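/- Let $N>1$ be an integer and let $b\in\mathbb C$ with $\operatorname{Re} b\neq 0$ and either $b\in\mathbb R$ or $|b|=1$ (equivalently $1+6(b+b^{-1})^2>1$). Indices $j$ of operators are taken in $\mathbb Z/2N$. On $L^2(\mathbb R^{2N})$ let $\mathsf q_j$ be multiplication by $x_j$ and $\mathsf p_j=(2\pi\mathsf i)^{-1}\partial/\partial x_j$; functions of real polynomials in the $\mathsf p_j,\mathsf q_j$ below are understood through the functional calculus of their self-adjoint closures from the Schwartz space. For a permutation $\sigma$ of $\mathbb Z/2N$ let $(\mathsf P_\sigma f)(x)=f((x_{\sigma(i)})_i)$. Put $$\varphi_b(z)=\exp\Big(\tfrac14\int_{\mathbb R+\mathsf i0}\frac{e^{-2\mathsf izw}\,dw}{\sinh(wb)\sinh(w/b)\,w}\Big),\qquad \zeta^x=e^{-\mathsf i\pi x(b+b^{-1})^2/12},$$ $$\mathsf A_k=e^{-\mathsf i\pi/3}e^{3\pi\mathsf i\mathsf q_k^2}e^{\mathsf i\pi(\mathsf p_k+\mathsf q_k)^2},\quad \mathsf T_{k,l}=e^{2\pi\mathsf i\mathsf p_k\mathsf q_l}\varphi_b(\mathsf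 q_k+\mathsf p_l-\mathsf q_l)^{-1},\quad \mathsf T_{k,\check l}=e^{-2\pi\mathsf i\mathsf p_k\mathsf p_l}\varphi_b(\mathsf q_k+\mathsf q_l)^{-1},$$ $$\mathsf D^{1/N}=\zeta^{-N-6/N}\,\mathsf P_{j\mapsto j+1}\prod_{k=1}^{2N}\mathsf A_k\prod_{l=1}^N\mathsf T_{2l+1,\check{2l}},\qquad \mathsf D=(\mathsf D^{1/N})^N .$$ Let $\mathcal A_N$ be the algebra generated by $\mathsf f_j$, $j\in\mathbb Z/2N$, with $[\mathsf f_m,\mathsf f_n]=(-1)^m(2\pi\mathsf i)^{-1}$ if $n=m\pm1$ and $0$ otherwise. Consider the annulus with $N$ marked points on each boundary component; its universal cover is a strip with marked points $b_n$ (bottom) and $t_n$ (top), $n\in\mathbb Z$, modulo $n\mapsto n+N$. Decorated ideal triangulations (up to isotopy) are those with $2N$ triangles labelled by $\mathbb Z/2N$, each with a distinguished corner; a triangle is written as its vertices in counterclockwise order, distinguished corner first. Let $\tau_N$ be the one with triangles $2m+1=(t_m,b_m,b_{m+1})$ and $2m+2=(b_{m+1},t_{m+1},t_m)$. The mapping classes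 $D^{1/N}$ and $D$ (the Dehn twist) fix the bottom boundary and shift the top boundary to the right by one, respectively $N$, spacings. In quantum Teichmüller theory a pair of decorated ideal triangulations is represented by operators $\mathsf F(\tau,\tau')$, up to phase, generated under $\mathsf F(\tau,\tau)\simeq1$, $\mathsf F(\tau,\tau')\mathsf F(\tau',\tau'')\simeq\mathsf F(\tau,\tau'')$ and $\mathsf F(\tau',\tau)\simeq\mathsf F(\tau,\tau')^{-1}$ by: $\mathsf P_\sigma$ for the relabelling $\tau'(k)=\tau(\sigma(k))$; $\mathsf A_i$ for moving the distinguished corner of triangle $i$ one step counterclockwise; $\mathsf T_{i,j}$, $i\ne j$, for the flip of $i=(L,B,U)$, $j=(B,R,U)$ to $i=(L,R,U)$, $j=(B,R,L)$. Then: 1. $\mathsf D^{1/N}$ is unitary, $\mathsf F(\tau_N,D^{1/N}(\tau_N))\simeq\mathsf D^{1/N}$, and $\mathsf F(\tau_N,D(\tau_N))\simeq\mathsf D$. 2. There is a realization $\kappa$ of $\mathcal A_N$ by operators on the Schwartz space of $\mathbb R^{2N}$ with $\kappa(\mathsf f_j)=\mathsf p_j+\mathsf p_{j-1}$ for $j$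 even and $\kappa(\mathsf f_j)=\mathsf q_j+\mathsf q_{j-1}$ for $j$ odd; the $\kappa(\mathsf f_j)$ are essentially self-adjoint, and $$\kappa(\mathsf G)=\zeta^{N+6/N}e^{2\pi\mathsf i\sum_{j=1}^N\mathsf p_{2j}\mathsf p_{2j+1}}\prod_{k=1}^{2N}\mathsf A_k^{-1}\,\mathsf P_{l\mapsto l-1}$$ is unitary and satisfies $\kappa(\mathsf G)\kappa(\mathsf f_j)=(-1)^j\kappa(\mathsf f_{j-1})\kappa(\mathsf G)$ (as self-adjoint operators, with domains). 3. For the light-cone evolution operator $\mathsf U_{lc}=\mathsf G\prod_{j=1}^N\varphi_b(\mathsf f_{2j})=\prod_{j=1}^N\varphi_b(\mathsf f_{2j-1})\,\mathsf G$ of the $2N$-periodic quantum discrete Liouville model, the images under $\kappa$ of both expressions coincide and $$\kappa(\mathsf U_{lc})=(\mathsf D^{1/N})^{-1},\qquad \kappa(\mathsf U_{lc})^N=\mathsf D^{-1}.$$ -/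

import Mathlib

open MeasureTheory
open scoped SchwartzMap LineDeriv

noncomputable section

namespace QuantumLiouville

/-! ## Hilbert space, Heisenberg operators, functional calculus -/

/-- Configuration space `ℝ^{2N}`, coordinates indexed by `ℤ/2N`. -/
abbrev Config (N : ℕ) : Type := EuclideanSpace ℝ (ZMod (2 * N))

/-- The Schwartz space of `ℝ^{2N}`, the common invariant core of all unbounded operators below. -/
abbrev Core (N : ℕ) [NeZero N] : Type := 𝓢(Config N, ℂ)

/-- The Hilbert space `L²(ℝ^{2N})`. -/
abbrev L2 (N : ℕ) [NeZero N] : Type := Lp (α := Config N) ℂ 2 volume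

/-- The position operator `q_j`: multiplication by the coordinate `x_j`. -/
def q {N : ℕ} [NeZero N] (j : ZMod (2 * N)) : Module.End ℂ (Core N) :=
  (SchwartzMap.smulLeftCLM ℂ (fun x : Config N => ((x j : ℝ) : ℂ))).toLinearMap

/-- The momentum operator `p_j = (2πi)⁻¹ ∂/∂x_j`. -/
def p {N : ℕ} [NeZero N] (j : ZMod (2 * N)) : Module.End ℂ (Core N) :=
  (2 * (Real.pi : ℂ) * Complex.I)⁻¹ •
    (LineDeriv.lineDerivOpCLM ℂ (Core N) (EuclideanSpace.single j (1 : ℝ))).toLinearMap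

/-- The inclusion of Schwartz functions into `L²`. -/
def coreIncl (N : ℕ) [NeZero N] : Core N →ₗ[ℂ] L2 N :=
  (SchwartzMap.toLpCLM ℂ (E := Config N) ℂ 2 volume).toLinearMap

theorem coreIncl_injective (N : ℕ) [NeZero N] : Function.Injective (coreIncl N) :=
  SchwartzMap.injective_toLp (E := Config N) (F := ℂ) 2 volume

/-- The closed operator in `L²(ℝ^{2N})` defined by an operator `T` on Schwartz functions: the
closure of `T` with domain the Schwartz space. -/
def closedOp {N : ℕ} [NeZero N] (T : Module.End ℂ (Core N)) : L2 N →ₗ.[ℂ] L2 N :=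
  LinearPMap.closure
    { domain := LinearMap.range (coreIncl N)
      toFun := coreIncl N ∘ₗ T ∘ₗ
        (LinearEquiv.ofInjective (coreIncl N) (coreIncl_injective N)).symm.toLinearMap }

/-- `B = g(A)` in the sense of the functional calculus of self-adjoint operators: some unitary map
`V` onto an `L²` space carries `A` to the operator of multiplication (with maximal domain) by a
real measurable function `a`, and carries `B` to multiplication by `g ∘ a`. -/
def IsFunctionOf {H : Type*} [NormedAddCommGroup H] [InnerProductSpace ℂ H]
    (A : H →ₗ.[ℂ] H) (g : ℝ → ℂ) (B : H →L[ℂ] H) : Prop :=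
  ∃ (X : Type) (_ : MeasurableSpace X) (μ : Measure X) (V : H ≃ₗᵢ[ℂ] Lp ℂ 2 μ) (a : X → ℝ),
    Measurable a ∧
    (∀ ψ χ : H, (ψ, χ) ∈ A.graph ↔
      (V χ : X → ℂ) =ᵐ[μ] fun x => ((a x : ℝ) : ℂ) * (V ψ : X → ℂ) x) ∧
    ∀ ψ : H, (V (B ψ) : X → ℂ) =ᵐ[μ] fun x => g (a x) * (V ψ : X → ℂ) x

open Classical in
/-- The bounded operator `g(A)`, where `A` is the closure of `T` (with the value `0` when there is
no such operator). -/
def fc {N : ℕ} [NeZero N] (g : ℝ → ℂ) (T : Module.End ℂ (Core N)) : L2 N →L[ℂ] L2 N :=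
  if h : ∃ B : L2 N →L[ℂ] L2 N, IsFunctionOf (closedOp T) g B then h.choose else 0

/-- The permutation operator `(P_σ f)(x) = f(i ↦ x_{σ(i)})`; it satisfies
`P_σ q_j P_σ⁻¹ = q_{σ(j)}` and `P_σ P_τ = P_{στ}`. -/
def P {N : ℕ} [NeZero N] (σ : Equiv.Perm (ZMod (2 * N))) : L2 N →L[ℂ] L2 N :=
  (Lp.compMeasurePreservingₗᵢ ℂ (LinearIsometryEquiv.piLpCongrLeft 2 ℝ ℝ σ.symm)
    (LinearIsometryEquiv.measurePreserving
      (LinearIsometryEquiv.piLpCongrLeft 2 ℝ ℝ σ.symm : Config N ≃ₗᵢ[ℝ] Config N))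
    ).toContinuousLinearMap

/-- The ordered product `F 1 * F 2 * ⋯ * F n`, from left to right. -/
def prodUpTo {M : Type*} [Monoid M] (n : ℕ) (F : ℕ → M) : M :=
  ((List.range n).map fun i => F (i + 1)).prod

/-! ## The noncompact quantum dilogarithm and the elementary operators -/

/-- A height at which the line `Im w = const` runs strictly between the pole `w = 0` and the
nonzero poles (of the form `iπn b^{±1}`) of the integrand of the quantum dilogarithm. By Cauchy's
theorem any smaller positive height defines the same integral, so this is the
contour `ℝ + i0`. -/
def contourHeight (b : ℂ) : ℝ := min |b.re| |(b⁻¹).re|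

/-- The noncompact quantum dilogarithm
`φ_b(z) = exp (1/4 ∫_{ℝ + i0} e^{-2izw} / (sinh(wb) sinh(w/b) w) dw)`. -/
def phi (b : ℂ) (z : ℝ) : ℂ :=
  Complex.exp ((1 / 4 : ℂ) * ∫ u : ℝ,
    (fun w : ℂ => Complex.exp (-2 * Complex.I * (z : ℂ) * w) /
      (Complex.sinh (w * b) * Complex.sinh (w / b) * w))
      ((u : ℂ) + (contourHeight b : ℂ) * Complex.I))

/-- The power `ζ^x` of `ζ = exp(-iπ(b + b⁻¹)²/12)`. -/
def zetaPow (b : ℂ) (x : ℝ) : ℂ :=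
  Complex.exp (-(Complex.I * (Real.pi : ℂ) * (b + b⁻¹) ^ 2 / 12) * (x : ℂ))

variable {N : ℕ} [NeZero N]

/-- `A_k = e^{-iπ/3} e^{3πi q_k²} e^{iπ(p_k + q_k)²}`. -/
def A (k : ZMod (2 * N)) : L2 N →L[ℂ] L2 N :=
  Complex.exp (-(Complex.I * (Real.pi : ℂ) / 3)) •
    (fc (fun x => Complex.exp (3 * (Real.pi : ℂ) * Complex.I * (x : ℂ) ^ 2)) (q k) *
      fc (fun x => Complex.exp ((Real.pi : ℂ) * Complex.I * (x : ℂ) ^ 2)) (p k + q k))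

/-- `T_{k,l} = e^{2πi p_k q_l} φ_b(q_k + p_l - q_l)⁻¹`. -/
def T (b : ℂ) (k l : ZMod (2 * N)) : L2 N →L[ℂ] L2 N :=
  fc (fun x => Complex.exp (2 * (Real.pi : ℂ) * Complex.I * (x : ℂ))) (p k * q l) *
    fc (fun x => (phi b x)⁻¹) (q k + p l - q l)

/-- `T_{k,ľ} = e^{-2πi p_k p_l} φ_b(q_k + q_l)⁻¹`. -/
def Tcheck (b : ℂ) (k l : ZMod (2 * N)) : L2 N →L[ℂ] L2 N :=
  fc (fun x => Complex.exp (-(2 * (Real.pi : ℂ) * Complex.I * (x : ℂ)))) (p k * p l) *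
    fc (fun x => (phi b x)⁻¹) (q k + q l)

variable (N) in
/-- The fractional Dehn twist operator
`D^{1/N} = ζ^{-N-6/N} P_{(…,j,j+1,…)} ∏_{k=1}^{2N} A_k ∏_{l=1}^N T_{2l+1,\check{2l}}`. -/
def fracDehnOp (b : ℂ) : L2 N →L[ℂ] L2 N :=
  zetaPow b (-(N : ℝ) - 6 / (N : ℝ)) •
    (P (Equiv.addRight (1 : ZMod (2 * N))) *
      prodUpTo (2 * N) (fun k => A (N := N) (k : ZMod (2 * N))) *
      prodUpTo N (fun l => Tcheck b (2 * (l : ZMod (2 * N)) + 1) (2 * (l : ZMod (2 * N)))))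

variable (N) in
/-- The Dehn twist operator `D = (D^{1/N})^N`. -/
def dehnOp (b : ℂ) : L2 N →L[ℂ] L2 N := fracDehnOp N b ^ N

/-! ## The quantum discrete Liouville system -/

variable (N) in
/-- The structure constants of the observable algebra: `[f_m, f_n] = commConst m n`. -/
def commConst (m n : ZMod (2 * N)) : ℂ :=
  if n = m + 1 ∨ n = m - 1 then (-1) ^ m.val * (2 * (Real.pi : ℂ) * Complex.I)⁻¹ else 0

/-- The defining relations of the observable algebra. -/
inductive ObsRel (N : ℕ) :
    FreeAlgebra ℂ (ZMod (2 * N)) → FreeAlgebra ℂ (ZMod (2 * N)) → Prop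
  | comm (m n : ZMod (2 * N)) :
      ObsRel N
        (FreeAlgebra.ι ℂ m * FreeAlgebra.ι ℂ n - FreeAlgebra.ι ℂ n * FreeAlgebra.ι ℂ m)
        (algebraMap ℂ _ (commConst N m n))

/-- The observable algebra: generators `f_j`, `j ∈ ℤ/2N`, with the above commutation relations. -/
abbrev ObsAlgebra (N : ℕ) : Type := RingQuot (ObsRel N)

/-- The generator `f_j`. -/
def f (j : ZMod (2 * N)) : ObsAlgebra N :=
  RingQuot.mkAlgHom ℂ (ObsRel N) (FreeAlgebra.ι ℂ j)

variable (N) in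
/-- The operator `κ(G) = ζ^{N+6/N} e^{2πi ∑_{j=1}^N p_{2j} p_{2j+1}} ∏_{k=1}^{2N} A_k⁻¹
P_{(…,l,l-1,…)}`. -/
def kappaG (b : ℂ) : L2 N →L[ℂ] L2 N :=
  zetaPow b ((N : ℝ) + 6 / (N : ℝ)) •
    (fc (fun x => Complex.exp (2 * (Real.pi : ℂ) * Complex.I * (x : ℂ)))
        (∑ j ∈ Finset.Icc 1 N,
          p (N := N) (2 * (j : ZMod (2 * N))) * p (2 * (j : ZMod (2 * N)) + 1)) *
      prodUpTo (2 * N) (fun k => Ring.inverse (A (N := N) (k : ZMod (2 * N)))) *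
      P (Equiv.subRight (1 : ZMod (2 * N))))

/-- The image of `U_lc = G ∏_{j=1}^N φ_b(f_{2j})` under a realization `κ` of the `f_j` and `κG`
of `G`. -/
def evolEven (b : ℂ) (κ : ObsAlgebra N →ₐ[ℂ] Module.End ℂ (Core N)) (κG : L2 N →L[ℂ] L2 N) :
    L2 N →L[ℂ] L2 N :=
  κG * prodUpTo N (fun j => fc (phi b) (κ (f (2 * (j : ZMod (2 * N))))))

/-- The image of `U_lc = ∏_{j=1}^N φ_b(f_{2j-1}) G` under a realization `κ` of the `f_j` and `κG`
of `G`. -/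
def evolOdd (b : ℂ) (κ : ObsAlgebra N →ₐ[ℂ] Module.End ℂ (Core N)) (κG : L2 N →L[ℂ] L2 N) :
    L2 N →L[ℂ] L2 N :=
  prodUpTo N (fun j => fc (phi b) (κ (f (2 * (j : ZMod (2 * N)) - 1)))) * κG

/-! ## Decorated ideal triangulations of the annulus

The universal cover of the annulus with `N` marked points on each boundary component is the strip
`ℝ × [0,1]` with marked points at the integers of both boundary lines; the deck group is generated
by the horizontal translation by `N`. An isotopy class of ideal triangles in the strip is
determined by the three vertices. -/

/-- Marked points of the strip. -/
inductive MarkedPoint : Type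
  | bot (n : ℤ) : MarkedPoint
  | top (n : ℤ) : MarkedPoint

namespace MarkedPoint

/-- The boundary order of the strip, counterclockwise starting at the left end. -/
def Before : MarkedPoint → MarkedPoint → Prop
  | bot m, bot n => m < n
  | bot _, top _ => True
  | top _, bot _ => False
  | top m, top n => n < m

/-- Three distinct marked points in counterclockwise cyclic order. -/
def CCW (x y z : MarkedPoint) : Prop :=
  (Before x y ∧ Before y z) ∨ (Before y z ∧ Before z x) ∨ (Before z x ∧ Before x y)

/-- Horizontal translation by `k`. -/
def shift (k : ℤ) : MarkedPoint → MarkedPoint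
  | bot n => bot (n + k)
  | top n => top (n + k)

/-- Rotation of the top boundary with respect to the bottom by `k` spacings to the right
(the action on marked points of the homeomorphism `(x, y) ↦ (x + k y, y)` of the strip). -/
def rotateTop (k : ℤ) : MarkedPoint → MarkedPoint
  | bot n => bot n
  | top n => top (n + k)

theorem before_rotateTop (k : ℤ) (x y : MarkedPoint) :
    Before (rotateTop k x) (rotateTop k y) ↔ Before x y := by
  cases x <;> cases y <;> simp [rotateTop, Before]

theorem ccw_rotateTop (k : ℤ) (x y z : MarkedPoint) :
    CCW (rotateTop k x) (rotateTop k y) (rotateTop k z) ↔ CCW x y z := by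
  simp [CCW, before_rotateTop]

theorem rotateTop_shift (k l : ℤ) (x : MarkedPoint) :
    rotateTop k (shift l x) = shift l (rotateTop k x) := by
  cases x <;> simp [rotateTop, shift]; ring

theorem rotateTop_neg (k : ℤ) (x : MarkedPoint) : rotateTop k (rotateTop (-k) x) = x := by
  cases x <;> simp [rotateTop]

theorem rotateTop_neg' (k : ℤ) (x : MarkedPoint) : rotateTop (-k) (rotateTop k x) = x := by
  cases x <;> simp [rotateTop]

theorem rotateTop_inj (k : ℤ) (x y : MarkedPoint) :
    rotateTop k x = rotateTop k y ↔ x = y :=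
  ⟨fun h => by rw [← rotateTop_neg' k x, h, rotateTop_neg'], fun h => by rw [h]⟩

end MarkedPoint

open MarkedPoint

/-- A decorated ideal triangle of the strip: its vertices in counterclockwise order, starting with
the distinguished corner. -/
abbrev Triple : Type := Fin 3 → MarkedPoint

/-- The ideal triangles `s` and `t` have disjoint interiors: all vertices of `t` are on the outer
side of some edge of `s`. -/
def InteriorsDisjoint (s t : Triple) : Prop :=
  ∃ i : Fin 3, ∀ j : Fin 3, t j = s i ∨ t j = s (i + 1) ∨ CCW (s i) (t j) (s (i + 1))

/-- Two decorated triangles of the strip cover the same triangle of the annulus. -/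
def deckSetoid (N : ℕ) : Setoid Triple where
  r s t := ∃ k : ℤ, ∀ i, t i = shift (N * k) (s i)
  iseqv :=
    { refl := fun s => ⟨0, fun i => by cases h : s i <;> simp [shift]⟩
      symm := by
        rintro s t ⟨k, h⟩
        refine ⟨-k, fun i => ?_⟩
        rw [h i]
        cases s i <;> simp [shift]
      trans := by
        rintro s t u ⟨k, h⟩ ⟨l, h'⟩
        refine ⟨k + l, fun i => ?_⟩
        rw [h' i, h i]
        cases s i <;> simp [shift] <;> ring }

/-- Decorated triangles in the annulus, up to isotopy, as deck orbits of triples. -/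
def AnnTriangle (N : ℕ) : Type := Quotient (deckSetoid N)

/-- The image in the annulus of a decorated triangle of the strip. -/
def toAnn (N : ℕ) (s : Triple) : AnnTriangle N := Quotient.mk (deckSetoid N) s

/-- The action of the rotation of the top boundary on decorated triangles of the annulus. -/
def AnnTriangle.rotateTop {N : ℕ} (k : ℤ) : AnnTriangle N → AnnTriangle N :=
  Quotient.map (sa := deckSetoid N) (sb := deckSetoid N)
    (fun s i => MarkedPoint.rotateTop k (s i))
    (by
      rintro s t ⟨l, h⟩
      exact ⟨l, fun i => by simp only [h i, rotateTop_shift]⟩)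

/-- A decorated ideal triangulation of the annulus (up to isotopy): `2N` labelled decorated
triangles, all of whose lifts to the strip have pairwise disjoint interiors. (Every ideal
triangulation of this annulus has `2N` triangles and `2N` triangles with disjoint interiors
fill it.) -/
@[ext] structure DecTriangulation (N : ℕ) where
  tri : ZMod (2 * N) → AnnTriangle N
  ccw : ∀ k s, toAnn N s = tri k → CCW (s 0) (s 1) (s 2)
  disjoint : ∀ k l s t, toAnn N s = tri k → toAnn N t = tri l → (k ≠ l ∨ s ≠ t) →
    InteriorsDisjoint s t

theorem toAnn_eq_rotateTop {N : ℕ} (m : ℤ) (s : Triple) (c : AnnTriangle N)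
    (h : toAnn N s = c.rotateTop m) :
    toAnn N (fun i => MarkedPoint.rotateTop (-m) (s i)) = c := by
  induction c using Quotient.inductionOn with
  | h u =>
    obtain ⟨l, hl⟩ := Quotient.exact (s := deckSetoid N) h
    refine Quotient.sound (s := deckSetoid N) ⟨l, fun i => ?_⟩
    have := hl i
    simp only at this
    rw [← rotateTop_shift, ← this, rotateTop_neg']

/-- The image of a decorated ideal triangulation under the mapping class of the annulus that
rotates the top boundary by `m` spacings to the right: `m = 1` is the fractional Dehn twist
`D^{1/N}`, and `m = N`, a full turn, is the Dehn twist `D`. -/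
def DecTriangulation.rotateTop {N : ℕ} (m : ℤ) (τ : DecTriangulation N) : DecTriangulation N where
  tri k := (τ.tri k).rotateTop m
  ccw k s h := by
    have := τ.ccw k _ (toAnn_eq_rotateTop m s _ h)
    rwa [ccw_rotateTop] at this
  disjoint k l s t hs ht hne := by
    have hne' : k ≠ l ∨ (fun i => MarkedPoint.rotateTop (-m) (s i)) ≠
        (fun i => MarkedPoint.rotateTop (-m) (t i)) := by
      refine hne.imp id fun h h' => h (funext fun i => ?_)
      exact (rotateTop_inj (-m) _ _).1 (congrFun h' i)
    obtain ⟨i, hi⟩ := τ.disjoint k l _ _ (toAnn_eq_rotateTop m s _ hs)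
      (toAnn_eq_rotateTop m t _ ht) hne'
    refine ⟨i, fun j => ?_⟩
    simpa only [rotateTop_inj, ccw_rotateTop] using hi j

/-- The lift of the standard triangulation: the square with lower left corner `m` is cut by the
diagonal from its upper left to its lower right corner; the lower triangle has number `2m+1` and
is marked at `top m`, the upper one has number `2m+2` and is marked at `bot (m+1)`. -/
def stdLift (n : ℤ) : Triple :=
  if n % 2 = 1 then ![.top (n / 2), .bot (n / 2), .bot (n / 2 + 1)]
  else ![.bot (n / 2), .top (n / 2), .top (n / 2 - 1)]

theorem stdLift_odd (m : ℤ) : stdLift (2 * m + 1) = ![.top m, .bot m, .bot (m + 1)] := by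
  have h1 : (2 * m + 1) % 2 = 1 := by omega
  have h2 : (2 * m + 1) / 2 = m := by omega
  simp [stdLift, h1, h2]

theorem stdLift_even (m : ℤ) : stdLift (2 * m) = ![.bot m, .top m, .top (m - 1)] := by
  have h2 : (2 * m) / 2 = m := by omega
  simp [stdLift, h2]

theorem stdLift_shift (N : ℕ) (n k : ℤ) (i : Fin 3) :
    shift (N * k) (stdLift n i) = stdLift (n + 2 * N * k) i := by
  obtain ⟨m, rfl | rfl⟩ : ∃ m, n = 2 * m ∨ n = 2 * m + 1 := ⟨n / 2, by omega⟩
  · rw [show 2 * m + 2 * N * k = 2 * (m + N * k) by ring, stdLift_even, stdLift_even]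
    fin_cases i <;> simp [shift]; ring
  · rw [show 2 * m + 1 + 2 * N * k = 2 * (m + N * k) + 1 by ring, stdLift_odd, stdLift_odd]
    fin_cases i <;> simp [shift]; ring

theorem stdLift_ccw (n : ℤ) : CCW (stdLift n 0) (stdLift n 1) (stdLift n 2) := by
  obtain ⟨m, rfl | rfl⟩ : ∃ m, n = 2 * m ∨ n = 2 * m + 1 := ⟨n / 2, by omega⟩
  · rw [stdLift_even]; simp [CCW, Before]
  · rw [stdLift_odd]; simp [CCW, Before]

theorem stdLift_disjoint (n n' : ℤ) (h : n ≠ n') :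
    InteriorsDisjoint (stdLift n) (stdLift n') := by
  obtain ⟨m, rfl | rfl⟩ : ∃ m, n = 2 * m ∨ n = 2 * m + 1 := ⟨n / 2, by omega⟩ <;>
  obtain ⟨m', rfl | rfl⟩ : ∃ m, n' = 2 * m ∨ n' = 2 * m + 1 := ⟨n' / 2, by omega⟩
  · rcases lt_or_gt_of_ne (show m ≠ m' by omega) with h' | h'
    · refine ⟨0, fun j => ?_⟩
      rw [stdLift_even, stdLift_even]
      fin_cases j <;> simp [CCW, Before] <;> omega
    · refine ⟨2, fun j => ?_⟩
      rw [stdLift_even, stdLift_even]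
      fin_cases j <;> simp [CCW, Before] <;> omega
  · rcases lt_or_ge m' m with h' | h'
    · refine ⟨2, fun j => ?_⟩
      rw [stdLift_even, stdLift_odd]
      fin_cases j <;> simp [CCW, Before] <;> omega
    · refine ⟨0, fun j => ?_⟩
      rw [stdLift_even, stdLift_odd]
      fin_cases j <;> simp [CCW, Before] <;> omega
  · rcases lt_or_ge m m' with h' | h'
    · refine ⟨2, fun j => ?_⟩
      rw [stdLift_even, stdLift_odd]
      fin_cases j <;> simp [CCW, Before] <;> omega
    · refine ⟨0, fun j => ?_⟩
      rw [stdLift_even, stdLift_odd]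
      fin_cases j <;> simp [CCW, Before] <;> omega
  · rcases lt_or_gt_of_ne (show m ≠ m' by omega) with h' | h'
    · refine ⟨2, fun j => ?_⟩
      rw [stdLift_odd, stdLift_odd]
      fin_cases j <;> simp [CCW, Before] <;> omega
    · refine ⟨0, fun j => ?_⟩
      rw [stdLift_odd, stdLift_odd]
      fin_cases j <;> simp [CCW, Before] <;> omega

theorem lift_of_toAnn {N : ℕ} (s : Triple) (n : ℤ) (h : toAnn N s = toAnn N (stdLift n)) :
    ∃ k : ℤ, s = stdLift (n + 2 * N * k) := by
  obtain ⟨k, hk⟩ := Quotient.exact (s := deckSetoid N) h.symm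
  exact ⟨k, funext fun i => by rw [hk i, stdLift_shift]⟩

variable (N) in
/-- The standard decorated ideal triangulation `τ_N` of the annulus. -/
def stdTriangulation : DecTriangulation N where
  tri k := toAnn N (stdLift k.val)
  ccw k s h := by
    obtain ⟨l, rfl⟩ := lift_of_toAnn s _ h
    exact stdLift_ccw _
  disjoint k l s t hs ht hne := by
    obtain ⟨a, rfl⟩ := lift_of_toAnn s _ hs
    obtain ⟨c, rfl⟩ := lift_of_toAnn t _ ht
    refine stdLift_disjoint _ _ fun h => ?_
    rcases hne with hne | hne
    · apply hne
      have h2 := congrArg (fun n : ℤ => (n : ZMod (2 * N))) h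
      have h0 : (2 * (N : ZMod (2 * N))) = 0 := by exact_mod_cast ZMod.natCast_self (2 * N)
      simpa [h0] using h2
    · exact hne (by rw [h])

/-! ## Quantum Teichmüller theory of the annulus -/

/-- `Quantizes b τ τ' X`: the operator `X` represents, up to a phase, the change of decorated
ideal triangulation from `τ` to `τ'` in quantum Teichmüller theory, `F(τ, τ') ≃ X`. It is generated
by the three elementary transformations:
* relabelling by `σ` is represented by `P_σ`;
* `ρ_i`, moving the distinguished corner of the triangle `i` one step counterclockwise, is
  represented by `A_i`;
* `ω_{ij}`, the flip of the common edge `BT` of the triangles `i = (L,B,T)` and `j = (B,R,T)` to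
  `i = (L,R,T)` and `j = (B,R,L)` (distinguished corners first), is represented by `T_{ij}`;
together with `F(τ, τ) ≃ 1`, `F(τ, τ') F(τ', τ'') ≃ F(τ, τ'')` and `F(τ', τ) ≃ F(τ, τ')⁻¹`. -/
inductive Quantizes (b : ℂ) :
    DecTriangulation N → DecTriangulation N → (L2 N →L[ℂ] L2 N) → Prop
  | relabel (τ τ' : DecTriangulation N) (σ : Equiv.Perm (ZMod (2 * N)))
      (h : ∀ k, τ'.tri k = τ.tri (σ k)) : Quantizes b τ τ' (P σ)
  | rho (τ τ' : DecTriangulation N) (i : ZMod (2 * N)) (s : Triple)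
      (h : τ.tri i = toAnn N s)
      (h' : τ'.tri = Function.update τ.tri i (toAnn N ![s 1, s 2, s 0])) :
      Quantizes b τ τ' (A i)
  | omega (τ τ' : DecTriangulation N) (i j : ZMod (2 * N)) (hij : i ≠ j)
      (L B R U : MarkedPoint)
      (hi : τ.tri i = toAnn N ![L, B, U]) (hj : τ.tri j = toAnn N ![B, R, U])
      (h' : τ'.tri = Function.update (Function.update τ.tri i (toAnn N ![L, R, U])) j
        (toAnn N ![B, R, L])) :
      Quantizes b τ τ' (T b i j)
  | refl (τ : DecTriangulation N) : Quantizes b τ τ 1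
  | trans (τ τ' τ'' : DecTriangulation N) (X Y : L2 N →L[ℂ] L2 N)
      (hX : Quantizes b τ τ' X) (hY : Quantizes b τ' τ'' Y) : Quantizes b τ τ'' (X * Y)
  | symm (τ τ' : DecTriangulation N) (X : L2 N →L[ℂ] L2 N)
      (hX : Quantizes b τ τ' X) : Quantizes b τ' τ (Ring.inverse X)
  | phase (τ τ' : DecTriangulation N) (X : L2 N →L[ℂ] L2 N) (c : ℂ) (hc : ‖c‖ = 1)
      (hX : Quantizes b τ τ' X) : Quantizes b τ τ' (c • X)

end QuantumLiouville

end

noncomputable section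

namespace QuantumLiouville

section

/-! ## Bounded multiplication operators on `L²` and uniqueness of the functional calculus -/

section Multiplication

variable {X : Type*} [MeasurableSpace X] {μ : Measure X}

/-! Everything rests on conjugation rules for `p` and `q` on the Schwartz space, once the functional
calculus can be trusted. Since `fc` is defined by choice, two facts are needed. Uniqueness: two
diagonalizations of the same operator give every vector the same spectral measure, because that
measure is tested by the bounded continuous functions that the transition unitary carries over, and
these include the resolvent function (`IsFunctionOf.unique`). Existence: all operators that occur
become multiplication by a real function `a` of temperate growth under a unitary preserving the
Schwartz space. As `(a + i)⁻¹` preserves that space, the closure from it is the maximal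
multiplication operator, hence self-adjoint (`DiagonalizedOnCore.isDiagonalizedBy`). It follows that
an identity `s S = T s` on Schwartz functions passes to closures and to functions of the operators
(`semiconjBy_fc`), so all later work is algebra.

Gaussian phases, the Fourier transform and permutations give the action of `A_k` (`p ↦ -q`, `q ↦ p -
q`) and of `exp (2πi p_k p_l)`, and with them the action of `κ(G)` on the `f_j`
(`exists_implementer_kappaG`). The dilogarithm has modulus one on the real line by the symmetry of
its integrand (`norm_phi`). In the product of the odd form of the evolution operator with `D^{1/N}`
the scalars, shifts, `A_k` and exponentials cancel in turn; there remain dilogarithms of commuting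
arguments and their inverses, which match after a cyclic shift
(`prod_fc_phi_mul_kappaG_mul_fracDehnOp`). Covariance under `κ(G)` identifies the even form with the
odd one (`kappaG_mul_prod_fc_phi`).

On the geometric side the factors of `D^{1/N}` spell a path of elementary moves: relabel the
triangles, move every distinguished corner, then flip the diagonals of the `N` squares in turn. Each
flip is a `T` conjugated by `A`, which is `Tcheck` (`inverse_A_mul_T_mul_A`,
`Quantizes.flipUpTo_succ`), and once all are flipped the triangulation is the rotated standard one.
The moves are natural under rotation of the top boundary, so the path can be repeated `N` times to
reach the full Dehn twist (`Quantizes.rotateTop`, `Quantizes.pow`). -/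

theorem memLp_mul_of_bounded {g : X → ℂ} (hg : Measurable g) {C : ℝ} (hC : ∀ x, ‖g x‖ ≤ C)
    (u : Lp ℂ 2 μ) : MemLp (fun x => g x * u x) 2 μ :=
  (Lp.memLp u).of_le_mul (c := C)
    (hg.aestronglyMeasurable.mul (Lp.aestronglyMeasurable u))
    (Filter.Eventually.of_forall fun x => by
      rw [norm_mul]
      exact mul_le_mul_of_nonneg_right (hC x) (norm_nonneg _))

variable (μ) in
/-- Multiplication by a bounded measurable function as an operator on `L²`. -/
def mulCLM (g : X → ℂ) (hg : Measurable g) (hC : ∃ C, ∀ x, ‖g x‖ ≤ C) :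
    Lp ℂ 2 μ →L[ℂ] Lp ℂ 2 μ :=
  LinearMap.mkContinuousOfExistsBound
    { toFun := fun u => (memLp_mul_of_bounded hg hC.choose_spec u).toLp _
      map_add' := fun u v => by
        rw [← MemLp.toLp_add]
        refine MemLp.toLp_congr _ _ ?_
        filter_upwards [Lp.coeFn_add u v] with x hx
        simp only [hx, Pi.add_apply, mul_add]
      map_smul' := fun c u => by
        rw [RingHom.id_apply, ← MemLp.toLp_const_smul]
        refine MemLp.toLp_congr _ _ ?_
        filter_upwards [Lp.coeFn_smul c u] with x hx
        simp only [hx, Pi.smul_apply, smul_eq_mul]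
        ring }
    ⟨hC.choose, fun u => by
      refine Lp.norm_le_mul_norm_of_ae_le_mul ?_
      filter_upwards [(memLp_mul_of_bounded hg hC.choose_spec u).coeFn_toLp] with x hx
      simp only [LinearMap.coe_mk, AddHom.coe_mk, hx, norm_mul]
      exact mul_le_mul_of_nonneg_right (hC.choose_spec x) (norm_nonneg _)⟩

theorem coeFn_mulCLM {g : X → ℂ} (hg : Measurable g) (hC : ∃ C, ∀ x, ‖g x‖ ≤ C) (u : Lp ℂ 2 μ) :
    mulCLM μ g hg hC u =ᵐ[μ] fun x => g x * u x :=
  (memLp_mul_of_bounded hg hC.choose_spec u).coeFn_toLp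

theorem eq_mulCLM_iff {g : X → ℂ} (hg : Measurable g) (hC : ∃ C, ∀ x, ‖g x‖ ≤ C)
    (u v : Lp ℂ 2 μ) : v = mulCLM μ g hg hC u ↔ v =ᵐ[μ] fun x => g x * u x :=
  ⟨fun h => h ▸ coeFn_mulCLM hg hC u, fun h => Lp.ext (h.trans (coeFn_mulCLM hg hC u).symm)⟩

theorem measurable_star_comp {Z : Type*} [MeasurableSpace Z] {g : Z → ℂ} (hg : Measurable g) :
    Measurable fun x => star (g x) :=
  continuous_star.measurable.comp hg

theorem inner_mulCLM_left {g : X → ℂ} (hg : Measurable g) (hC : ∃ C, ∀ x, ‖g x‖ ≤ C)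
    (hC' : ∃ C, ∀ x, ‖star (g x)‖ ≤ C) (u v : Lp ℂ 2 μ) :
    inner ℂ (mulCLM μ g hg hC u) v =
      inner ℂ u (mulCLM μ (fun x => star (g x)) (measurable_star_comp hg) hC' v) := by
  rw [L2.inner_def, L2.inner_def]
  refine integral_congr_ae ?_
  filter_upwards [coeFn_mulCLM hg hC u, coeFn_mulCLM (measurable_star_comp hg) hC' v] with x h1 h2
  simp only [h1, h2, RCLike.inner_apply, map_mul, starRingEnd_apply]
  ring

/-- The spectral measure of the operator of multiplication by `a` at the vector `u`. -/
def spectralMeasure (a : X → ℝ) (u : Lp ℂ 2 μ) : Measure ℝ :=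
  (μ.withDensity fun x => ((‖u x‖₊ ^ 2 : NNReal) : ENNReal)).map a

theorem measurable_nnnorm_sq (u : Lp ℂ 2 μ) : Measurable fun x => ‖u x‖₊ ^ 2 :=
  (Lp.stronglyMeasurable u).measurable.nnnorm.pow_const 2

instance isFiniteMeasure_spectralMeasure (a : X → ℝ) (u : Lp ℂ 2 μ) :
    IsFiniteMeasure (spectralMeasure a u) := by
  have : IsFiniteMeasure (μ.withDensity fun x => ((‖u x‖₊ ^ 2 : NNReal) : ENNReal)) := by
    refine isFiniteMeasure_withDensity ?_
    have h := (Lp.memLp u).eLpNorm_lt_top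
    rw [eLpNorm_lt_top_iff_lintegral_rpow_enorm_lt_top (by simp) (by simp)] at h
    simpa [enorm_eq_nnnorm] using h.ne
  unfold spectralMeasure
  infer_instance

/-- The inner product is the integral of `h ∘ a` against `|u|²`, and `a` pushes this density forward
to the spectral measure. The quadratic form of a function of the operator thus depends on the
spectral measures alone. -/
theorem inner_eq_integral_spectralMeasure {a : X → ℝ} (ha : Measurable a) {h : ℝ → ℂ}
    (hh : Measurable h) {u v : Lp ℂ 2 μ} (hv : v =ᵐ[μ] fun x => h (a x) * u x) :
    inner ℂ u v = ∫ t, h t ∂(spectralMeasure a u) := by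
  rw [spectralMeasure, integral_map ha.aemeasurable hh.aestronglyMeasurable,
    integral_withDensity_eq_integral_smul (measurable_nnnorm_sq u), L2.inner_def]
  refine integral_congr_ae ?_
  filter_upwards [hv] with x hx
  rw [hx, RCLike.inner_apply, mul_assoc, RCLike.mul_conj, NNReal.smul_def]
  simp [mul_comm]

end Multiplication

/-! ### Spectral measures do not depend on the diagonalization -/

section Uniqueness

variable {X Y : Type*} [MeasurableSpace X] [MeasurableSpace Y] {μ : Measure X} {ν : Measure Y}

theorem exists_bound_comp {Z : Type*} (h : BoundedContinuousFunction ℝ ℂ) (a : Z → ℝ) :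
    ∃ C, ∀ x, ‖(h (a x))‖ ≤ C :=
  ⟨‖h‖, fun _ => h.norm_coe_le_norm _⟩

theorem exists_bound_star_comp {Z : Type*} (h : BoundedContinuousFunction ℝ ℂ) (a : Z → ℝ) :
    ∃ C, ∀ x, ‖star (h (a x))‖ ≤ C :=
  ⟨‖h‖, fun _ => by rw [norm_star]; exact h.norm_coe_le_norm _⟩

variable (W : Lp ℂ 2 μ ≃ₗᵢ[ℂ] Lp ℂ 2 ν) {a : X → ℝ} {c : Y → ℝ}

/-- `W` carries multiplication by `h ∘ a` to multiplication by `h ∘ c`. -/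
def CarriesMul (a : X → ℝ) (c : Y → ℝ) (h : ℝ → ℂ) : Prop :=
  ∀ u v : Lp ℂ 2 μ, (v =ᵐ[μ] fun x => h (a x) * u x) → W v =ᵐ[ν] fun y => h (c y) * W u y

/-- The bounded continuous functions of `a` carried by `W` to the same function of `c`. -/
def carriedSubalgebra (ha : Measurable a) (hc : Measurable c) :
    StarSubalgebra ℂ (BoundedContinuousFunction ℝ ℂ) where
  carrier := {h | CarriesMul W a c h}
  mul_mem' {h k} hh hk u v huv := by
    have hm : Measurable fun x => h (a x) := h.continuous.measurable.comp ha
    have km : Measurable fun x => k (a x) := k.continuous.measurable.comp ha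
    set w := mulCLM μ (fun x => k (a x)) km (exists_bound_comp k a) u
    have hw := coeFn_mulCLM km (exists_bound_comp k a) u
    have h1 := hk u w hw
    have h2 := hh w v (by
      filter_upwards [huv, hw] with x h1 h2
      rw [h1, h2]
      simp [mul_assoc])
    filter_upwards [h1, h2] with y h1 h2
    rw [h2, h1]
    simp [mul_assoc]
  one_mem' u v huv := by
    have : v = u := Lp.ext (by simpa using huv)
    simp [this]
  add_mem' {h k} hh hk u v huv := by
    have hm : Measurable fun x => h (a x) := h.continuous.measurable.comp ha
    have km : Measurable fun x => k (a x) := k.continuous.measurable.comp ha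
    have hw := coeFn_mulCLM km (exists_bound_comp k a) u
    have hz := coeFn_mulCLM hm (exists_bound_comp h a) u
    set w := mulCLM μ (fun x => k (a x)) km (exists_bound_comp k a) u
    set z := mulCLM μ (fun x => h (a x)) hm (exists_bound_comp h a) u
    have h1 := hk u w hw
    have h2 := hh u z hz
    have hv : v = z + w := Lp.ext (by
      filter_upwards [huv, hw, hz, Lp.coeFn_add z w] with x h1 h2 h3 h4
      rw [h1, h4, Pi.add_apply, h2, h3]
      simp [add_mul])
    rw [hv, map_add]
    filter_upwards [h1, h2, Lp.coeFn_add (W z) (W w)] with y h1 h2 h3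
    rw [h3, Pi.add_apply, h1, h2]
    simp [add_mul]
  zero_mem' u v huv := by
    have : v = 0 := Lp.ext (by
      filter_upwards [huv, Lp.coeFn_zero ℂ 2 μ] with x h1 h2
      rw [h1, h2]
      exact zero_mul _)
    rw [this, map_zero]
    filter_upwards [Lp.coeFn_zero ℂ 2 ν] with x h1
    exact h1.trans (zero_mul _).symm
  algebraMap_mem' r u v huv := by
    have : v = r • u := Lp.ext (by
      filter_upwards [huv, Lp.coeFn_smul r u] with x h1 h2
      simpa [h2] using h1)
    rw [this, map_smul]
    filter_upwards [Lp.coeFn_smul r (W u)] with x h1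
    simp [h1]
  star_mem' {h} hh u v huv := by
    have hm : Measurable fun x => h (a x) := h.continuous.measurable.comp ha
    have hm' : Measurable fun x => h (c x) := h.continuous.measurable.comp hc
    suffices W v = mulCLM ν (fun y => star (h (c y))) (measurable_star_comp hm')
        (exists_bound_star_comp h c) (W u) from
      (eq_mulCLM_iff (measurable_star_comp hm') (exists_bound_star_comp h c) (W u) (W v)).1 this
    -- Since `W` is unitary and intertwines multiplication by `h ∘ a` and `h ∘ c`, it intertwines
    -- their adjoints; this is checked by pairing with an arbitrary `W x`.
    refine ext_inner_left ℂ fun x => ?_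
    obtain ⟨x, rfl⟩ := W.surjective x
    have h1 := hh x _ (coeFn_mulCLM hm (exists_bound_comp h a) x)
    rw [LinearIsometryEquiv.inner_map_map,
      ← inner_mulCLM_left hm' (exists_bound_comp h c) (exists_bound_star_comp h c),
      ← (eq_mulCLM_iff hm' (exists_bound_comp h c) _ _).2 h1, LinearIsometryEquiv.inner_map_map,
      inner_mulCLM_left hm (exists_bound_comp h a) (exists_bound_star_comp h a)]
    congr 1
    exact (eq_mulCLM_iff (measurable_star_comp hm) (exists_bound_star_comp h a) _ _).2 huv

/-- The function `t ↦ (t + i)⁻¹`. -/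
def resolventFun : BoundedContinuousFunction ℝ ℂ :=
  BoundedContinuousFunction.ofNormedAddCommGroup (fun t : ℝ => ((t : ℂ) + Complex.I)⁻¹)
    (by
      refine Continuous.inv₀ (by fun_prop) fun t h => ?_
      simpa using congrArg Complex.im h) 1
    (fun t => by
      rw [norm_inv]
      refine inv_le_one_of_one_le₀ ?_
      simpa using Complex.abs_im_le_norm ((t : ℂ) + Complex.I))

theorem ofReal_add_I_ne_zero (t : ℝ) : (t : ℂ) + Complex.I ≠ 0 := fun h => by
  simpa using congrArg Complex.im h

/-- If `v = (a + i)⁻¹ u` then `a v = u - i v`, so the hypothesis on graphs applies to the pair `(v,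
u - i v)`. This extracts a bounded function from information about unbounded multiplication
operators. -/
theorem carriesMul_resolventFun
    (hW : ∀ u v : Lp ℂ 2 μ, (v =ᵐ[μ] fun x => (a x : ℂ) * u x) ↔
      (W v =ᵐ[ν] fun y => (c y : ℂ) * W u y)) :
    CarriesMul W a c resolventFun := by
  intro u v huv
  have h1 := (hW v (u - Complex.I • v)).1 (by
    filter_upwards [huv, Lp.coeFn_sub u (Complex.I • v), Lp.coeFn_smul Complex.I v] with x h1 h2 h3
    rw [h2, Pi.sub_apply, h3, Pi.smul_apply, h1]
    simp only [resolventFun, BoundedContinuousFunction.coe_ofNormedAddCommGroup, smul_eq_mul]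
    field_simp [ofReal_add_I_ne_zero (a x)]
    ring)
  rw [map_sub, map_smul] at h1
  filter_upwards [h1, Lp.coeFn_sub (W u) (Complex.I • W v), Lp.coeFn_smul Complex.I (W v)]
    with y h1 h2 h3
  rw [h2, Pi.sub_apply, h3, Pi.smul_apply, smul_eq_mul] at h1
  simp only [resolventFun, BoundedContinuousFunction.coe_ofNormedAddCommGroup]
  rw [eq_inv_mul_iff_mul_eq₀ (ofReal_add_I_ne_zero _)]
  linear_combination -h1

/-- Finite measures on the line are determined by their integrals over a point-separating star
subalgebra of bounded continuous functions. The functions carried by `W` form one, because it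
contains the injective function `t ↦ (t + i)⁻¹`, and on it both integrals are the same inner
product. -/
theorem spectralMeasure_map_eq (ha : Measurable a) (hc : Measurable c)
    (hW : ∀ u v : Lp ℂ 2 μ, (v =ᵐ[μ] fun x => (a x : ℂ) * u x) ↔
      (W v =ᵐ[ν] fun y => (c y : ℂ) * W u y)) (u : Lp ℂ 2 μ) :
    spectralMeasure a u = spectralMeasure c (W u) := by
  refine ext_of_forall_mem_subalgebra_integral_eq_of_polish
    (A := carriedSubalgebra W ha hc) ?_ fun h hh => ?_
  · intro s t hst
    refine ⟨resolventFun, ⟨resolventFun.toContinuousMap,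
      ⟨resolventFun, carriesMul_resolventFun W hW, rfl⟩, rfl⟩, fun h => hst ?_⟩
    have h' : ((s : ℂ) + Complex.I)⁻¹ = ((t : ℂ) + Complex.I)⁻¹ := h
    exact_mod_cast add_right_cancel (inv_injective h')
  · have hm : Measurable fun x => h (a x) := h.continuous.measurable.comp ha
    have h1 := coeFn_mulCLM hm (exists_bound_comp h a) u
    rw [← inner_eq_integral_spectralMeasure ha h.continuous.measurable h1,
      ← inner_eq_integral_spectralMeasure hc h.continuous.measurable (hh u _ h1),
      LinearIsometryEquiv.inner_map_map]

end Uniqueness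

/-! ### Uniqueness of a function of an operator -/

section FunctionalCalculus

variable {H : Type*} [NormedAddCommGroup H] [InnerProductSpace ℂ H]

theorem IsFunctionOf.unique {A : H →ₗ.[ℂ] H} {g : ℝ → ℂ} (hg : Measurable g) {B B' : H →L[ℂ] H}
    (h : IsFunctionOf A g B) (h' : IsFunctionOf A g B') : B = B' := by
  obtain ⟨X, _, μ, V, a, ha, hA, hB⟩ := h
  obtain ⟨Y, _, ν, V', c, hc, hA', hB'⟩ := h'
  have key : (B : H →ₗ[ℂ] H) = B' := by
    -- Over `ℂ` an operator is determined by its quadratic form, and both forms are integrals of `g`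
    -- against the spectral measure of `ψ`.
    rw [← sub_eq_zero, ← inner_map_self_eq_zero]
    intro ψ
    rw [LinearMap.sub_apply, inner_sub_left, sub_eq_zero, ← inner_conj_symm,
      ← inner_conj_symm _ ψ]
    congr 1
    rw [ContinuousLinearMap.coe_coe, ContinuousLinearMap.coe_coe,
      ← V.inner_map_map, ← V'.inner_map_map,
      inner_eq_integral_spectralMeasure ha hg (hB ψ),
      inner_eq_integral_spectralMeasure hc hg (hB' ψ),
      spectralMeasure_map_eq (V.symm.trans V') ha hc]
    · simp
    · intro u v
      have h1 := hA (V.symm u) (V.symm v)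
      have h2 := hA' (V.symm u) (V.symm v)
      simp only [LinearIsometryEquiv.apply_symm_apply] at h1
      exact h1.symm.trans h2
  exact ContinuousLinearMap.coe_injective key

end FunctionalCalculus

end

section

/-! ## Diagonalized operators -/

section Diagonalized

variable {H : Type*} [NormedAddCommGroup H] [InnerProductSpace ℂ H]
  {X : Type*} [MeasurableSpace X] {μ : Measure X}

/-- The unitary map `V` carries `A` to multiplication by the real function `a`, with maximal
domain. -/
def IsDiagonalizedBy (A : H →ₗ.[ℂ] H) (V : H ≃ₗᵢ[ℂ] Lp ℂ 2 μ) (a : X → ℝ) : Prop :=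
  ∀ ψ χ : H, (ψ, χ) ∈ A.graph ↔
    (V χ : X → ℂ) =ᵐ[μ] fun x => ((a x : ℝ) : ℂ) * (V ψ : X → ℂ) x

theorem exists_bound_resolvent {Z : Type*} (a : Z → ℝ) :
    ∃ C, ∀ x, ‖((a x : ℂ) + Complex.I)⁻¹‖ ≤ C :=
  exists_bound_comp resolventFun a

theorem measurable_resolvent {a : X → ℝ} (ha : Measurable a) :
    Measurable fun x => ((a x : ℂ) + Complex.I)⁻¹ :=
  resolventFun.continuous.measurable.comp ha

theorem exists_bound_star_resolvent {Z : Type*} (a : Z → ℝ) :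
    ∃ C, ∀ x, ‖star ((a x : ℂ) + Complex.I)⁻¹‖ ≤ C :=
  exists_bound_star_comp resolventFun a

variable (μ) in
/-- The resolvent `(a + i)⁻¹` of the operator of multiplication by `a`. -/
def resolventCLM (a : X → ℝ) (ha : Measurable a) : Lp ℂ 2 μ →L[ℂ] Lp ℂ 2 μ :=
  mulCLM μ (fun x => ((a x : ℂ) + Complex.I)⁻¹) (measurable_resolvent ha)
    (exists_bound_resolvent a)

/-- Membership in the graph of an unbounded multiplication operator becomes an equation between
bounded operators, hence a closed condition. -/
theorem ae_eq_mul_iff_resolvent {a : X → ℝ} (ha : Measurable a) (u v : Lp ℂ 2 μ) :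
    (v =ᵐ[μ] fun x => (a x : ℂ) * u x) ↔ u = resolventCLM μ a ha (v + Complex.I • u) := by
  rw [resolventCLM, eq_mulCLM_iff]
  constructor <;> intro h <;>
    filter_upwards [h, Lp.coeFn_add v (Complex.I • u), Lp.coeFn_smul Complex.I u]
      with x h1 h2 h3 <;>
    have h0 := ofReal_add_I_ne_zero (a x)
  · rw [h2, Pi.add_apply, h3, Pi.smul_apply, smul_eq_mul, eq_inv_mul_iff_mul_eq₀ h0, h1]
    ring
  · rw [h2, Pi.add_apply, h3, Pi.smul_apply, smul_eq_mul, eq_inv_mul_iff_mul_eq₀ h0] at h1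
    linear_combination -h1

theorem resolventCLM_graph {a : X → ℝ} (ha : Measurable a) (w : Lp ℂ 2 μ) :
    (w - Complex.I • resolventCLM μ a ha w : Lp ℂ 2 μ) =ᵐ[μ]
      fun x => (a x : ℂ) * resolventCLM μ a ha w x := by
  rw [ae_eq_mul_iff_resolvent ha, sub_add_cancel]

theorem IsDiagonalizedBy.isSelfAdjoint [CompleteSpace H] {A : H →ₗ.[ℂ] H}
    {V : H ≃ₗᵢ[ℂ] Lp ℂ 2 μ} {a : X → ℝ} (hA : IsDiagonalizedBy A V a) (ha : Measurable a)
    (hd : Dense (A.domain : Set H)) : IsSelfAdjoint A := by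
  rw [LinearPMap.isSelfAdjoint_def]
  refine LinearPMap.eq_of_eq_graph ?_
  rw [LinearPMap.adjoint_graph_eq_graph_adjoint hd]
  ext ⟨u, v⟩
  rw [Submodule.mem_adjoint_iff, hA]
  constructor
  · intro h
    -- Write `R` for the resolvent. Testing the adjoint relation on all graph vectors `(R w, w - i R
    -- w)` gives `u = R* (v - i u)` in the diagonal picture, that is `(a - i) u = v - i u`, hence `v
    -- = a u`.
    have key : V u = mulCLM μ _ (measurable_star_comp (measurable_resolvent ha))
        (exists_bound_star_resolvent a) (V v - Complex.I • V u) := by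
      refine ext_inner_left ℂ fun w => ?_
      rw [← inner_mulCLM_left (measurable_resolvent ha) (exists_bound_resolvent a)]
      change _ = inner ℂ (resolventCLM μ a ha w) _
      have h1 := h (V.symm (resolventCLM μ a ha w))
        (V.symm (w - Complex.I • resolventCLM μ a ha w))
        ((hA _ _).2 (by simpa only [LinearIsometryEquiv.apply_symm_apply] using
          resolventCLM_graph ha w))
      simp only at h1
      rw [← V.inner_map_map, ← V.inner_map_map (V.symm _) v,
        LinearIsometryEquiv.apply_symm_apply, LinearIsometryEquiv.apply_symm_apply,
        inner_sub_left, inner_smul_left] at h1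
      rw [inner_sub_right, inner_smul_right]
      simp only [Complex.conj_I] at h1
      linear_combination h1
    rw [eq_mulCLM_iff] at key
    filter_upwards [key, Lp.coeFn_sub (V v) (Complex.I • V u), Lp.coeFn_smul Complex.I (V u)]
      with x h1 h2 h3
    rw [h2, Pi.sub_apply, h3, Pi.smul_apply, smul_eq_mul, star_inv₀,
      eq_inv_mul_iff_mul_eq₀ (star_ne_zero.2 (ofReal_add_I_ne_zero (a x)))] at h1
    simp only [star_add, RCLike.star_def, Complex.conj_ofReal, Complex.conj_I] at h1
    linear_combination -h1
  · intro h α β hαβ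
    rw [hA] at hαβ
    rw [sub_eq_zero, ← V.inner_map_map, ← V.inner_map_map α, L2.inner_def, L2.inner_def]
    refine integral_congr_ae ?_
    filter_upwards [h, hαβ] with x h1 h2
    simp only [h1, h2, RCLike.inner_apply, map_mul, Complex.conj_ofReal]
    ring

end Diagonalized

variable {N : ℕ} [NeZero N]

theorem coeFn_coreIncl (f : Core N) : coreIncl N f =ᵐ[volume] f :=
  SchwartzMap.coeFn_toLp f 2 volume

theorem denseRange_coreIncl : DenseRange (coreIncl N) :=
  SchwartzMap.denseRange_toLpCLM (E := Config N) (F := ℂ) (p := 2) (by simp) (μ := volume)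

/-! ## Unitary operators preserving the Schwartz space -/

variable (N) in
/-- Pairs of a unitary operator on `L²` and an automorphism of the Schwartz space which is its
restriction. -/
def implementers : Subgroup ((L2 N ≃ₗᵢ[ℂ] L2 N) × (Module.End ℂ (Core N))ˣ) where
  carrier := {g | ∀ f, g.1 (coreIncl N f) = coreIncl N (g.2.val f)}
  one_mem' _ := rfl
  mul_mem' {g h} hg hh f := by
    change g.1 (h.1 (coreIncl N f)) = coreIncl N (g.2.val (h.2.val f))
    rw [hh, hg]
  inv_mem' {g} hg f := by
    have h1 : g.2.val (g.2⁻¹.val f) = f := by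
      rw [← Module.End.mul_apply, Units.mul_inv, Module.End.one_apply]
    change g.1.symm (coreIncl N f) = coreIncl N (g.2⁻¹.val f)
    rw [LinearIsometryEquiv.symm_apply_eq, hg, h1]

variable (N) in
/-- Unitary operators on `L²` restricting to automorphisms of the Schwartz space. -/
abbrev Implementer : Type := implementers N

namespace Implementer

/-- The unitary operator on `L²` as an isometric equivalence. -/
def iso (g : Implementer N) : L2 N ≃ₗᵢ[ℂ] L2 N := g.1.1

/-- The automorphism of the Schwartz space. -/
def core (g : Implementer N) : Module.End ℂ (Core N) := g.1.2.val

/-- The unitary operator on `L²`. -/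
def op : Implementer N →* (L2 N →L[ℂ] L2 N) where
  toFun g := (g.iso.toContinuousLinearEquiv : L2 N →L[ℂ] L2 N)
  map_one' := rfl
  map_mul' _ _ := rfl

theorem op_apply (g : Implementer N) (ψ : L2 N) : op g ψ = g.iso ψ := rfl

theorem iso_coreIncl (g : Implementer N) (f : Core N) :
    g.iso (coreIncl N f) = coreIncl N (g.core f) := g.2 f

theorem core_inv_mul (g : Implementer N) : g⁻¹.core * g.core = 1 := g.1.2.inv_mul

theorem core_mul_inv (g : Implementer N) : g.core * g⁻¹.core = 1 := g.1.2.mul_inv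

theorem op_inv_mul (g : Implementer N) : op g⁻¹ * op g = 1 := by
  rw [← map_mul, inv_mul_cancel, map_one]

theorem op_mul_inv (g : Implementer N) : op g * op g⁻¹ = 1 := by
  rw [← map_mul, mul_inv_cancel, map_one]

/-- The unitary on `L²` determines its restriction because Schwartz functions embed injectively.
Identities between implementers can therefore be checked in either picture. -/
theorem op_injective : Function.Injective (op (N := N)) := by
  intro g h hgh
  have h1 : g.iso = h.iso := LinearIsometryEquiv.ext fun ψ => congrArg (fun T => T ψ) hgh
  have h2 : g.core = h.core := LinearMap.ext fun f => coreIncl_injective N (by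
    rw [← iso_coreIncl, ← iso_coreIncl, h1])
  exact Subtype.ext (Prod.ext h1 (Units.ext h2))

theorem op_mem_unitary (g : Implementer N) : op g ∈ unitary (L2 N →L[ℂ] L2 N) :=
  (Unitary.linearIsometryEquiv.symm g.iso).2

theorem inverse_op (g : Implementer N) : Ring.inverse (op g) = op g⁻¹ :=
  Ring.inverse_unit (⟨op g, op g⁻¹, op_mul_inv g, op_inv_mul g⟩ : (L2 N →L[ℂ] L2 N)ˣ)

/-- `g S = T g` on the Schwartz space. -/
theorem semiconjBy_inv {g : Implementer N} {S T : Module.End ℂ (Core N)}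
    (h : SemiconjBy g.core S T) : SemiconjBy g⁻¹.core T S := by
  unfold SemiconjBy at *
  calc g⁻¹.core * T = g⁻¹.core * T * (g.core * g⁻¹.core) := by rw [core_mul_inv, mul_one]
    _ = g⁻¹.core * (T * g.core) * g⁻¹.core := by simp only [mul_assoc]
    _ = g⁻¹.core * g.core * S * g⁻¹.core := by rw [← h]; simp only [mul_assoc]
    _ = S * g⁻¹.core := by rw [core_inv_mul, one_mul]

end Implementer

/-! ## Operators conjugate to multiplication by real functions of temperate growth -/

/-- Multiplication by a function, on the Schwartz space. -/
def mulCore (a : Config N → ℂ) : Module.End ℂ (Core N) :=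
  (SchwartzMap.smulLeftCLM ℂ a).toLinearMap

theorem mulCore_apply {a : Config N → ℂ} (ha : a.HasTemperateGrowth) (f : Core N) (x : Config N) :
    mulCore a f x = a x * f x := by
  simp [mulCore, ha]

/-- The restriction of the unitary operator `g` to the Schwartz space carries `T` to
multiplication by the real function `a`. -/
structure DiagonalizedOnCore (T : Module.End ℂ (Core N)) (g : Implementer N) (a : Config N → ℝ) :
    Prop where
  temperate : a.HasTemperateGrowth
  semiconj : SemiconjBy g.core T (mulCore fun x => (a x : ℂ))

theorem temperate_ofReal {a : Config N → ℝ} (ha : a.HasTemperateGrowth) :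
    (fun x => (a x : ℂ)).HasTemperateGrowth :=
  Function.Complex.hasTemperateGrowth_ofReal.comp ha

/-- The function is `(a - i)` times the composition of `t ↦ (1 + t²)⁻¹` with `a`, a product of
functions of temperate growth. -/
theorem temperate_resolvent {a : Config N → ℝ} (ha : a.HasTemperateGrowth) :
    (fun x => ((a x : ℂ) + Complex.I)⁻¹).HasTemperateGrowth := by
  have h1 : (fun x => (((1 + ‖a x‖ ^ 2) ^ (-1 : ℝ) : ℝ) : ℂ)).HasTemperateGrowth :=
    Function.Complex.hasTemperateGrowth_ofReal.comp
      ((Function.hasTemperateGrowth_one_add_norm_sq_rpow ℝ (-1)).comp ha)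
  have h2 : (fun x => (a x : ℂ) - Complex.I).HasTemperateGrowth :=
    (temperate_ofReal ha).sub (Function.HasTemperateGrowth.const _)
  convert! h2.mul h1 using 1
  funext x
  have h3 : ((1 : ℂ) + (a x : ℂ) ^ 2) = (a x + Complex.I) * (a x - Complex.I) := by
    linear_combination Complex.I_sq
  have h4 : (a x : ℂ) - Complex.I ≠ 0 := fun h => by simpa using congrArg Complex.im h
  have h5 := ofReal_add_I_ne_zero (a x)
  simp only [Pi.mul_apply, Real.rpow_neg_one, Real.norm_eq_abs, sq_abs]
  push_cast
  rw [h3]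
  field_simp

namespace DiagonalizedOnCore

variable {T : Module.End ℂ (Core N)} {g : Implementer N} {a : Config N → ℝ}

theorem conj (h : DiagonalizedOnCore T g a) {s : Implementer N} {S : Module.End ℂ (Core N)}
    (hs : SemiconjBy s.core S T) : DiagonalizedOnCore S (g * s) a :=
  ⟨h.temperate, h.semiconj.mul_left hs⟩

theorem measurable (h : DiagonalizedOnCore T g a) : Measurable a :=
  h.temperate.1.continuous.measurable

theorem resolvent_coreIncl (ha : a.HasTemperateGrowth) (hm : Measurable a) (f : Core N) :
    resolventCLM volume a hm (coreIncl N f) =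
      coreIncl N (mulCore (fun x => ((a x : ℂ) + Complex.I)⁻¹) f) := by
  symm
  rw [resolventCLM, eq_mulCLM_iff]
  filter_upwards [coeFn_coreIncl f,
    coeFn_coreIncl (mulCore (fun x => ((a x : ℂ) + Complex.I)⁻¹) f)] with x h1 h2
  rw [h1, h2, mulCore_apply (temperate_resolvent ha)]

theorem mem_graph_core (T : Module.End ℂ (Core N)) (f : Core N) :
    (coreIncl N f, coreIncl N (T f)) ∈
      LinearPMap.graph
        { domain := LinearMap.range (coreIncl N)
          toFun := coreIncl N ∘ₗ T ∘ₗ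
            (LinearEquiv.ofInjective (coreIncl N) (coreIncl_injective N)).symm.toLinearMap } := by
  rw [LinearPMap.mem_graph_iff]
  refine ⟨⟨coreIncl N f, ⟨f, rfl⟩⟩, rfl, ?_⟩
  have : (LinearEquiv.ofInjective (coreIncl N) (coreIncl_injective N)).symm
      ⟨coreIncl N f, ⟨f, rfl⟩⟩ = f := by
    rw [LinearEquiv.symm_apply_eq]; rfl
  change coreIncl N (T ((LinearEquiv.ofInjective (coreIncl N) (coreIncl_injective N)).symm
      ⟨coreIncl N f, ⟨f, rfl⟩⟩)) = _
  rw [this]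

theorem exists_of_mem_graph_core (T : Module.End ℂ (Core N)) {z : L2 N × L2 N} (hz : z ∈
      LinearPMap.graph
        { domain := LinearMap.range (coreIncl N)
          toFun := coreIncl N ∘ₗ T ∘ₗ
            (LinearEquiv.ofInjective (coreIncl N) (coreIncl_injective N)).symm.toLinearMap }) :
    ∃ f, z = (coreIncl N f, coreIncl N (T f)) := by
  obtain ⟨⟨y, f, rfl⟩, h1, h2⟩ := (LinearPMap.mem_graph_iff _).1 hz
  refine ⟨f, Prod.ext h1.symm ?_⟩
  have h3 := (LinearPMap.mem_graph_iff _).1 (mem_graph_core T f)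
  obtain ⟨y', h4, h5⟩ := h3
  rw [← h2]
  have : y' = ⟨coreIncl N f, ⟨f, rfl⟩⟩ := Subtype.ext h4
  rw [this] at h5
  exact h5

/-- The graph of multiplication by `a`, transported by `g`. -/
def mulGraph (g : Implementer N) (a : Config N → ℝ) (hm : Measurable a) :
    Submodule ℂ (L2 N × L2 N) :=
  LinearMap.eqLocus
    ((g.iso.toContinuousLinearEquiv : L2 N →L[ℂ] L2 N) ∘L ContinuousLinearMap.fst ℂ _ _).toLinearMap
    (resolventCLM volume a hm ∘L (g.iso.toContinuousLinearEquiv : L2 N →L[ℂ] L2 N) ∘L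
      (ContinuousLinearMap.snd ℂ _ _ + Complex.I • ContinuousLinearMap.fst ℂ _ _)).toLinearMap

theorem mem_mulGraph (hm : Measurable a) (ψ χ : L2 N) :
    (ψ, χ) ∈ mulGraph g a hm ↔
      g.iso ψ = resolventCLM volume a hm (g.iso χ + Complex.I • g.iso ψ) := by
  change g.iso ψ = resolventCLM volume a hm (g.iso (χ + Complex.I • ψ)) ↔ _
  rw [map_add, map_smul]

theorem isClosed_mulGraph (hm : Measurable a) :
    IsClosed (mulGraph g a hm : Set (L2 N × L2 N)) :=
  isClosed_eq (ContinuousLinearMap.continuous _) (ContinuousLinearMap.continuous _)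

/-- Points of the maximal graph are exactly `(R w, w - i R w)`, with `R` the resolvent of `a`. For
Schwartz `w` they come from Schwartz functions, since `R` preserves the Schwartz space; density of
the latter and continuity of `R` show that the graph on the core is dense in the maximal graph,
which is closed. -/
theorem isDiagonalizedBy (h : DiagonalizedOnCore T g a) :
    IsDiagonalizedBy (closedOp T) g.iso a := by
  have hm := h.measurable
  set T₀ : L2 N →ₗ.[ℂ] L2 N :=
    { domain := LinearMap.range (coreIncl N)
      toFun := coreIncl N ∘ₗ T ∘ₗ
        (LinearEquiv.ofInjective (coreIncl N) (coreIncl_injective N)).symm.toLinearMap } with hT₀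
  have h1 : T₀.graph ≤ mulGraph g a hm := by
    intro z hz
    obtain ⟨f, rfl⟩ := exists_of_mem_graph_core T hz
    rw [mem_mulGraph, ← ae_eq_mul_iff_resolvent, g.iso_coreIncl, g.iso_coreIncl]
    have h2 : g.core (T f) = mulCore (fun x => (a x : ℂ)) (g.core f) :=
      congrArg (fun S => S f) h.semiconj
    filter_upwards [coeFn_coreIncl (g.core f), coeFn_coreIncl (g.core (T f))] with x h3 h4
    rw [h3, h4, h2, mulCore_apply (temperate_ofReal h.temperate)]
  have h2 : T₀.graph.topologicalClosure = mulGraph g a hm := by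
    refine le_antisymm (Submodule.topologicalClosure_minimal _ h1 (isClosed_mulGraph hm)) ?_
    have key : ∀ w : L2 N, (g.iso.symm (resolventCLM volume a hm w),
        g.iso.symm (w - Complex.I • resolventCLM volume a hm w)) ∈
          T₀.graph.topologicalClosure := by
      intro w
      refine denseRange_coreIncl.induction_on w ?_ fun f => ?_
      · refine T₀.graph.isClosed_topologicalClosure.preimage ?_
        fun_prop
      · refine subset_closure ?_
        set f' := mulCore (fun x => ((a x : ℂ) + Complex.I)⁻¹) f with hf'
        have h3 : resolventCLM volume a hm (coreIncl N f) = coreIncl N f' :=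
          resolvent_coreIncl h.temperate hm f
        have h4 := mem_graph_core T (g⁻¹.core f')
        have h5 : g.iso (coreIncl N (g⁻¹.core f')) = coreIncl N f' := by
          rw [g.iso_coreIncl, ← Module.End.mul_apply, g.core_mul_inv, Module.End.one_apply]
        have h6 : f - Complex.I • f' = g.core (T (g⁻¹.core f')) := by
          have : g.core (T (g⁻¹.core f')) = mulCore (fun x => (a x : ℂ)) f' := by
            have := congrArg (fun S => S (g⁻¹.core f')) h.semiconj
            simp only [Module.End.mul_apply] at this
            rw [this, ← Module.End.mul_apply g.core, g.core_mul_inv, Module.End.one_apply]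
          rw [this]
          ext x
          have h0 := ofReal_add_I_ne_zero (a x)
          rw [mulCore_apply (temperate_ofReal h.temperate), sub_apply,
            smul_apply, hf', mulCore_apply (temperate_resolvent h.temperate)]
          simp only [smul_eq_mul]
          field_simp
          ring
        rw [h3, ← map_smul, ← map_sub, h6, ← g.iso_coreIncl, LinearIsometryEquiv.symm_apply_apply,
          ← h5, LinearIsometryEquiv.symm_apply_apply]
        exact h4
    rintro ⟨ψ, χ⟩ hz
    rw [mem_mulGraph] at hz
    have := key (g.iso χ + Complex.I • g.iso ψ)
    rwa [← hz, add_sub_cancel_right, LinearIsometryEquiv.symm_apply_apply,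
      LinearIsometryEquiv.symm_apply_apply] at this
  -- Closability: a pair `(0, χ)` in the multiplication graph has `χ = a · 0 = 0`, so the closure of
  -- the graph is again the graph of an operator.
  have h3 : T₀.graph.topologicalClosure = (mulGraph g a hm).toLinearPMap.graph := by
    rw [h2, Submodule.toLinearPMap_graph_eq]
    rintro ⟨ψ, χ⟩ hz (h0 : ψ = 0)
    rw [mem_mulGraph, ← ae_eq_mul_iff_resolvent, h0, map_zero] at hz
    have : g.iso χ = 0 := Lp.ext (by
      filter_upwards [hz, Lp.coeFn_zero ℂ 2 (volume : Measure (Config N))] with x h1 h2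
      rw [h1, h2]
      simp)
    simpa using this
  have h4 : (closedOp T).graph = mulGraph g a hm := by
    rw [← h2, closedOp, LinearPMap.IsClosable.graph_closure_eq_closure_graph ⟨_, h3⟩]
  intro ψ χ
  rw [h4, mem_mulGraph, ae_eq_mul_iff_resolvent hm]

theorem isSelfAdjoint (h : DiagonalizedOnCore T g a) : IsSelfAdjoint (closedOp T) := by
  refine h.isDiagonalizedBy.isSelfAdjoint h.measurable ?_
  refine denseRange_coreIncl.mono ?_
  exact fun ψ hψ => (LinearPMap.le_closure _).1 hψ

/-- Covariance of the closure, up to a nonzero real factor. -/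
theorem mem_graph_closedOp_iff (h : DiagonalizedOnCore T g a) {s : Implementer N}
    {S : Module.End ℂ (Core N)} (c : ℝ) (hc : c * c = 1)
    (hs : SemiconjBy s.core S ((c : ℂ) • T)) (ψ χ : L2 N) :
    (ψ, χ) ∈ (closedOp S).graph ↔
      (s.iso ψ, (c : ℂ) • s.iso χ) ∈ (closedOp T).graph := by
  have ht : (fun x => c * a x).HasTemperateGrowth :=
    (Function.HasTemperateGrowth.const c).mul h.temperate
  -- Both closures are now multiplication operators for the same unitary `g`, by `c a` and by `a`;
  -- the factor `c = ±1` is its own inverse.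
  have h1 : DiagonalizedOnCore S (g * s) (fun x => c * a x) := by
    refine ⟨ht, SemiconjBy.mul_left ?_ hs⟩
    have h2 : (mulCore fun x : Config N => ((c * a x : ℝ) : ℂ)) =
        (c : ℂ) • mulCore fun x => (a x : ℂ) := by
      ext f x
      rw [LinearMap.smul_apply, smul_apply, mulCore_apply (temperate_ofReal ht),
        mulCore_apply (temperate_ofReal h.temperate)]
      simp [mul_assoc]
    rw [h2]
    unfold SemiconjBy
    rw [mul_smul_comm, smul_mul_assoc, show g.1.2.val * T = _ from h.semiconj.eq]
    rfl
  rw [h1.isDiagonalizedBy, h.isDiagonalizedBy, map_smul]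
  change g.iso (s.iso χ) =ᵐ[volume] (fun x => ((c * a x : ℝ) : ℂ) * g.iso (s.iso ψ) x) ↔ _
  have hc' : (c : ℂ) * c = 1 := by exact_mod_cast hc
  constructor <;> intro h2 <;> filter_upwards [h2, Lp.coeFn_smul (c : ℂ) (g.iso (s.iso χ))]
    with x h2 h3
  · rw [h3, Pi.smul_apply, h2, smul_eq_mul]
    push_cast
    linear_combination (a x : ℂ) * g.iso (s.iso ψ) x * hc'
  · rw [h3, Pi.smul_apply, smul_eq_mul] at h2
    push_cast
    linear_combination (c : ℂ) * h2 - (g.iso (s.iso χ) x) * hc'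

/-- The diagonalization exhibits an explicit function of the closure, so the default value in `fc`
is not taken, and by `IsFunctionOf.unique` the chosen operator is this one. -/
theorem fc_eq (h : DiagonalizedOnCore T g a) {G : ℝ → ℂ} (hG : Measurable G)
    (hb : ∃ C, ∀ x, ‖G x‖ ≤ C) :
    fc G T = Implementer.op g⁻¹ *
      mulCLM volume (fun x => G (a x)) (hG.comp h.measurable) (hb.imp fun _ h x => h (a x)) *
        Implementer.op g := by
  have hf : IsFunctionOf (closedOp T) G (Implementer.op g⁻¹ *
      mulCLM volume (fun x => G (a x)) (hG.comp h.measurable) (hb.imp fun _ h x => h (a x)) *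
        Implementer.op g) := by
    refine ⟨Config N, inferInstance, volume, g.iso, a, h.measurable, h.isDiagonalizedBy,
      fun ψ => ?_⟩
    change g.iso (g.iso.symm _) =ᵐ[volume] _
    rw [LinearIsometryEquiv.apply_symm_apply]
    exact coeFn_mulCLM _ _ _
  rw [fc, dif_pos ⟨_, hf⟩]
  exact IsFunctionOf.unique hG (Exists.choose_spec (⟨_, hf⟩ :
    ∃ B, IsFunctionOf (closedOp T) G B)) hf

/-- Covariance of the functional calculus. -/
theorem semiconjBy_fc (h : DiagonalizedOnCore T g a) {G : ℝ → ℂ} (hG : Measurable G)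
    (hb : ∃ C, ∀ x, ‖G x‖ ≤ C) {s : Implementer N} {S : Module.End ℂ (Core N)}
    (hs : SemiconjBy s.core S T) : SemiconjBy (Implementer.op s) (fc G S) (fc G T) := by
  unfold SemiconjBy
  rw [h.fc_eq hG hb, (h.conj hs).fc_eq hG hb, mul_inv_rev, map_mul, map_mul]
  simp only [← mul_assoc]
  rw [Implementer.op_mul_inv, one_mul]

end DiagonalizedOnCore

end

section

/-! ## Multiplication by phases, the Fourier transform and permutations -/

section Phase

variable {X : Type*} [MeasurableSpace X] (μ : Measure X)

theorem exists_bound_of_norm_eq_one {Z : Type*} {g : Z → ℂ} (h : ∀ x, ‖g x‖ = 1) :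
    ∃ C, ∀ x, ‖g x‖ ≤ C := ⟨1, fun x => (h x).le⟩

theorem norm_mulCLM {g : X → ℂ} (hg : Measurable g) (h1 : ∀ x, ‖g x‖ = 1) (u : Lp ℂ 2 μ) :
    ‖mulCLM μ g hg (exists_bound_of_norm_eq_one h1) u‖ = ‖u‖ := by
  refine le_antisymm (Lp.norm_le_norm_of_ae_le ?_) (Lp.norm_le_norm_of_ae_le ?_) <;>
  · filter_upwards [coeFn_mulCLM hg (exists_bound_of_norm_eq_one h1) u] with x hx
    rw [hx, norm_mul, h1, one_mul]

/-- Multiplication by a measurable function of modulus one, as a unitary operator on `L²`. -/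
def mulIso (g : X → ℂ) (hg : Measurable g) (h1 : ∀ x, ‖g x‖ = 1) : Lp ℂ 2 μ ≃ₗᵢ[ℂ] Lp ℂ 2 μ where
  toLinearEquiv := LinearEquiv.ofLinearMap
    (mulCLM μ g hg (exists_bound_of_norm_eq_one h1)).toLinearMap
    (mulCLM μ (fun x => star (g x)) (measurable_star_comp hg)
      (exists_bound_of_norm_eq_one fun x => by rw [norm_star, h1])).toLinearMap
    (LinearMap.ext fun u => by
      symm
      simp only [LinearMap.comp_apply, ContinuousLinearMap.coe_coe, LinearMap.id_apply]
      rw [eq_mulCLM_iff]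
      filter_upwards [coeFn_mulCLM (measurable_star_comp hg)
        (exists_bound_of_norm_eq_one fun x => by rw [norm_star, h1]) u] with x hx
      rw [hx, ← mul_assoc, RCLike.star_def, RCLike.mul_conj, h1]
      simp)
    (LinearMap.ext fun u => by
      symm
      simp only [LinearMap.comp_apply, ContinuousLinearMap.coe_coe, LinearMap.id_apply]
      rw [eq_mulCLM_iff]
      filter_upwards [coeFn_mulCLM hg (exists_bound_of_norm_eq_one h1) u] with x hx
      rw [hx, ← mul_assoc, RCLike.star_def, RCLike.conj_mul, h1]
      simp)
  norm_map' := norm_mulCLM μ hg h1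

end Phase

variable {N : ℕ}

/-- The `n`-th derivative is `(ci)ⁿ` times the function itself, which has modulus one, so it is
bounded by `|c|ⁿ`. -/
theorem temperate_cexp_mul_I (c : ℝ) :
    (fun t : ℝ => Complex.exp (c * Complex.I * t)).HasTemperateGrowth := by
  have h1 : ∀ n : ℕ, iteratedDeriv n (fun t : ℝ => Complex.exp (c * Complex.I * t)) =
      fun t : ℝ => (c * Complex.I) ^ n * Complex.exp (c * Complex.I * t) := by
    intro n
    induction n with
    | zero => simp
    | succ n ih =>
      rw [iteratedDeriv_succ, ih]
      funext t
      have h2 : HasDerivAt (fun t : ℝ => Complex.exp (c * Complex.I * t))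
          (Complex.exp (c * Complex.I * t) * (c * Complex.I * 1)) t :=
        ((hasDerivAt_id (t : ℂ)).const_mul (c * Complex.I)).cexp.comp_ofReal
      rw [(h2.const_mul _).deriv]
      ring
  refine ⟨?_, fun n => ⟨0, |c| ^ n, fun t => ?_⟩⟩
  · have : ContDiff ℝ ⊤ fun t : ℝ => (t : ℂ) := Complex.ofRealCLM.contDiff
    exact ((contDiff_const.mul Complex.ofRealCLM.contDiff).cexp)
  · rw [norm_iteratedFDeriv_eq_norm_iteratedDeriv, h1, norm_mul, norm_pow, norm_mul]
    have : (c : ℂ) * Complex.I * t = ((c * t : ℝ) : ℂ) * Complex.I := by push_cast; ring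
    rw [this, Complex.norm_exp_ofReal_mul_I]
    simp

/-- The phase function `exp (2πi a)`. -/
def phase (a : Config N → ℝ) (x : Config N) : ℂ :=
  Complex.exp (((2 * Real.pi : ℝ) : ℂ) * Complex.I * (a x : ℂ))

theorem norm_phase (a : Config N → ℝ) (x : Config N) : ‖phase a x‖ = 1 := by
  have : ((2 * Real.pi : ℝ) : ℂ) * Complex.I * (a x : ℂ) =
      ((2 * Real.pi * a x : ℝ) : ℂ) * Complex.I := by push_cast; ring
  rw [phase, this, Complex.norm_exp_ofReal_mul_I]

theorem temperate_neg [NeZero N] {a : Config N → ℝ} (ha : a.HasTemperateGrowth) :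
    (fun x => -a x).HasTemperateGrowth := ha.neg

theorem temperate_phase [NeZero N] {a : Config N → ℝ} (ha : a.HasTemperateGrowth) :
    (phase a).HasTemperateGrowth :=
  (temperate_cexp_mul_I (2 * Real.pi)).comp ha

theorem phase_mul_phase_neg (a : Config N → ℝ) (x : Config N) :
    phase a x * phase (fun x => -a x) x = 1 := by
  rw [phase, phase, ← Complex.exp_add]
  simp

theorem hasLineDerivAt_coord (i j : ZMod (2 * N)) (x : Config N) :
    HasLineDerivAt ℝ (fun x : Config N => x i) (if i = j then 1 else 0) x
      (EuclideanSpace.single j (1 : ℝ)) := by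
  have h : (fun t : ℝ => (x + t • EuclideanSpace.single j (1 : ℝ) : Config N) i) =
      fun t => x i + t * (if i = j then 1 else 0) := by
    funext t
    by_cases hij : i = j <;> simp [hij]
  change HasDerivAt (fun t : ℝ => (x + t • EuclideanSpace.single j (1 : ℝ) : Config N) i) _ 0
  rw [h]
  simpa using ((hasDerivAt_id (0 : ℝ)).mul_const (if i = j then (1 : ℝ) else 0)).const_add (x i)

variable [NeZero N]

theorem mulCore_mul {a c : Config N → ℂ} (ha : a.HasTemperateGrowth) (hc : c.HasTemperateGrowth) :
    mulCore a * mulCore c = mulCore (fun x => a x * c x) := by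
  ext f x
  have h : (fun x => a x * c x).HasTemperateGrowth := ha.mul hc
  rw [Module.End.mul_apply, mulCore_apply ha, mulCore_apply hc, mulCore_apply h, mul_assoc]

theorem mulCore_comm {a c : Config N → ℂ} (ha : a.HasTemperateGrowth)
    (hc : c.HasTemperateGrowth) : Commute (mulCore a) (mulCore c) := by
  unfold Commute SemiconjBy
  rw [mulCore_mul ha hc, mulCore_mul hc ha]
  simp_rw [mul_comm]

theorem mulCore_phase_mul_neg {a : Config N → ℝ} (ha : a.HasTemperateGrowth) :
    mulCore (phase a) * mulCore (phase fun x => -a x) = 1 := by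
  ext f x
  rw [Module.End.mul_apply, mulCore_apply (temperate_phase ha),
    mulCore_apply (temperate_phase (temperate_neg ha)), ← mul_assoc, phase_mul_phase_neg, one_mul,
    Module.End.one_apply]

theorem mulCore_phase_neg_mul {a : Config N → ℝ} (ha : a.HasTemperateGrowth) :
    mulCore (phase fun x => -a x) * mulCore (phase a) = 1 := by
  rw [(mulCore_comm (temperate_phase (temperate_neg ha)) (temperate_phase ha)).eq,
    mulCore_phase_mul_neg ha]

/-- Multiplication by `exp (2πi a)`. -/
def gauss (a : Config N → ℝ) (ha : a.HasTemperateGrowth) : Implementer N :=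
  ⟨(mulIso volume (phase a) (temperate_phase ha).1.continuous.measurable (norm_phase a),
    ⟨mulCore (phase a), mulCore (phase fun x => -a x), mulCore_phase_mul_neg ha,
      mulCore_phase_neg_mul ha⟩), fun f => by
    change mulCLM volume (phase a) (temperate_phase ha).1.continuous.measurable
      (exists_bound_of_norm_eq_one (norm_phase a)) (coreIncl N f) =
        coreIncl N (mulCore (phase a) f)
    symm
    rw [eq_mulCLM_iff]
    filter_upwards [coeFn_coreIncl f, coeFn_coreIncl (mulCore (phase a) f)] with x h1 h2
    rw [h2, h1, mulCore_apply (temperate_phase ha)]⟩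

theorem gauss_core {a : Config N → ℝ} (ha : a.HasTemperateGrowth) :
    (gauss a ha).core = mulCore (phase a) := rfl

theorem op_gauss {a : Config N → ℝ} (ha : a.HasTemperateGrowth) :
    Implementer.op (gauss a ha) = mulCLM volume (phase a)
      (temperate_phase ha).1.continuous.measurable (exists_bound_of_norm_eq_one (norm_phase a)) :=
  rfl

theorem gauss_mul_gauss {a c : Config N → ℝ} (ha : a.HasTemperateGrowth)
    (hc : c.HasTemperateGrowth) :
    gauss a ha * gauss c hc = gauss (fun x => a x + c x) (ha.add hc) := by
  apply Implementer.op_injective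
  rw [map_mul, op_gauss, op_gauss, op_gauss]
  ext1 u
  rw [eq_mulCLM_iff]
  filter_upwards [coeFn_mulCLM (temperate_phase hc).1.continuous.measurable
      (exists_bound_of_norm_eq_one (norm_phase c)) u,
    coeFn_mulCLM (temperate_phase ha).1.continuous.measurable
      (exists_bound_of_norm_eq_one (norm_phase a)) (Implementer.op (gauss c hc) u)] with x h1 h2
  refine h2.trans ?_
  rw [op_gauss, h1, ← mul_assoc, phase, phase, phase, ← Complex.exp_add]
  congr 2
  push_cast
  ring

theorem commute_gauss {a c : Config N → ℝ} (ha : a.HasTemperateGrowth)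
    (hc : c.HasTemperateGrowth) : Commute (gauss a ha) (gauss c hc) := by
  unfold Commute SemiconjBy
  rw [gauss_mul_gauss, gauss_mul_gauss]
  simp_rw [add_comm]

/-- Functional calculus for phases. -/
theorem DiagonalizedOnCore.fc_phase {T : Module.End ℂ (Core N)} {g : Implementer N}
    {a : Config N → ℝ} (h : DiagonalizedOnCore T g a) {G : ℝ → ℂ} {s : Config N → ℝ}
    (hs : s.HasTemperateGrowth) (hG : Measurable G) (h1 : ∀ t, ‖G t‖ = 1)
    (hGs : ∀ x, G (a x) = phase s x) :
    fc G T = Implementer.op (g⁻¹ * gauss s hs * g) := by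
  rw [h.fc_eq hG (exists_bound_of_norm_eq_one h1), map_mul, map_mul, op_gauss]
  simp_rw [hGs]

/-! ### Commutation relations on the Schwartz space -/

theorem temperate_coord (j : ZMod (2 * N)) :
    (fun x : Config N => x j).HasTemperateGrowth :=
  (EuclideanSpace.proj (𝕜 := ℝ) j : Config N →L[ℝ] ℝ).hasTemperateGrowth

theorem q_eq_mulCore (j : ZMod (2 * N)) : (q j : Module.End ℂ (Core N)) =
    mulCore fun x => ((x j : ℝ) : ℂ) := rfl

theorem q_apply (j : ZMod (2 * N)) (f : Core N) (x : Config N) : q j f x = (x j : ℂ) * f x :=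
  mulCore_apply (temperate_ofReal (temperate_coord j)) f x

theorem p_apply (j : ZMod (2 * N)) (f : Core N) (x : Config N) :
    p j f x = (2 * (Real.pi : ℂ) * Complex.I)⁻¹ *
      lineDeriv ℝ f x (EuclideanSpace.single j (1 : ℝ)) := by
  change (2 * (Real.pi : ℂ) * Complex.I)⁻¹ • (∂_{EuclideanSpace.single j (1 : ℝ)} f) x = _
  rw [SchwartzMap.lineDerivOp_apply, smul_eq_mul]

theorem commute_q (i j : ZMod (2 * N)) : Commute (q i : Module.End ℂ (Core N)) (q j) :=
  mulCore_comm (temperate_ofReal (temperate_coord i)) (temperate_ofReal (temperate_coord j))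

theorem two_pi_I_inv_mul : (2 * (Real.pi : ℂ) * Complex.I)⁻¹ * (2 * Real.pi * Complex.I) = 1 :=
  inv_mul_cancel₀ Complex.two_pi_I_ne_zero

/-- The commutator of a momentum operator with multiplication by a function. -/
theorem p_mul_mulCore {c : Config N → ℂ} (hc : c.HasTemperateGrowth) (j : ZMod (2 * N))
    {d : Config N → ℂ} (hd : d.HasTemperateGrowth)
    (hcd : ∀ x, HasLineDerivAt ℝ c ((2 * (Real.pi : ℂ) * Complex.I) * d x) x
      (EuclideanSpace.single j (1 : ℝ))) :
    p j * mulCore c = mulCore c * p j + mulCore d := by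
  ext f x
  have h1 : (mulCore c f : Config N → ℂ) = fun x => c x * f x :=
    funext fun x => mulCore_apply hc f x
  have h2 : HasLineDerivAt ℝ f (lineDeriv ℝ f x (EuclideanSpace.single j (1 : ℝ))) x
      (EuclideanSpace.single j (1 : ℝ)) :=
    (f.differentiableAt.lineDifferentiableAt).hasLineDerivAt
  have h3 : HasLineDerivAt ℝ (fun x => c x * f x) _ x (EuclideanSpace.single j (1 : ℝ)) :=
    HasDerivAt.mul (hcd x) h2
  rw [Module.End.mul_apply, p_apply, h1, h3.lineDeriv, LinearMap.add_apply, Module.End.mul_apply,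
    add_apply, mulCore_apply hc, mulCore_apply hd, p_apply]
  simp only [zero_smul, add_zero]
  linear_combination (d x * f x) * two_pi_I_inv_mul

/-- Conjugation of momenta by phases. -/
theorem gauss_semiconj_p {a : Config N → ℝ} (ha : a.HasTemperateGrowth) (j : ZMod (2 * N))
    {d : Config N → ℝ} (hd : d.HasTemperateGrowth)
    (had : ∀ x, HasLineDerivAt ℝ a (d x) x (EuclideanSpace.single j (1 : ℝ))) :
    SemiconjBy (gauss a ha).core (p j) (p j - mulCore fun x => (d x : ℂ)) := by
  have hd' := temperate_ofReal hd
  -- Differentiating the phase brings down `2πi d`, and the normalization of `p` removes the `2πi`.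
  have h := p_mul_mulCore (temperate_phase ha) j ((hd').mul (temperate_phase ha)) (fun x => by
    have h1 : HasDerivAt (fun t : ℝ => (a (x + t • EuclideanSpace.single j (1 : ℝ)) : ℂ))
      (d x : ℂ) 0 := (had x).ofReal_comp
    have h2 := (h1.const_mul (((2 * Real.pi : ℝ) : ℂ) * Complex.I)).cexp
    have h3 : HasLineDerivAt ℝ (phase a) _ x (EuclideanSpace.single j (1 : ℝ)) := h2
    convert h3 using 1
    simp only [Pi.mul_apply, phase, zero_smul, add_zero]
    push_cast
    ring)
  unfold SemiconjBy
  rw [gauss_core, sub_mul, h]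
  have h4 := mulCore_mul hd' (temperate_phase ha)
  rw [h4]
  exact (add_sub_cancel_right _ _).symm

theorem gauss_commute_mulCore {a : Config N → ℝ} (ha : a.HasTemperateGrowth)
    {c : Config N → ℂ} (hc : c.HasTemperateGrowth) : Commute (gauss a ha).core (mulCore c) :=
  mulCore_comm (temperate_phase ha) hc

theorem gauss_commute_q {a : Config N → ℝ} (ha : a.HasTemperateGrowth) (j : ZMod (2 * N)) :
    Commute (gauss a ha).core (q j) :=
  gauss_commute_mulCore ha (temperate_ofReal (temperate_coord j))

theorem mulCore_smul {c : Config N → ℂ} (hc : c.HasTemperateGrowth) (r : ℂ) :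
    mulCore (fun x => r * c x) = r • mulCore c := by
  have h : (fun x => r * c x).HasTemperateGrowth := (Function.HasTemperateGrowth.const r).mul hc
  ext f x
  rw [LinearMap.smul_apply, smul_apply, mulCore_apply h, mulCore_apply hc, smul_eq_mul, mul_assoc]

theorem mulCore_add {a c : Config N → ℂ} (ha : a.HasTemperateGrowth) (hc : c.HasTemperateGrowth) :
    mulCore (fun x => a x + c x) = mulCore a + mulCore c := by
  have h : (fun x => a x + c x).HasTemperateGrowth := ha.add hc
  ext f x
  rw [LinearMap.add_apply, add_apply, mulCore_apply h, mulCore_apply hc, mulCore_apply ha, add_mul]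

theorem mulCore_zero : mulCore (fun _ : Config N => (0 : ℂ)) = 0 := by
  ext f x
  rw [mulCore_apply (Function.HasTemperateGrowth.const 0)]
  simp

theorem commutator_p_q (i j : ZMod (2 * N)) :
    (p i * q j - q j * p i : Module.End ℂ (Core N)) =
      if i = j then (2 * (Real.pi : ℂ) * Complex.I)⁻¹ • 1 else 0 := by
  rw [q_eq_mulCore, p_mul_mulCore (d := fun _ => if j = i then (2 * (Real.pi : ℂ) * Complex.I)⁻¹
      else 0) (temperate_ofReal (temperate_coord j)) i (Function.HasTemperateGrowth.const _)
      (fun x => by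
        have h1 : HasDerivAt (fun t : ℝ => ((x + t • EuclideanSpace.single i (1 : ℝ)) j : ℂ))
          _ 0 := (hasLineDerivAt_coord j i x).ofReal_comp
        have h2 : (2 * (Real.pi : ℂ) * Complex.I) *
            (if j = i then (2 * (Real.pi : ℂ) * Complex.I)⁻¹ else 0) =
              ((if j = i then 1 else 0 : ℝ) : ℂ) := by
          split_ifs
          · rw [mul_inv_cancel₀ Complex.two_pi_I_ne_zero]; simp
          · simp
        rw [h2]
        exact h1), add_sub_cancel_left]
  ext f x
  rw [mulCore_apply (Function.HasTemperateGrowth.const _)]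
  by_cases h : i = j
  · simp [h]
  · simp [h, Ne.symm h]

/-- Symmetry of the second derivative of a smooth function. -/
theorem commute_p (i j : ZMod (2 * N)) : Commute (p i : Module.End ℂ (Core N)) (p j) := by
  unfold Commute SemiconjBy p
  rw [smul_mul_smul_comm, smul_mul_smul_comm]
  congr 1
  ext f x
  set u : Config N := EuclideanSpace.single i (1 : ℝ)
  set v : Config N := EuclideanSpace.single j (1 : ℝ)
  change (∂_{u} (∂_{v} f)) x = (∂_{v} (∂_{u} f)) x
  have hf : ∀ v, (fun y => (∂_{v} f) y) = fun y => fderiv ℝ f y v := fun v => funext fun y => by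
    rw [SchwartzMap.lineDerivOp_apply_eq_fderiv]
  have hd : DifferentiableAt ℝ (fderiv ℝ f) x :=
    ((f.smooth 2).fderiv_right (m := 1) (by norm_num)).differentiable (by norm_num) x
  have hg : ∀ u v, (∂_{u} (∂_{v} f)) x = fderiv ℝ (fderiv ℝ f) x u v := fun u v => by
    rw [SchwartzMap.lineDerivOp_apply_eq_fderiv]
    change fderiv ℝ (fun y => (∂_{v} f) y) x u = _
    rw [hf, fderiv_clm_apply hd (differentiableAt_const _)]
    simp
  rw [hg, hg]
  exact (((f.smooth 2).contDiffAt).isSymmSndFDerivAt (by simp)) u v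

/-! ### The Fourier transform -/

open FourierTransform in
variable (N) in
/-- The Fourier transform. -/
def fourierImp : Implementer N :=
  ⟨(Lp.fourierTransformₗᵢ (Config N) ℂ,
    ⟨(fourierEquiv ℂ (Core N)).toLinearMap, (fourierEquiv ℂ (Core N)).symm.toLinearMap,
      LinearMap.ext fun f => (fourierEquiv ℂ (Core N)).apply_symm_apply f,
      LinearMap.ext fun f => (fourierEquiv ℂ (Core N)).symm_apply_apply f⟩),
    fun f => SchwartzMap.toLp_fourier_eq f⟩

open FourierTransform in
theorem fourierImp_core_apply (f : Core N) : (fourierImp N).core f = 𝓕 f := rfl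

theorem smulLeftCLM_inner_single (j : ZMod (2 * N)) (f : Core N) :
    SchwartzMap.smulLeftCLM ℂ (fun x : Config N => inner ℝ x (EuclideanSpace.single j (1 : ℝ))) f =
      q j f := by
  ext x
  have h : (fun x : Config N => inner ℝ x (EuclideanSpace.single j (1 : ℝ))).HasTemperateGrowth :=
    by fun_prop
  rw [SchwartzMap.smulLeftCLM_apply_apply h, q_apply]
  simp [EuclideanSpace.inner_single_right]

/-- The factor `(2πi)⁻¹` in `p` matches the `2π` in the exponent of the Fourier transform, so no
constants remain. -/
theorem fourierImp_semiconj_p (j : ZMod (2 * N)) :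
    SemiconjBy (fourierImp N).core (p j) (q j) := by
  refine LinearMap.ext fun f => ?_
  rw [Module.End.mul_apply, Module.End.mul_apply]
  change (fourierImp N).core ((2 * (Real.pi : ℂ) * Complex.I)⁻¹ •
    (∂_{EuclideanSpace.single j (1 : ℝ)} f)) = _
  rw [map_smul, fourierImp_core_apply, fourierImp_core_apply, SchwartzMap.fourier_lineDerivOp_eq,
    smul_smul, two_pi_I_inv_mul, one_smul, smulLeftCLM_inner_single]

theorem fourierImp_semiconj_q (j : ZMod (2 * N)) :
    SemiconjBy (fourierImp N).core (q j) (-p j) := by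
  refine LinearMap.ext fun f => ?_
  rw [Module.End.mul_apply, Module.End.mul_apply, LinearMap.neg_apply]
  change _ = -((2 * (Real.pi : ℂ) * Complex.I)⁻¹ •
    (∂_{EuclideanSpace.single j (1 : ℝ)} ((fourierImp N).core f)))
  rw [fourierImp_core_apply f, SchwartzMap.lineDerivOp_fourier_eq, smulLeftCLM_inner_single,
    ← fourierImp_core_apply, map_smul, smul_smul, mul_neg,
    two_pi_I_inv_mul]
  simp

/-! ### Permutations -/

/-- The permutation of coordinates `x ↦ (i ↦ x (σ i))` as a linear isometry. -/
def permIso (σ : Equiv.Perm (ZMod (2 * N))) : Config N ≃ₗᵢ[ℝ] Config N :=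
  LinearIsometryEquiv.piLpCongrLeft 2 ℝ ℝ σ.symm

theorem permIso_apply (σ : Equiv.Perm (ZMod (2 * N))) (x : Config N) (i : ZMod (2 * N)) :
    permIso σ x i = x (σ i) := by
  simp [permIso, LinearIsometryEquiv.piLpCongrLeft_apply, Equiv.piCongrLeft'_apply]

theorem P_coeFn (σ : Equiv.Perm (ZMod (2 * N))) (u : L2 N) :
    P σ u =ᵐ[volume] fun x => u (permIso σ x) :=
  Lp.coeFn_compMeasurePreserving _ (LinearIsometryEquiv.measurePreserving (permIso σ))

theorem P_mul (σ τ : Equiv.Perm (ZMod (2 * N))) : (P σ * P τ : L2 N →L[ℂ] L2 N) = P (σ * τ) := by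
  ext1 u
  refine Lp.ext ?_
  -- The almost everywhere description of `P τ u` has to be pulled back along `permIso σ`, which is
  -- legitimate since this map preserves null sets.
  have h1 := (LinearIsometryEquiv.measurePreserving
    (permIso (N := N) σ)).quasiMeasurePreserving.ae_eq_comp
    (P_coeFn τ u)
  filter_upwards [P_coeFn σ (P τ u), P_coeFn (σ * τ) u, h1] with x h2 h3 h4
  change P σ (P τ u) x = _
  rw [h2, h3]
  refine h4.trans ?_
  simp only [Function.comp_apply]
  congr 1

theorem P_one : (P 1 : L2 N →L[ℂ] L2 N) = 1 := by
  ext1 u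
  refine Lp.ext ?_
  filter_upwards [P_coeFn 1 u] with x h2
  rw [h2]
  change u _ = u x
  congr 1

/-- Permutation of coordinates on the Schwartz space. -/
def permCore (σ : Equiv.Perm (ZMod (2 * N))) : Module.End ℂ (Core N) :=
  (SchwartzMap.compCLMOfContinuousLinearEquiv ℂ
    (permIso σ).toContinuousLinearEquiv).toLinearMap

theorem permCore_apply (σ : Equiv.Perm (ZMod (2 * N))) (f : Core N) (x : Config N) :
    permCore σ f x = f (permIso σ x) := rfl

theorem permCore_mul (σ τ : Equiv.Perm (ZMod (2 * N))) :
    permCore σ * permCore τ = (permCore (σ * τ) : Module.End ℂ (Core N)) := by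
  ext f x
  rw [Module.End.mul_apply, permCore_apply, permCore_apply, permCore_apply]
  congr 1

theorem permCore_one : (permCore 1 : Module.End ℂ (Core N)) = 1 := by
  ext f x
  rw [permCore_apply, Module.End.one_apply]
  congr 1

/-- The permutation operators. -/
def permImp (σ : Equiv.Perm (ZMod (2 * N))) : Implementer N :=
  ⟨({ toLinearEquiv := LinearEquiv.ofLinearMap (P σ).toLinearMap (P σ⁻¹).toLinearMap
        (by
          have h : (P σ * P σ⁻¹ : L2 N →L[ℂ] L2 N) = 1 := by rw [P_mul, mul_inv_cancel, P_one]
          exact congrArg ContinuousLinearMap.toLinearMap h)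
        (by
          have h : (P σ⁻¹ * P σ : L2 N →L[ℂ] L2 N) = 1 := by rw [P_mul, inv_mul_cancel, P_one]
          exact congrArg ContinuousLinearMap.toLinearMap h)
      norm_map' := fun u => LinearIsometry.norm_map _ u },
    ⟨permCore σ, permCore σ⁻¹, by rw [permCore_mul, mul_inv_cancel, permCore_one],
      by rw [permCore_mul, inv_mul_cancel, permCore_one]⟩), fun f => by
    change P σ (coreIncl N f) = coreIncl N (permCore σ f)
    refine Lp.ext ?_
    have h1 := (LinearIsometryEquiv.measurePreserving
      (permIso (N := N) σ)).quasiMeasurePreserving.ae_eq_comp (coeFn_coreIncl f)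
    filter_upwards [P_coeFn σ (coreIncl N f), coeFn_coreIncl (permCore σ f), h1] with x h2 h3 h4
    rw [h2, h3, permCore_apply]
    exact h4⟩

theorem op_permImp (σ : Equiv.Perm (ZMod (2 * N))) : Implementer.op (permImp σ) = P σ := rfl

theorem permImp_semiconj_q (σ : Equiv.Perm (ZMod (2 * N))) (j : ZMod (2 * N)) :
    SemiconjBy (permImp σ).core (q j) (q (σ j)) := by
  refine LinearMap.ext fun f => SchwartzMap.ext fun x => ?_
  change permCore σ (q j f) x = q (σ j) (permCore σ f) x
  rw [permCore_apply, q_apply, q_apply, permCore_apply, permIso_apply]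

theorem permImp_semiconj_p (σ : Equiv.Perm (ZMod (2 * N))) (j : ZMod (2 * N)) :
    SemiconjBy (permImp σ).core (p j) (p (σ j)) := by
  refine LinearMap.ext fun f => SchwartzMap.ext fun x => ?_
  change permCore σ (p j f) x = p (σ j) (permCore σ f) x
  rw [permCore_apply, p_apply, p_apply]
  congr 1
  -- Chain rule: differentiating after the substitution in direction `σ j` is differentiating before
  -- it in direction `j`.
  have h : permIso σ (EuclideanSpace.single (σ j) (1 : ℝ)) =
      (EuclideanSpace.single j (1 : ℝ) : Config N) := by
    ext i
    simp [permIso_apply]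
  unfold lineDeriv
  congr 1
  funext t
  rw [permCore_apply, map_add (permIso σ), map_smul (permIso σ), h]

end

section

/-! ## The quantum dilogarithm has modulus one on the real line -/

/-- No convergence is required: the integral of a jointly measurable integrand is measurable in the
parameter, with value zero wherever the integrand is not integrable. -/
theorem measurable_phi (b : ℂ) : Measurable (phi b) := by
  unfold phi
  refine Complex.continuous_exp.measurable.comp (Measurable.const_mul ?_ _)
  refine StronglyMeasurable.measurable
    (f := fun z : ℝ => ∫ u : ℝ, (fun w : ℂ => Complex.exp (-2 * Complex.I * (z : ℂ) * w) /
      (Complex.sinh (w * b) * Complex.sinh (w / b) * w))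
      ((u : ℂ) + (contourHeight b : ℂ) * Complex.I)) ?_
  refine StronglyMeasurable.integral_prod_right
    (f := fun z u : ℝ => (fun w : ℂ => Complex.exp (-2 * Complex.I * (z : ℂ) * w) /
      (Complex.sinh (w * b) * Complex.sinh (w / b) * w))
      ((u : ℂ) + (contourHeight b : ℂ) * Complex.I)) ?_
  refine Measurable.stronglyMeasurable ?_
  refine Measurable.div (Continuous.measurable ?_) (Continuous.measurable ?_)
  · fun_prop
  · have : Continuous Complex.sinh := Complex.continuous_sinh
    fun_prop

/-- For real `b` each factor is compatible with conjugation; for `|b| = 1` conjugation exchanges `b`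
and `b⁻¹`, hence the two factors. -/
theorem star_sinh_mul_sinh {b : ℂ} (hb : b.im = 0 ∨ ‖b‖ = 1) (w : ℂ) :
    star (Complex.sinh (w * b) * Complex.sinh (w / b)) =
      Complex.sinh (star w * b) * Complex.sinh (star w / b) := by
  simp only [RCLike.star_def, map_mul, ← Complex.sinh_conj, map_div₀]
  rcases hb with hb | hb
  · rw [Complex.conj_eq_iff_im.2 hb]
  · have h1 : (starRingEnd ℂ) b = b⁻¹ := by
      rw [Complex.inv_def, Complex.normSq_eq_norm_sq, hb]
      simp
    rw [h1, div_inv_eq_mul, ← div_eq_mul_inv, mul_comm]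

/-- The reflection `w ↦ -w̄` preserves the contour and turns the integrand `F` into minus its
conjugate, `star (F u) = -F (-u)`. The integral is therefore purely imaginary. -/
theorem norm_phi {b : ℂ} (hb : b.im = 0 ∨ ‖b‖ = 1) (z : ℝ) : ‖phi b z‖ = 1 := by
  set F : ℝ → ℂ := fun u => (fun w : ℂ => Complex.exp (-2 * Complex.I * (z : ℂ) * w) /
      (Complex.sinh (w * b) * Complex.sinh (w / b) * w))
      ((u : ℂ) + (contourHeight b : ℂ) * Complex.I) with hF
  have h1 : ∀ u, star (F u) = -F (-u) := by
    intro u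
    have hw : star ((u : ℂ) + (contourHeight b : ℂ) * Complex.I) =
        -(((-u : ℝ) : ℂ) + (contourHeight b : ℂ) * Complex.I) := by
      simp
      ring
    simp only [hF]
    rw [star_div₀, star_mul, star_sinh_mul_sinh hb, hw]
    have he : star (Complex.exp (-2 * Complex.I * (z : ℂ) *
        ((u : ℂ) + (contourHeight b : ℂ) * Complex.I))) =
        Complex.exp (-2 * Complex.I * (z : ℂ) *
          (((-u : ℝ) : ℂ) + (contourHeight b : ℂ) * Complex.I)) := by
      rw [RCLike.star_def, ← Complex.exp_conj]
      congr 1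
      have h2 : (starRingEnd ℂ) 2 = 2 := map_ofNat _ 2
      simp [h2]
      ring
    rw [he]
    generalize ((-u : ℝ) : ℂ) + (contourHeight b : ℂ) * Complex.I = v
    rw [neg_mul v b, neg_div, Complex.sinh_neg, Complex.sinh_neg]
    ring
  have h2 : star (∫ u, F u) = -∫ u, F u := by
    rw [RCLike.star_def, ← integral_conj]
    calc ∫ u, (starRingEnd ℂ) (F u) = ∫ u, -F (-u) := by
          refine integral_congr_ae (Filter.Eventually.of_forall h1)
      _ = -∫ u, F u := by rw [integral_neg, integral_neg_eq_self (fun u => F u) volume]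
  have h3 : (∫ u, F u).re = 0 := by
    have := congrArg Complex.re h2
    simp at this
    linarith
  rw [phi, Complex.norm_exp]
  simp only [Complex.mul_re, Real.exp_eq_one_iff]
  rw [h3]
  norm_num

theorem norm_phi_inv {b : ℂ} (hb : b.im = 0 ∨ ‖b‖ = 1) (z : ℝ) : ‖(phi b z)⁻¹‖ = 1 := by
  rw [norm_inv, norm_phi hb, inv_one]

theorem im_add_inv_sq {b : ℂ} (hb : b.im = 0 ∨ ‖b‖ = 1) : ((b + b⁻¹) ^ 2).im = 0 := by
  have h : (b + b⁻¹).im = 0 := by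
    rcases hb with hb | hb
    · simp [hb]
    · rw [Complex.add_im, Complex.inv_im, Complex.normSq_eq_norm_sq, hb]
      simp
  rw [sq, Complex.mul_im, h]
  simp

theorem norm_zetaPow {b : ℂ} (hb : b.im = 0 ∨ ‖b‖ = 1) (x : ℝ) : ‖zetaPow b x‖ = 1 := by
  have h : (b + b⁻¹) ^ 2 = (((b + b⁻¹) ^ 2).re : ℂ) := by
    apply Complex.ext
    · simp
    · rw [im_add_inv_sq hb]; simp
  rw [zetaPow, h, show -(Complex.I * (Real.pi : ℂ) * (((b + b⁻¹) ^ 2).re : ℂ) / 12) * (x : ℂ) =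
    ((-(Real.pi * ((b + b⁻¹) ^ 2).re / 12 * x) : ℝ) : ℂ) * Complex.I by push_cast; ring,
    Complex.norm_exp_ofReal_mul_I]

theorem zetaPow_mul_neg (b : ℂ) (x : ℝ) : zetaPow b x * zetaPow b (-x) = 1 := by
  rw [zetaPow, zetaPow, ← Complex.exp_add]
  simp

end

section

/-! ## Ordered products -/

section OrderedProducts

variable {M M' : Type*} [Monoid M] [Monoid M']

theorem prodUpTo_zero (F : ℕ → M) : prodUpTo 0 F = 1 := rfl

theorem prodUpTo_succ (n : ℕ) (F : ℕ → M) : prodUpTo (n + 1) F = prodUpTo n F * F (n + 1) := by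
  simp [prodUpTo, List.range_succ]

theorem prodUpTo_succ' (n : ℕ) (F : ℕ → M) :
    prodUpTo (n + 1) F = F 1 * prodUpTo n fun i => F (i + 1) := by
  simp [prodUpTo, List.range_succ_eq_map, Function.comp_def]

theorem map_prodUpTo (φ : M →* M') (n : ℕ) (F : ℕ → M) :
    φ (prodUpTo n F) = prodUpTo n fun i => φ (F i) := by
  induction n with
  | zero => simp [prodUpTo_zero]
  | succ n ih => rw [prodUpTo_succ, prodUpTo_succ, map_mul, ih]

theorem prodUpTo_congr {n : ℕ} {F G : ℕ → M} (h : ∀ i, 1 ≤ i → i ≤ n → F i = G i) :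
    prodUpTo n F = prodUpTo n G := by
  unfold prodUpTo
  congr 1
  refine List.map_congr_left fun i hi => h _ (by omega) ?_
  have := List.mem_range.1 hi
  omega

/-- The rightmost factor acts first, so the operator passes through `X n, X (n - 1), …, X 0`. -/
theorem prodUpTo_semiconjBy {n : ℕ} {F : ℕ → M} (X : ℕ → M)
    (h : ∀ i < n, SemiconjBy (F (i + 1)) (X (i + 1)) (X i)) :
    SemiconjBy (prodUpTo n F) (X n) (X 0) := by
  induction n with
  | zero => exact SemiconjBy.one_left _
  | succ n ih =>
    rw [prodUpTo_succ]
    exact (ih fun i hi => h i (by omega)).mul_left (h n (by omega))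

theorem prodUpTo_commute {n : ℕ} {F : ℕ → M} {x : M}
    (h : ∀ i, 1 ≤ i → i ≤ n → Commute (F i) x) : Commute (prodUpTo n F) x :=
  prodUpTo_semiconjBy (fun _ => x) fun i hi => h _ (by omega) (by omega)

/-- If only the factor number `m` acts nontrivially then the product acts as this factor. -/
theorem prodUpTo_semiconjBy_single {n : ℕ} {F : ℕ → M} {x y : M} (m : ℕ) (hm : 1 ≤ m)
    (hmn : m ≤ n) (h : SemiconjBy (F m) x y)
    (hx : ∀ i, 1 ≤ i → i ≤ n → i ≠ m → Commute (F i) x)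
    (hy : ∀ i, 1 ≤ i → i ≤ n → i ≠ m → Commute (F i) y) : SemiconjBy (prodUpTo n F) x y := by
  -- The intermediate operators are `x` until the factor `m` has been passed and `y` from then on.
  have := prodUpTo_semiconjBy (n := n) (F := F) (fun i => if m ≤ i then x else y) fun i hi => by
    rcases lt_trichotomy (i + 1) m with h1 | h1 | h1
    · rw [if_neg (by omega), if_neg (by omega)]
      exact hy _ (by omega) (by omega) (by omega)
    · rw [if_pos (by omega), if_neg (by omega), h1]
      exact h
    · rw [if_pos (by omega), if_pos (by omega)]
      exact hx _ (by omega) (by omega) (by omega)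
  rwa [if_pos hmn, if_neg (by omega)] at this

/-- Only factors of different index have to commute; `F i` and `G i` stay in their order. This
matters where `F i` is an exponential of momenta and `G i` contains a function of the positions it
moves. -/
theorem prodUpTo_mul {n : ℕ} {F G : ℕ → M}
    (h : ∀ i j, 1 ≤ i → i ≤ n → 1 ≤ j → j ≤ n → i ≠ j → Commute (F i) (G j)) :
    prodUpTo n (fun i => F i * G i) = prodUpTo n F * prodUpTo n G := by
  induction n with
  | zero => simp [prodUpTo_zero]
  | succ n ih =>
    have h1 : Commute (prodUpTo n G) (F (n + 1)) := prodUpTo_commute fun i h1 h2 =>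
      (h (n + 1) i (by omega) (by omega) (by omega) (by omega) (by omega)).symm
    rw [prodUpTo_succ, prodUpTo_succ, prodUpTo_succ, ih fun i j h1 h2 h3 h4 =>
      h i j h1 (by omega) h3 (by omega), mul_assoc, ← mul_assoc _ (F (n + 1)), h1.eq]
    simp only [mul_assoc]

theorem prodUpTo_one (n : ℕ) : prodUpTo n (fun _ => (1 : M)) = 1 := by
  simp [prodUpTo]

theorem prodUpTo_mul_eq_one {n : ℕ} {F G : ℕ → M}
    (h : ∀ i j, 1 ≤ i → i ≤ n → 1 ≤ j → j ≤ n → i ≠ j → Commute (F i) (G j))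
    (h1 : ∀ i, 1 ≤ i → i ≤ n → F i * G i = 1) : prodUpTo n F * prodUpTo n G = 1 := by
  rw [← prodUpTo_mul h, prodUpTo_congr h1, prodUpTo_one]

theorem prodUpTo_mem {S : Type*} [SetLike S M] [SubmonoidClass S M] (s : S) {n : ℕ} {F : ℕ → M}
    (h : ∀ i, 1 ≤ i → i ≤ n → F i ∈ s) : prodUpTo n F ∈ s := by
  induction n with
  | zero => exact one_mem s
  | succ n ih =>
    rw [prodUpTo_succ]
    exact mul_mem (ih fun i h1 h2 => h i h1 (by omega)) (h _ (by omega) le_rfl)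

/-- Cyclic shift of an ordered product of commuting factors. -/
theorem prodUpTo_shift {n : ℕ} {F : ℕ → M} (hc : ∀ i j, Commute (F i) (F j))
    (hF : F (n + 1) = F 1) {x : M} (hx : x * F 1 = 1) :
    prodUpTo n (fun i => F (i + 1)) = prodUpTo n F := by
  -- Both sides equal the product of `n + 1` factors, whose last factor is again `F 1`; the left
  -- inverse `x` then cancels `F 1`.
  have h1 : F 1 * prodUpTo n (fun i => F (i + 1)) = F 1 * prodUpTo n F := by
    rw [← prodUpTo_succ', prodUpTo_succ, hF]
    exact prodUpTo_commute fun i _ _ => hc i 1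
  calc _ = x * F 1 * prodUpTo n (fun i => F (i + 1)) := by rw [hx, one_mul]
    _ = x * F 1 * prodUpTo n F := by rw [mul_assoc, h1, mul_assoc]
    _ = _ := by rw [hx, one_mul]

end OrderedProducts

variable {N : ℕ} [NeZero N]

/-! ## The operators `A_k` -/

namespace Implementer

/-- Restriction to the Schwartz space as a homomorphism. -/
def coreHom : Implementer N →* Module.End ℂ (Core N) where
  toFun := core
  map_one' := rfl
  map_mul' _ _ := rfl

theorem semiconjBy_mul {g h : Implementer N} {S T R : Module.End ℂ (Core N)}
    (hg : SemiconjBy g.core T R) (hh : SemiconjBy h.core S T) : SemiconjBy (g * h).core S R :=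
  SemiconjBy.mul_left hg hh

end Implementer

theorem temperate_const_mul_sq (c : ℝ) (k : ZMod (2 * N)) :
    (fun x : Config N => c * x k ^ 2).HasTemperateGrowth :=
  (Function.HasTemperateGrowth.const c).mul ((temperate_coord k).pow 2)

theorem temperate_const_mul_mul (c : ℝ) (k l : ZMod (2 * N)) :
    (fun x : Config N => c * (x k * x l)).HasTemperateGrowth :=
  (Function.HasTemperateGrowth.const c).mul ((temperate_coord k).mul (temperate_coord l))

/-- Multiplication by `exp (2πi c x_k²)`. -/
def gaussSq (c : ℝ) (k : ZMod (2 * N)) : Implementer N := gauss _ (temperate_const_mul_sq c k)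

/-- Multiplication by `exp (2πi c x_k x_l)`. -/
def gaussMul (c : ℝ) (k l : ZMod (2 * N)) : Implementer N :=
  gauss _ (temperate_const_mul_mul c k l)

theorem gaussSq_semiconj_p_self (c : ℝ) (k : ZMod (2 * N)) :
    SemiconjBy (gaussSq c k).core (p k) (p k - (2 * c : ℂ) • q k) := by
  have h := gauss_semiconj_p (temperate_const_mul_sq c k) k
    (d := fun x => 2 * c * x k)
    ((Function.HasTemperateGrowth.const (2 * c)).mul (temperate_coord k)) fun x => by
      have h1 : HasDerivAt (fun t : ℝ => (x + t • EuclideanSpace.single k (1 : ℝ) : Config N) k)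
        _ 0 := hasLineDerivAt_coord k k x
      have h2 : HasLineDerivAt ℝ (fun x : Config N => c * x k ^ 2) _ x
        (EuclideanSpace.single k (1 : ℝ)) := (h1.pow 2).const_mul c
      convert! h2 using 1
      simp
      ring
  convert! h using 2
  rw [q_eq_mulCore, ← mulCore_smul (temperate_ofReal (temperate_coord k))]
  push_cast
  rfl

theorem gaussSq_commute_p {k j : ZMod (2 * N)} (hjk : j ≠ k) (c : ℝ) :
    Commute (gaussSq c k).core (p j) := by
  have h := gauss_semiconj_p (temperate_const_mul_sq c k) j
    (d := fun x => 0) (Function.HasTemperateGrowth.const 0) fun x => by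
      have h1 : HasDerivAt (fun t : ℝ => (x + t • EuclideanSpace.single j (1 : ℝ) : Config N) k)
        _ 0 := hasLineDerivAt_coord k j x
      have h2 : HasLineDerivAt ℝ (fun x : Config N => c * x k ^ 2) _ x
        (EuclideanSpace.single j (1 : ℝ)) := (h1.pow 2).const_mul c
      convert! h2 using 1
      simp [hjk.symm]
  simp only [Complex.ofReal_zero, mulCore_zero, sub_zero] at h
  exact h

theorem gaussMul_semiconj_p_left {k l : ZMod (2 * N)} (hkl : k ≠ l) (c : ℝ) :
    SemiconjBy (gaussMul c k l).core (p k) (p k - (c : ℂ) • q l) := by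
  have h := gauss_semiconj_p (temperate_const_mul_mul c k l) k
    (d := fun x => c * x l)
    ((Function.HasTemperateGrowth.const c).mul (temperate_coord l)) fun x => by
      have h1 : HasDerivAt (fun t : ℝ => (x + t • EuclideanSpace.single k (1 : ℝ) : Config N) k)
        _ 0 := hasLineDerivAt_coord k k x
      have h1' : HasDerivAt (fun t : ℝ => (x + t • EuclideanSpace.single k (1 : ℝ) : Config N) l)
        _ 0 := hasLineDerivAt_coord l k x
      have h2 : HasLineDerivAt ℝ (fun x : Config N => c * (x k * x l)) _ x
        (EuclideanSpace.single k (1 : ℝ)) := (h1.mul h1').const_mul c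
      convert! h2 using 1
      simp [hkl.symm]
  convert! h using 2
  rw [q_eq_mulCore, ← mulCore_smul (temperate_ofReal (temperate_coord l))]
  push_cast
  rfl

theorem gaussMul_comm (c : ℝ) (k l : ZMod (2 * N)) : gaussMul c k l = gaussMul c l k := by
  unfold gaussMul
  congr 1
  funext x
  ring

theorem gaussMul_commute_p {k l j : ZMod (2 * N)} (hjk : j ≠ k) (hjl : j ≠ l) (c : ℝ) :
    Commute (gaussMul c k l).core (p j) := by
  have h := gauss_semiconj_p (temperate_const_mul_mul c k l) j
    (d := fun x => 0) (Function.HasTemperateGrowth.const 0) fun x => by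
      have h1 : HasDerivAt (fun t : ℝ => (x + t • EuclideanSpace.single j (1 : ℝ) : Config N) k)
        _ 0 := hasLineDerivAt_coord k j x
      have h1' : HasDerivAt (fun t : ℝ => (x + t • EuclideanSpace.single j (1 : ℝ) : Config N) l)
        _ 0 := hasLineDerivAt_coord l j x
      have h2 : HasLineDerivAt ℝ (fun x : Config N => c * (x k * x l)) _ x
        (EuclideanSpace.single j (1 : ℝ)) := (h1.mul h1').const_mul c
      convert! h2 using 1
      simp [hjk.symm, hjl.symm]
  simp only [Complex.ofReal_zero, mulCore_zero, sub_zero] at h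
  exact h

theorem op_gauss_const (t : ℝ) :
    Implementer.op (gauss (fun _ : Config N => t) (Function.HasTemperateGrowth.const t)) =
      Complex.exp (2 * Real.pi * Complex.I * t) • 1 := by
  ext1 u
  rw [op_gauss]
  symm
  rw [eq_mulCLM_iff]
  filter_upwards [Lp.coeFn_smul (Complex.exp (2 * Real.pi * Complex.I * t)) u] with x hx
  rw [phase]
  push_cast
  exact hx

theorem gauss_const_commute (t : ℝ) (S : Module.End ℂ (Core N)) :
    Commute (gauss (fun _ : Config N => t) (Function.HasTemperateGrowth.const t)).core S := by
  have h : (gauss (fun _ : Config N => t) (Function.HasTemperateGrowth.const t)).core =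
      Complex.exp (2 * Real.pi * Complex.I * t) • 1 := by
    ext f x
    rw [gauss_core, mulCore_apply (temperate_phase (Function.HasTemperateGrowth.const t)), phase]
    push_cast
    rfl
  rw [h]
  exact (Commute.one_left S).smul_left _

/-- The unitary operator `A_k`. -/
def implA (k : ZMod (2 * N)) : Implementer N :=
  -- As `gauss` includes the factor `2πi`, the constants `-1/6`, `3/2`, `1/2` encode `e^{-iπ/3}`,
  -- `e^{3πi q²}` and `e^{iπ(p+q)²}`; the last is a Gaussian conjugated by the unitary that turns `p
  -- + q` into `q`.
  gauss (fun _ => -1 / 6) (Function.HasTemperateGrowth.const _) *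
    (gaussSq (3 / 2) k * ((fourierImp N * gaussSq (1 / 2) k)⁻¹ * gaussSq (1 / 2) k *
      (fourierImp N * gaussSq (1 / 2) k)))

theorem diagonalized_mulCore {a : Config N → ℝ} (ha : a.HasTemperateGrowth) :
    DiagonalizedOnCore (mulCore fun x => (a x : ℂ)) 1 a :=
  ⟨ha, SemiconjBy.one_left _⟩

theorem gaussSq_half_semiconj_p (k : ZMod (2 * N)) :
    SemiconjBy (gaussSq (1 / 2) k).core (p k) (p k - q k) := by
  have := gaussSq_semiconj_p_self (1 / 2) k
  push_cast at this
  rwa [show (2 * (1 / 2) : ℂ) = 1 by norm_num, one_smul] at this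

theorem fourier_gaussSq_semiconj_p (k : ZMod (2 * N)) :
    SemiconjBy (fourierImp N * gaussSq (1 / 2) k).core (p k) (p k + q k) := by
  have := ((fourierImp_semiconj_p k).sub_right (fourierImp_semiconj_q k)).mul_left
    (gaussSq_half_semiconj_p k)
  rwa [sub_neg_eq_add, add_comm] at this

theorem fourier_gaussSq_semiconj_q (k : ZMod (2 * N)) :
    SemiconjBy (fourierImp N * gaussSq (1 / 2) k).core (q k) (-p k) :=
  (fourierImp_semiconj_q k).mul_left (gauss_commute_q _ k)

/-- Multiplication by `e^{πi q²}` takes `p + q` to `p`, and the Fourier transform takes `p` to `q`.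
-/
theorem diagonalized_p_add_q (k : ZMod (2 * N)) :
    DiagonalizedOnCore (p k + q k) (fourierImp N * gaussSq (1 / 2) k) (fun x => x k) := by
  refine ⟨temperate_coord k, ?_⟩
  have := (fourier_gaussSq_semiconj_p k).add_right (fourier_gaussSq_semiconj_q k)
  rwa [add_neg_cancel_comm] at this

theorem norm_cexp_real_mul_I {z : ℂ} (c : ℝ) (h : z = (c : ℂ) * Complex.I) :
    ‖Complex.exp z‖ = 1 := by
  rw [h, Complex.norm_exp_ofReal_mul_I]

theorem A_eq_op (k : ZMod (2 * N)) : A k = Implementer.op (implA k) := by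
  have h1 : fc (fun x => Complex.exp (3 * (Real.pi : ℂ) * Complex.I * (x : ℂ) ^ 2)) (q k) =
      Implementer.op (gaussSq (3 / 2) k) := by
    rw [q_eq_mulCore, (diagonalized_mulCore (temperate_coord k)).fc_phase
      (temperate_const_mul_sq (3 / 2) k) (Continuous.measurable (by fun_prop))
      (fun t => norm_cexp_real_mul_I (3 * Real.pi * t ^ 2) (by push_cast; ring))
      (fun x => by rw [phase]; congr 1; push_cast; ring), inv_one, one_mul, mul_one]
    rfl
  have h2 : fc (fun x => Complex.exp ((Real.pi : ℂ) * Complex.I * (x : ℂ) ^ 2)) (p k + q k) =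
      Implementer.op ((fourierImp N * gaussSq (1 / 2) k)⁻¹ * gaussSq (1 / 2) k *
      (fourierImp N * gaussSq (1 / 2) k)) := by
    rw [(diagonalized_p_add_q k).fc_phase
      (temperate_const_mul_sq (1 / 2) k) (Continuous.measurable (by fun_prop))
      (fun t => norm_cexp_real_mul_I (Real.pi * t ^ 2) (by push_cast; ring))
      (fun x => by rw [phase]; congr 1; push_cast; ring)]
    rfl
  rw [A, h1, h2, ← map_mul, implA, map_mul Implementer.op (gauss _ _), op_gauss_const,
    smul_one_mul]
  congr 2
  push_cast
  ring

/-- The factors of `A_k` are crossed from right to left: `S` becomes `T`, then `R`, is pulled back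
to `R'`, and ends as `S'`. The scalar factor plays no role. -/
theorem implA_semiconj {k : ZMod (2 * N)} {S T R R' : Module.End ℂ (Core N)}
    (h1 : SemiconjBy (fourierImp N * gaussSq (1 / 2) k).core S T)
    (h2 : SemiconjBy (gaussSq (1 / 2) k).core T R)
    (h3 : SemiconjBy (fourierImp N * gaussSq (1 / 2) k).core R' R)
    {S' : Module.End ℂ (Core N)} (h4 : SemiconjBy (gaussSq (3 / 2) k).core R' S') :
    SemiconjBy (implA k).core S S' :=
  Implementer.semiconjBy_mul (gauss_const_commute _ _) (Implementer.semiconjBy_mul h4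
    (Implementer.semiconjBy_mul (Implementer.semiconjBy_mul (Implementer.semiconjBy_inv h3) h2) h1))

theorem implA_semiconj_p (k : ZMod (2 * N)) : SemiconjBy (implA k).core (p k) (-q k) := by
  have h1 : SemiconjBy (gaussSq (1 / 2) k).core (p k + q k) (p k) := by
    have := SemiconjBy.add_right (gaussSq_half_semiconj_p k)
      (gauss_commute_q (temperate_const_mul_sq (1 / 2) k) k)
    rwa [sub_add_cancel] at this
  have h3 : SemiconjBy (fourierImp N * gaussSq (1 / 2) k).core (-q k) (p k) := by
    simpa using (fourier_gaussSq_semiconj_q k).neg_right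
  exact implA_semiconj (fourier_gaussSq_semiconj_p k) h1 h3
    (SemiconjBy.neg_right (gauss_commute_q (temperate_const_mul_sq (3 / 2) k) k))

theorem implA_semiconj_q (k : ZMod (2 * N)) : SemiconjBy (implA k).core (q k) (p k - q k) := by
  have h4 : SemiconjBy (fourierImp N * gaussSq (1 / 2) k).core (q k + (p k + q k))
      (-(p k - q k)) := by
    rw [neg_sub, sub_eq_add_neg, add_comm (q k : Module.End ℂ (Core N)) (-p k)]
    exact SemiconjBy.add_right (fourier_gaussSq_semiconj_q k) (diagonalized_p_add_q k).semiconj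
  -- The first three factors have turned `q` into `p + 2q`; the last Gaussian replaces `p` by `p -
  -- 3q`, leaving `p - q`.
  have h5 : SemiconjBy (gaussSq (3 / 2) k).core (q k + (p k + q k)) (p k - q k) := by
    have h6 := gaussSq_semiconj_p_self (3 / 2) k
    have h7 : SemiconjBy (gaussSq (3 / 2) k).core (q k) (q k) := gauss_commute_q _ k
    have h8 := SemiconjBy.add_right h7 (SemiconjBy.add_right h6 h7)
    convert! h8 using 1
    push_cast
    rw [show (2 * (3 / 2) : ℂ) = 1 + 1 + 1 by norm_num, add_smul, add_smul, one_smul]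
    abel
  exact implA_semiconj (fourier_gaussSq_semiconj_q k) (gaussSq_half_semiconj_p k).neg_right h4 h5

theorem implA_commute_p {j k : ZMod (2 * N)} (h : j ≠ k) : Commute (implA k).core (p j) := by
  have h1 : SemiconjBy (fourierImp N * gaussSq (1 / 2) k).core (p j) (q j) :=
    Implementer.semiconjBy_mul (fourierImp_semiconj_p j) (gaussSq_commute_p h _)
  exact implA_semiconj h1 (gauss_commute_q _ j) h1 (gaussSq_commute_p h _)

theorem implA_commute_q {j k : ZMod (2 * N)} (h : j ≠ k) : Commute (implA k).core (q j) := by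
  have h1 : SemiconjBy (fourierImp N * gaussSq (1 / 2) k).core (q j) (-p j) :=
    Implementer.semiconjBy_mul (fourierImp_semiconj_q j) (gauss_commute_q _ j)
  exact implA_semiconj h1 (SemiconjBy.neg_right (gaussSq_commute_p h _)) h1 (gauss_commute_q _ j)

theorem implA_inv_semiconj_q (k : ZMod (2 * N)) : SemiconjBy (implA k)⁻¹.core (q k) (-p k) := by
  simpa using (Implementer.semiconjBy_inv (implA_semiconj_p k)).neg_right

theorem implA_inv_semiconj_p (k : ZMod (2 * N)) :
    SemiconjBy (implA k)⁻¹.core (p k) (q k - p k) := by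
  have := (Implementer.semiconjBy_inv (implA_semiconj_q k)).add_right (implA_inv_semiconj_q k)
  rwa [sub_add_cancel, ← sub_eq_add_neg] at this

theorem implA_inv_commute_p {j k : ZMod (2 * N)} (h : j ≠ k) :
    Commute (implA k)⁻¹.core (p j) := Implementer.semiconjBy_inv (implA_commute_p h)

theorem implA_inv_commute_q {j k : ZMod (2 * N)} (h : j ≠ k) :
    Commute (implA k)⁻¹.core (q j) := Implementer.semiconjBy_inv (implA_commute_q h)

/-- For `l ≠ k` the implementer of `A_k` commutes with `p_l` and `q_l` on the Schwartz space, hence,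
by covariance of the functional calculus, with the functions of them that make up `A_l`. -/
theorem A_commute (k l : ZMod (2 * N)) : Commute (A k : L2 N →L[ℂ] L2 N) (A l) := by
  rcases eq_or_ne l k with rfl | h
  · exact Commute.refl _
  have h1 : SemiconjBy (implA k).core (q l) (mulCore fun x => ((x l : ℝ) : ℂ)) := implA_commute_q h
  have h2 := (diagonalized_mulCore (temperate_coord l)).semiconjBy_fc
    (G := fun x => Complex.exp (3 * (Real.pi : ℂ) * Complex.I * (x : ℂ) ^ 2))
    (Continuous.measurable (by fun_prop))
    (exists_bound_of_norm_eq_one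
      (fun t => norm_cexp_real_mul_I (3 * Real.pi * t ^ 2) (by push_cast; ring))) h1
  have h3 := (diagonalized_p_add_q l).semiconjBy_fc
    (G := fun x => Complex.exp ((Real.pi : ℂ) * Complex.I * (x : ℂ) ^ 2))
    (Continuous.measurable (by fun_prop))
    (exists_bound_of_norm_eq_one
      (fun t => norm_cexp_real_mul_I (Real.pi * t ^ 2) (by push_cast; ring)))
    ((implA_commute_p h).add_right (implA_commute_q h))
  rw [A_eq_op k, A]
  exact Commute.smul_right (SemiconjBy.mul_right h2 h3) _

theorem inverse_A (k : ZMod (2 * N)) :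
    Ring.inverse (A k) = Implementer.op (implA k)⁻¹ := by
  rw [A_eq_op, Implementer.inverse_op]

theorem A_mem_unitary (k : ZMod (2 * N)) : (A k : L2 N →L[ℂ] L2 N) ∈ unitary _ := by
  rw [A_eq_op]
  exact Implementer.op_mem_unitary _

theorem inverse_A_mul (k : ZMod (2 * N)) : Ring.inverse (A k) * A k = (1 : L2 N →L[ℂ] L2 N) := by
  rw [inverse_A, A_eq_op, Implementer.op_inv_mul]

theorem mul_inverse_A (k : ZMod (2 * N)) : A k * Ring.inverse (A k) = (1 : L2 N →L[ℂ] L2 N) := by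
  rw [inverse_A, A_eq_op, Implementer.op_mul_inv]

theorem inverse_A_commute_A (k l : ZMod (2 * N)) :
    Commute (Ring.inverse (A k)) (A l : L2 N →L[ℂ] L2 N) := by
  have h := A_commute (N := N) k l
  unfold Commute SemiconjBy at *
  calc _ = Ring.inverse (A k) * A l * (A k * Ring.inverse (A k)) := by rw [mul_inverse_A, mul_one]
    _ = Ring.inverse (A k) * (A l * A k) * Ring.inverse (A k) := by simp only [mul_assoc]
    _ = Ring.inverse (A k) * A k * A l * Ring.inverse (A k) := by rw [← h]; simp only [mul_assoc]
    _ = _ := by rw [inverse_A_mul, one_mul]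

end

section

/-! ## Arithmetic of the labels -/

section Labels

variable {N : ℕ}

/-- Parity of a label is well defined because `2N` is even: reduce modulo 2. -/
theorem two_mul_add_one_ne (l m : ZMod (2 * N)) : 2 * l + 1 ≠ 2 * m := by
  intro h
  have h1 := congrArg (ZMod.castHom (Dvd.intro N rfl) (ZMod 2)) h
  rw [map_add, map_mul, map_mul, map_one, map_ofNat] at h1
  rw [show (OfNat.ofNat 2 : ZMod 2) = 0 from rfl] at h1
  simp at h1

variable [NeZero N]

theorem two_mul_cast_inj {l m : ℕ} (hl : 1 ≤ l) (hlN : l ≤ N) (hm : 1 ≤ m) (hmN : m ≤ N)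
    (h : (2 * (l : ZMod (2 * N)) : ZMod (2 * N)) = 2 * (m : ZMod (2 * N))) : l = m := by
  have h1 : ((2 * l : ℕ) : ZMod (2 * N)) = ((2 * m : ℕ) : ZMod (2 * N)) := by exact_mod_cast h
  rw [ZMod.natCast_eq_natCast_iff] at h1
  have h2 : l ≡ m [MOD N] := Nat.ModEq.mul_left_cancel' (by norm_num) h1
  rcases Nat.lt_or_ge l N with h3 | h3
  · rcases Nat.lt_or_ge m N with h4 | h4
    · exact Nat.ModEq.eq_of_lt_of_lt h2 h3 h4
    · obtain rfl : m = N := le_antisymm hmN h4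
      have := h2.trans (show m ≡ 0 [MOD m] by simp [Nat.ModEq])
      have := Nat.ModEq.eq_of_lt_of_lt this h3 (by omega)
      omega
  · obtain rfl : l = N := le_antisymm hlN h3
    rcases Nat.lt_or_ge m l with h4 | h4
    · have := h2.symm.trans (show l ≡ 0 [MOD l] by simp [Nat.ModEq])
      have := Nat.ModEq.eq_of_lt_of_lt this h4 (by omega)
      omega
    · exact (le_antisymm hmN h4).symm

theorem castHom_two_eq (j : ZMod (2 * N)) :
    ZMod.castHom (Dvd.intro N rfl) (ZMod 2) j = (j.val : ZMod 2) := by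
  conv_lhs => rw [← ZMod.natCast_zmod_val j]
  rw [map_natCast]

theorem even_val_iff (j : ZMod (2 * N)) :
    Even j.val ↔ ZMod.castHom (Dvd.intro N rfl) (ZMod 2) j = 0 := by
  rw [castHom_two_eq, ZMod.natCast_eq_zero_iff_even]

theorem even_val_two_mul (j : ZMod (2 * N)) : Even (2 * j).val := by
  rw [even_val_iff, map_mul, map_ofNat, show (OfNat.ofNat 2 : ZMod 2) = 0 from rfl, zero_mul]

theorem not_even_val_add_one (j : ZMod (2 * N)) : ¬Even (j + 1).val ↔ Even j.val := by
  rw [even_val_iff, even_val_iff, map_add, map_one]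
  generalize ZMod.castHom (Dvd.intro N rfl) (ZMod 2) j = x
  revert x
  decide

theorem even_val_sub_one (j : ZMod (2 * N)) : Even (j - 1).val ↔ ¬Even j.val := by
  rw [← not_even_val_add_one, sub_add_cancel]

theorem exists_two_mul_eq {j : ZMod (2 * N)} (hj : Even j.val) :
    ∃ m : ℕ, 1 ≤ m ∧ m ≤ N ∧ j = 2 * (m : ZMod (2 * N)) := by
  obtain ⟨m, hm⟩ := hj
  have hlt := ZMod.val_lt j
  have hj : j = 2 * (m : ZMod (2 * N)) := by
    rw [← ZMod.natCast_zmod_val j, hm]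
    push_cast
    ring
  rcases Nat.eq_zero_or_pos m with rfl | h0
  · refine ⟨N, NeZero.one_le, le_rfl, ?_⟩
    have h1 : ((2 * N : ℕ) : ZMod (2 * N)) = 0 := ZMod.natCast_self _
    push_cast at h1
    rw [hj, h1]
    simp
  · exact ⟨m, h0, by omega, hj⟩

/-- Every label occurs exactly once in an ordered product over `1, …, 2N`, with `0` represented by
`2N`; the last clause is the uniqueness. -/
theorem exists_cast_eq (j : ZMod (2 * N)) :
    ∃ m : ℕ, 1 ≤ m ∧ m ≤ 2 * N ∧ (m : ZMod (2 * N)) = j ∧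
      ∀ k : ℕ, 1 ≤ k → k ≤ 2 * N → k ≠ m → j ≠ (k : ZMod (2 * N)) := by
  have h0 : ((2 * N : ℕ) : ZMod (2 * N)) = 0 := ZMod.natCast_self _
  have hN : 1 ≤ N := NeZero.one_le
  rcases Nat.eq_zero_or_pos j.val with hj | hj
  · have hj0 : j = 0 := (ZMod.val_eq_zero j).1 hj
    refine ⟨2 * N, by omega, le_rfl, by rw [h0, hj0], fun k h1 h2 h3 h4 => ?_⟩
    have := congrArg ZMod.val h4
    rw [ZMod.val_natCast, hj, Nat.mod_eq_of_lt (by omega)] at this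
    omega
  · refine ⟨j.val, hj, (ZMod.val_lt j).le, ZMod.natCast_zmod_val j, fun k h1 h2 h3 h4 => ?_⟩
    have := congrArg ZMod.val h4
    rw [ZMod.val_natCast] at this
    rcases Nat.lt_or_ge k (2 * N) with h5 | h5
    · rw [Nat.mod_eq_of_lt h5] at this
      omega
    · obtain rfl : k = 2 * N := by omega
      rw [Nat.mod_self] at this
      omega

end Labels

variable {N : ℕ} [NeZero N]

/-! ### Identities transported by conjugation -/

section Conjugation

variable {M : Type*} [Monoid M] {u v X Y : M}

theorem conj_mul_conj_eq_one (huv : u * v = 1) (hvu : v * u = 1) (h : X * Y = 1) :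
    v * X * u * (v * Y * u) = 1 := by
  calc v * X * u * (v * Y * u) = v * (X * (u * v) * Y) * u := by simp only [mul_assoc]
    _ = 1 := by rw [huv, mul_one, h, mul_one, hvu]

theorem conj_commute_conj (huv : u * v = 1) (h : Commute X Y) :
    Commute (v * X * u) (v * Y * u) := by
  unfold Commute SemiconjBy
  calc v * X * u * (v * Y * u) = v * (X * (u * v) * Y) * u := by simp only [mul_assoc]
    _ = v * (Y * (u * v) * X) * u := by rw [huv, mul_one, mul_one, h.eq]
    _ = _ := by simp only [mul_assoc]

end Conjugation

/-! ### Products of bounded multiplication operators -/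

section Multiplication

variable {X : Type*} [MeasurableSpace X] {μ : Measure X} {g h : X → ℂ}

theorem mulCLM_mul_apply (hg : Measurable g) (hh : Measurable h) (hC : ∃ C, ∀ x, ‖g x‖ ≤ C)
    (hD : ∃ C, ∀ x, ‖h x‖ ≤ C) (u : Lp ℂ 2 μ) :
    mulCLM μ g hg hC (mulCLM μ h hh hD u) =ᵐ[μ] fun x => g x * h x * u x := by
  filter_upwards [coeFn_mulCLM hg hC (mulCLM μ h hh hD u), coeFn_mulCLM hh hD u] with x h1 h2
  rw [h1, h2, mul_assoc]

theorem mulCLM_mul_eq_one (hg : Measurable g) (hh : Measurable h) (hC : ∃ C, ∀ x, ‖g x‖ ≤ C)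
    (hD : ∃ C, ∀ x, ‖h x‖ ≤ C) (h1 : ∀ x, g x * h x = 1) :
    mulCLM μ g hg hC * mulCLM μ h hh hD = 1 := by
  ext1 u
  refine Lp.ext ((mulCLM_mul_apply hg hh hC hD u).trans ?_)
  simp_rw [h1, one_mul]
  rfl

theorem mulCLM_commute (hg : Measurable g) (hh : Measurable h) (hC : ∃ C, ∀ x, ‖g x‖ ≤ C)
    (hD : ∃ C, ∀ x, ‖h x‖ ≤ C) : Commute (mulCLM μ g hg hC) (mulCLM μ h hh hD) := by
  refine ContinuousLinearMap.ext fun u => ?_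
  refine Lp.ext ((mulCLM_mul_apply hg hh hC hD u).trans ?_)
  simp_rw [mul_comm (g _)]
  exact (mulCLM_mul_apply hh hg hD hC u).symm

end Multiplication

/-! ## Functions of commuting diagonalized operators -/

namespace DiagonalizedOnCore

variable {S T : Module.End ℂ (Core N)} {g : Implementer N} {a c : Config N → ℝ}

theorem mul (h : DiagonalizedOnCore T g a) (h' : DiagonalizedOnCore S g c) :
    DiagonalizedOnCore (T * S) g (fun x => a x * c x) := by
  refine ⟨h.temperate.mul h'.temperate, ?_⟩
  have := h.semiconj.mul_right h'.semiconj
  rw [mulCore_mul (temperate_ofReal h.temperate) (temperate_ofReal h'.temperate)] at this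
  exact_mod_cast this

theorem add (h : DiagonalizedOnCore T g a) (h' : DiagonalizedOnCore S g c) :
    DiagonalizedOnCore (T + S) g (fun x => a x + c x) := by
  refine ⟨h.temperate.add h'.temperate, ?_⟩
  have := SemiconjBy.add_right h.semiconj h'.semiconj
  rw [← mulCore_add (temperate_ofReal h.temperate) (temperate_ofReal h'.temperate)] at this
  exact_mod_cast this

theorem neg (h : DiagonalizedOnCore T g a) : DiagonalizedOnCore (-T) g (fun x => -a x) := by
  refine ⟨temperate_neg h.temperate, ?_⟩
  have h1 : (mulCore fun x => ((-a x : ℝ) : ℂ)) = -mulCore fun x => (a x : ℂ) := by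
    simpa using mulCore_smul (temperate_ofReal h.temperate) (-1)
  rw [h1]
  exact h.semiconj.neg_right

theorem zero (g : Implementer N) : DiagonalizedOnCore 0 g fun _ => 0 := by
  refine ⟨Function.HasTemperateGrowth.const 0, ?_⟩
  simp only [Complex.ofReal_zero, mulCore_zero]
  exact SemiconjBy.zero_right _

theorem sum {ι : Type*} (s : Finset ι) {T : ι → Module.End ℂ (Core N)} {a : ι → Config N → ℝ}
    (h : ∀ i, DiagonalizedOnCore (T i) g (a i)) :
    DiagonalizedOnCore (∑ i ∈ s, T i) g (fun x => ∑ i ∈ s, a i x) := by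
  classical
  induction s using Finset.induction_on with
  | empty => simpa using zero g
  | insert i s hi ih =>
    simp only [Finset.sum_insert hi]
    exact (h i).add ih

theorem fc_mul_fc_eq_one (h : DiagonalizedOnCore T g a) {G G' : ℝ → ℂ} (hG : Measurable G)
    (hG' : Measurable G') (hb : ∃ C, ∀ x, ‖G x‖ ≤ C) (hb' : ∃ C, ∀ x, ‖G' x‖ ≤ C)
    (hGG : ∀ t, G t * G' t = 1) : fc G T * fc G' T = 1 := by
  rw [h.fc_eq hG hb, h.fc_eq hG' hb']
  exact conj_mul_conj_eq_one (Implementer.op_mul_inv g) (Implementer.op_inv_mul g)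
    (mulCLM_mul_eq_one _ _ _ _ fun x => hGG (a x))

theorem fc_commute (h : DiagonalizedOnCore T g a) (h' : DiagonalizedOnCore S g c) {G G' : ℝ → ℂ}
    (hG : Measurable G) (hG' : Measurable G') (hb : ∃ C, ∀ x, ‖G x‖ ≤ C)
    (hb' : ∃ C, ∀ x, ‖G' x‖ ≤ C) : Commute (fc G T) (fc G' S) := by
  rw [h.fc_eq hG hb, h'.fc_eq hG' hb']
  exact conj_commute_conj (Implementer.op_mul_inv g) (mulCLM_commute _ _ _ _)

theorem fc_mem_unitary (h : DiagonalizedOnCore T g a) {G : ℝ → ℂ} (hG : Measurable G)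
    (h1 : ∀ t, ‖G t‖ = 1) : fc G T ∈ unitary (L2 N →L[ℂ] L2 N) := by
  rw [h.fc_eq hG (exists_bound_of_norm_eq_one h1)]
  refine mul_mem (mul_mem (Implementer.op_mem_unitary _) ?_) (Implementer.op_mem_unitary _)
  exact (Unitary.linearIsometryEquiv.symm
    (mulIso volume (fun x => G (a x)) (hG.comp h.measurable) fun x => h1 (a x))).2

end DiagonalizedOnCore

theorem diagonalized_q (j : ZMod (2 * N)) : DiagonalizedOnCore (q j) 1 (fun x => x j) :=
  diagonalized_mulCore (temperate_coord j)

theorem diagonalized_p (j : ZMod (2 * N)) :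
    DiagonalizedOnCore (p j) (fourierImp N) (fun x => x j) :=
  ⟨temperate_coord j, fourierImp_semiconj_p j⟩

/-- A scalar of modulus one is a constant phase function, so scalar prefactors can be absorbed into
implementers. -/
theorem exists_implementer_smul {c : ℂ} (hc : ‖c‖ = 1) :
    ∃ g : Implementer N, Implementer.op g = c • 1 ∧ ∀ S, Commute g.core S := by
  obtain ⟨θ, hθ⟩ := (Complex.norm_eq_one_iff c).1 hc
  refine ⟨gauss (fun _ => θ / (2 * Real.pi)) (Function.HasTemperateGrowth.const _), ?_,
    fun S => gauss_const_commute _ S⟩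
  rw [op_gauss_const, ← hθ]
  congr 2
  have := Real.pi_ne_zero
  push_cast
  field_simp

theorem smul_mem_unitary {c : ℂ} (hc : ‖c‖ = 1) {X : L2 N →L[ℂ] L2 N} (hX : X ∈ unitary _) :
    c • X ∈ unitary (L2 N →L[ℂ] L2 N) := by
  obtain ⟨g, hg, -⟩ := exists_implementer_smul (N := N) hc
  rw [← one_mul X, ← smul_mul_assoc, ← hg]
  exact mul_mem (Implementer.op_mem_unitary g) hX

/-- A one-sided inverse does not suffice in infinite dimension; here `D` is already known to be
invertible, being unitary. -/
theorem inverse_eq_of_mul_eq_one {D X : L2 N →L[ℂ] L2 N} (hD : D ∈ unitary (L2 N →L[ℂ] L2 N))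
    (h : X * D = 1) : Ring.inverse D = X := by
  have h1 : D * star D = 1 := (Unitary.mem_iff.1 hD).2
  have h2 : star D * D = 1 := (Unitary.mem_iff.1 hD).1
  have h3 : Ring.inverse D = star D :=
    Ring.inverse_unit (⟨D, star D, h1, h2⟩ : (L2 N →L[ℂ] L2 N)ˣ)
  rw [h3]
  calc star D = X * D * star D := by rw [h, one_mul]
    _ = X := by rw [mul_assoc, h1, mul_one]

/-! ## The operators `exp (2πi p_k p_l)` -/

/-- The unitary operator `exp (2πi p_k p_l)`. -/
def implE (k l : ZMod (2 * N)) : Implementer N :=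
  (fourierImp N)⁻¹ * gaussMul 1 k l * fourierImp N

theorem implE_semiconj {k l : ZMod (2 * N)} {S S' T T' : Module.End ℂ (Core N)}
    (h1 : SemiconjBy (fourierImp N).core S T) (h2 : SemiconjBy (gaussMul 1 k l).core T T')
    (h3 : SemiconjBy (fourierImp N).core S' T') : SemiconjBy (implE k l).core S S' :=
  Implementer.semiconjBy_mul
    (Implementer.semiconjBy_mul (Implementer.semiconjBy_inv h3) h2) h1

theorem implE_commute_p (k l j : ZMod (2 * N)) : Commute (implE k l).core (p j) :=
  implE_semiconj (fourierImp_semiconj_p j) (gauss_commute_q _ j) (fourierImp_semiconj_p j)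

theorem implE_commute_q {k l j : ZMod (2 * N)} (hk : j ≠ k) (hl : j ≠ l) :
    Commute (implE k l).core (q j) :=
  implE_semiconj (fourierImp_semiconj_q j) (SemiconjBy.neg_right (gaussMul_commute_p hk hl 1))
    (fourierImp_semiconj_q j)

/-- In Fourier space `q_k` is `-p_k`; the Gaussian `exp (2πi x_k x_l)` adds `q_l`, which is `p_l` on
returning. -/
theorem implE_semiconj_q_left {k l : ZMod (2 * N)} (h : k ≠ l) :
    SemiconjBy (implE k l).core (q k) (q k + p l) := by
  refine implE_semiconj (fourierImp_semiconj_q k) (gaussMul_semiconj_p_left h 1).neg_right ?_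
  have := SemiconjBy.add_right (fourierImp_semiconj_q k) (fourierImp_semiconj_p l)
  rwa [Complex.ofReal_one, one_smul, neg_sub, sub_eq_neg_add]

theorem implE_semiconj_q_right {k l : ZMod (2 * N)} (h : k ≠ l) :
    SemiconjBy (implE k l).core (q l) (q l + p k) := by
  have : implE k l = implE l k := by rw [implE, implE, gaussMul_comm]
  rw [this]
  exact implE_semiconj_q_left h.symm

/-- The sum `q_k + q_l` gains exactly `p_k + p_l`. This removes the momenta that `A_k⁻¹` and `A_l⁻¹`
create in `κ(G)`. -/
theorem implE_semiconj_q_add_q {k l : ZMod (2 * N)} (h : k ≠ l) :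
    SemiconjBy (implE k l).core (q k + q l - p k - p l) (q k + q l) := by
  have h1 : SemiconjBy (implE k l).core (p k) (p k) := implE_commute_p k l k
  have h2 : SemiconjBy (implE k l).core (p l) (p l) := implE_commute_p k l l
  have h3 := ((SemiconjBy.add_right (implE_semiconj_q_left h)
    (implE_semiconj_q_right h)).sub_right h1).sub_right h2
  convert! h3 using 1
  abel

theorem gauss_zero (h : (fun _ : Config N => (0 : ℝ)).HasTemperateGrowth) : gauss _ h = 1 := by
  apply Implementer.op_injective
  rw [op_gauss_const, map_one]
  simp

theorem gaussMul_neg_one (k l : ZMod (2 * N)) : gaussMul (-1) k l = (gaussMul 1 k l)⁻¹ := by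
  rw [eq_inv_iff_mul_eq_one, gaussMul, gaussMul, gauss_mul_gauss]
  simp only [neg_one_mul, one_mul, neg_add_cancel]
  exact gauss_zero _

theorem measurable_cexp_two_pi : Measurable fun x : ℝ =>
    Complex.exp (2 * (Real.pi : ℂ) * Complex.I * (x : ℂ)) := Continuous.measurable (by fun_prop)

theorem norm_cexp_two_pi (x : ℝ) : ‖Complex.exp (2 * (Real.pi : ℂ) * Complex.I * (x : ℂ))‖ = 1 :=
  norm_cexp_real_mul_I (2 * Real.pi * x) (by push_cast; ring)

theorem measurable_cexp_neg_two_pi : Measurable fun x : ℝ =>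
    Complex.exp (-(2 * (Real.pi : ℂ) * Complex.I * (x : ℂ))) :=
  Continuous.measurable (by fun_prop)

theorem norm_cexp_neg_two_pi (x : ℝ) :
    ‖Complex.exp (-(2 * (Real.pi : ℂ) * Complex.I * (x : ℂ)))‖ = 1 :=
  norm_cexp_real_mul_I (-(2 * Real.pi * x)) (by push_cast; ring)

theorem fc_exp_p_mul_p (k l : ZMod (2 * N)) :
    fc (fun x => Complex.exp (-(2 * (Real.pi : ℂ) * Complex.I * (x : ℂ)))) (p k * p l) =
      Implementer.op (implE k l)⁻¹ := by
  rw [((diagonalized_p k).mul (diagonalized_p l)).fc_phase (temperate_const_mul_mul (-1) k l)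
    measurable_cexp_neg_two_pi norm_cexp_neg_two_pi
    (fun x => by rw [phase]; congr 1; push_cast; ring)]
  congr 1
  change (fourierImp N)⁻¹ * gaussMul (-1) k l * fourierImp N = _
  rw [gaussMul_neg_one, implE]
  group

theorem prodUpTo_gaussMul (n : ℕ) (k l : ℕ → ZMod (2 * N))
    (h : (fun x : Config N => ∑ j ∈ Finset.Icc 1 n, x (k j) * x (l j)).HasTemperateGrowth) :
    prodUpTo n (fun j => gaussMul 1 (k j) (l j)) = gauss _ h := by
  induction n with
  | zero =>
    simp only [prodUpTo_zero, Order.lt_one_iff, Finset.Icc_eq_empty_of_lt,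
      Finset.sum_empty]
    exact (gauss_zero _).symm
  | succ n ih =>
    have h1 : (fun x : Config N => ∑ j ∈ Finset.Icc 1 n, x (k j) * x (l j)).HasTemperateGrowth :=
      Function.HasTemperateGrowth.sum fun i _ => (temperate_coord _).mul (temperate_coord _)
    rw [prodUpTo_succ, ih h1, gaussMul, gauss_mul_gauss]
    congr 1
    funext x
    rw [Finset.sum_Icc_succ_top (by omega), one_mul]

variable (N) in
/-- The unitary operator `∏ exp (2πi p_{2j} p_{2j+1})`. -/
def implEProd : Implementer N :=
  prodUpTo N fun j => implE (2 * (j : ZMod (2 * N))) (2 * (j : ZMod (2 * N)) + 1)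

/-- The Fourier transform diagonalizes all the summands at once, so the exponential of the closed
sum is the product of the single exponentials. -/
theorem fc_exp_sum_p_mul_p :
    fc (fun x => Complex.exp (2 * (Real.pi : ℂ) * Complex.I * (x : ℂ)))
        (∑ j ∈ Finset.Icc 1 N,
          p (N := N) (2 * (j : ZMod (2 * N))) * p (2 * (j : ZMod (2 * N)) + 1)) =
      Implementer.op (implEProd N) := by
  have h := DiagonalizedOnCore.sum (Finset.Icc 1 N) fun j : ℕ =>
    (diagonalized_p (N := N) (2 * (j : ZMod (2 * N)))).mul
      (diagonalized_p (2 * (j : ZMod (2 * N)) + 1))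
  rw [h.fc_phase h.temperate measurable_cexp_two_pi norm_cexp_two_pi
    (fun x => by rw [phase]; push_cast; rfl)]
  congr 1
  have h1 := map_prodUpTo (MulAut.conj (fourierImp N)⁻¹).toMonoidHom N
    (fun j => gaussMul 1 (2 * (j : ZMod (2 * N))) (2 * (j : ZMod (2 * N)) + 1))
  rw [prodUpTo_gaussMul N _ _ h.temperate] at h1
  simpa [MulAut.conj_apply, implEProd, implE] using h1

/-! ## The flip operators -/

theorem measurable_phi_inv (b : ℂ) : Measurable fun x => (phi b x)⁻¹ := (measurable_phi b).inv

theorem diagonalized_q_add_q (k l : ZMod (2 * N)) :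
    DiagonalizedOnCore (q k + q l) 1 (fun x => x k + x l) :=
  (diagonalized_q k).add (diagonalized_q l)

theorem diagonalized_p_add_p (k l : ZMod (2 * N)) :
    DiagonalizedOnCore (p k + p l) (fourierImp N) (fun x => x k + x l) :=
  (diagonalized_p k).add (diagonalized_p l)

theorem Tcheck_eq (b : ℂ) (k l : ZMod (2 * N)) : Tcheck b k l =
    Implementer.op (implE k l)⁻¹ * fc (fun x => (phi b x)⁻¹) (q k + q l) := by
  rw [Tcheck, fc_exp_p_mul_p]

theorem Tcheck_mem_unitary {b : ℂ} (hb : b.im = 0 ∨ ‖b‖ = 1) (k l : ZMod (2 * N)) :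
    Tcheck b k l ∈ unitary (L2 N →L[ℂ] L2 N) := by
  rw [Tcheck_eq]
  exact mul_mem (Implementer.op_mem_unitary _)
    ((diagonalized_q_add_q k l).fc_mem_unitary (measurable_phi_inv b) (norm_phi_inv hb))

/-- `T_{k,ľ}` is conjugate to `T_{k,l}` by `A_l`. -/
theorem inverse_A_mul_T_mul_A {b : ℂ} (hb : b.im = 0 ∨ ‖b‖ = 1) {k l : ZMod (2 * N)} (hkl : k ≠ l) :
    Ring.inverse (A l) * T b k l * A l = Tcheck b k l := by
  -- The sign in `p_l ↦ -q_l` accounts for the opposite signs in the exponents of `T` and `Tcheck`.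
  have h1 : SemiconjBy (implA l).core (p k * p l) (-(p k * q l)) := by
    have := SemiconjBy.mul_right (implA_commute_p hkl) (implA_semiconj_p l)
    rwa [mul_neg] at this
  -- The same operators serve for diagonalization: `A_k` takes `p_k` to `-q_k` and commutes with
  -- `q_l`.
  have hd : DiagonalizedOnCore (-(p k * q l)) (implA k) (fun x => x k * x l) := by
    have h2 : SemiconjBy (implA k).core (-(p k * q l)) (q k * q l) := by
      have := (SemiconjBy.mul_right (implA_semiconj_p k) (implA_commute_q hkl.symm)).neg_right
      rwa [neg_mul, neg_neg] at this
    have := ((diagonalized_q k).mul (diagonalized_q l)).conj h2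
    rwa [one_mul] at this
  have h2 : fc (fun x => Complex.exp (-(2 * (Real.pi : ℂ) * Complex.I * (x : ℂ))))
      (-(p k * q l)) =
      fc (fun x => Complex.exp (2 * (Real.pi : ℂ) * Complex.I * (x : ℂ))) (p k * q l) := by
    have hd' := hd.neg
    rw [neg_neg] at hd'
    rw [hd.fc_phase (temperate_const_mul_mul (-1) k l) measurable_cexp_neg_two_pi
      norm_cexp_neg_two_pi (fun x => by rw [phase]; congr 1; push_cast; ring),
      hd'.fc_phase (temperate_const_mul_mul (-1) k l) measurable_cexp_two_pi
      norm_cexp_two_pi (fun x => by rw [phase]; congr 1; push_cast; ring)]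
  have h3 := hd.semiconjBy_fc measurable_cexp_neg_two_pi
    (exists_bound_of_norm_eq_one norm_cexp_neg_two_pi) h1
  rw [h2] at h3
  have h4 : SemiconjBy (implA l).core (q k + q l) (q k + p l - q l) := by
    rw [add_sub_assoc]
    exact SemiconjBy.add_right (implA_commute_q hkl) (implA_semiconj_q l)
  have h5 := ((diagonalized_q_add_q k l).conj (Implementer.semiconjBy_inv h4)).semiconjBy_fc
    (measurable_phi_inv b) (exists_bound_of_norm_eq_one (norm_phi_inv hb)) h4
  have h6 : SemiconjBy (Implementer.op (implA l)) (Tcheck b k l) (T b k l) :=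
    SemiconjBy.mul_right h3 h5
  rw [inverse_A, A_eq_op, mul_assoc, ← h6.eq, ← mul_assoc, Implementer.op_inv_mul, one_mul]

/-! ## The fractional Dehn twist -/

theorem fracDehnOp_mem_unitary {b : ℂ} (hb : b.im = 0 ∨ ‖b‖ = 1) :
    fracDehnOp N b ∈ unitary (L2 N →L[ℂ] L2 N) := by
  refine smul_mem_unitary (norm_zetaPow hb _) (mul_mem (mul_mem ?_ ?_) ?_)
  · exact Implementer.op_mem_unitary (permImp _)
  · exact prodUpTo_mem _ fun i _ _ => A_mem_unitary _
  · exact prodUpTo_mem _ fun i _ _ => Tcheck_mem_unitary hb _ _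

/-! ## The operator `κ(G)` -/

variable (N) in
/-- The unitary operator `∏ A_k⁻¹`. -/
def implAInvProd : Implementer N := prodUpTo (2 * N) fun k => (implA (k : ZMod (2 * N)))⁻¹

theorem op_implAInvProd : Implementer.op (implAInvProd N) =
    prodUpTo (2 * N) fun k => Ring.inverse (A (N := N) (k : ZMod (2 * N))) := by
  simp only [implAInvProd, map_prodUpTo, inverse_A]

theorem implAInvProd_semiconj_q (j : ZMod (2 * N)) :
    SemiconjBy (implAInvProd N).core (q j) (-p j) := by
  obtain ⟨m, h1, h2, rfl, h3⟩ := exists_cast_eq j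
  have h := map_prodUpTo (Implementer.coreHom (N := N)) (2 * N)
    fun k => (implA (k : ZMod (2 * N)))⁻¹
  change SemiconjBy (Implementer.coreHom (implAInvProd N)) _ _
  rw [implAInvProd, h]
  exact prodUpTo_semiconjBy_single m h1 h2 (implA_inv_semiconj_q _)
    (fun i h4 h5 h6 => implA_inv_commute_q (h3 i h4 h5 h6))
    (fun i h4 h5 h6 => SemiconjBy.neg_right (implA_inv_commute_p (h3 i h4 h5 h6)))

theorem implAInvProd_semiconj_p (j : ZMod (2 * N)) :
    SemiconjBy (implAInvProd N).core (p j) (q j - p j) := by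
  obtain ⟨m, h1, h2, rfl, h3⟩ := exists_cast_eq j
  have h := map_prodUpTo (Implementer.coreHom (N := N)) (2 * N)
    fun k => (implA (k : ZMod (2 * N)))⁻¹
  change SemiconjBy (Implementer.coreHom (implAInvProd N)) _ _
  rw [implAInvProd, h]
  exact prodUpTo_semiconjBy_single m h1 h2 (implA_inv_semiconj_p _)
    (fun i h4 h5 h6 => implA_inv_commute_p (h3 i h4 h5 h6))
    (fun i h4 h5 h6 => SemiconjBy.sub_right (implA_inv_commute_q (h3 i h4 h5 h6))
      (implA_inv_commute_p (h3 i h4 h5 h6)))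

theorem implEProd_commute_p (j : ZMod (2 * N)) : Commute (implEProd N).core (p j) := by
  change Commute (Implementer.coreHom (implEProd N)) _
  rw [implEProd, map_prodUpTo]
  exact prodUpTo_commute fun i _ _ => implE_commute_p _ _ j

/-- The pairs `{2m, 2m+1}` are disjoint, so only the exponential belonging to the pair of `k` acts.
-/
theorem implEProd_semiconj {k : ZMod (2 * N)} (hk : Even k.val) :
    SemiconjBy (implEProd N).core (q k + q (k + 1) - p k - p (k + 1)) (q k + q (k + 1)) := by
  obtain ⟨m, h1, h2, rfl⟩ := exists_two_mul_eq hk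
  change SemiconjBy (Implementer.coreHom (implEProd N)) _ _
  rw [implEProd, map_prodUpTo]
  have h3 : ∀ i, 1 ≤ i → i ≤ N → i ≠ m → Commute (implE (2 * (i : ZMod (2 * N)))
      (2 * (i : ZMod (2 * N)) + 1)).core
      (q (2 * (m : ZMod (2 * N))) + q (2 * (m : ZMod (2 * N)) + 1)) := fun i h4 h5 h6 => by
    have h7 : (2 * (m : ZMod (2 * N)) : ZMod (2 * N)) ≠ 2 * (i : ZMod (2 * N)) := fun h =>
      h6 (two_mul_cast_inj h1 h2 h4 h5 h).symm
    exact SemiconjBy.add_right (implE_commute_q h7 (two_mul_add_one_ne _ _).symm)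
      (implE_commute_q (two_mul_add_one_ne _ _) fun h => h7 (add_right_cancel h))
  refine prodUpTo_semiconjBy_single m h1 h2
    (implE_semiconj_q_add_q (two_mul_add_one_ne _ _).symm) (fun i h4 h5 h6 => ?_) h3
  exact SemiconjBy.sub_right (SemiconjBy.sub_right (h3 i h4 h5 h6) (implE_commute_p _ _ _))
    (implE_commute_p _ _ _)

/-- The shift lowers the labels by one. For even `j` the operators `A⁻¹` then turn each `p` into `q
- p`, and the exponential cancels the momenta; for odd `j` they turn each `q` into `-p`, with which
the exponential commutes. -/
theorem exists_implementer_kappaG {b : ℂ} (hb : b.im = 0 ∨ ‖b‖ = 1) :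
    ∃ g : Implementer N, Implementer.op g = kappaG N b ∧
    (∀ j : ZMod (2 * N), Even j.val →
      SemiconjBy g.core (p j + p (j - 1)) (q (j - 1) + q (j - 1 - 1))) ∧
    (∀ j : ZMod (2 * N), ¬Even j.val →
      SemiconjBy g.core (q j + q (j - 1)) (-(p (j - 1) + p (j - 1 - 1)))) := by
  obtain ⟨z, hz, hz'⟩ :=
    exists_implementer_smul (N := N) (norm_zetaPow hb ((N : ℝ) + 6 / (N : ℝ)))
  refine ⟨z * (implEProd N * implAInvProd N * permImp (Equiv.subRight 1)), ?_, fun j hj => ?_,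
    fun j hj => ?_⟩
  · rw [map_mul, map_mul, map_mul, hz, op_permImp, op_implAInvProd, kappaG, fc_exp_sum_p_mul_p,
      smul_one_mul]
  · have h1 : Even (j - 1 - 1).val := by
      rw [even_val_sub_one, even_val_sub_one, not_not]
      exact hj
    have h2 := implEProd_semiconj h1
    rw [sub_add_cancel] at h2
    rw [add_comm (q (j - 1 - 1)) (q (j - 1))] at h2
    have h3 := SemiconjBy.add_right (permImp_semiconj_p (Equiv.subRight 1) j)
      (permImp_semiconj_p (Equiv.subRight 1) (j - 1))
    have h4 := SemiconjBy.add_right (implAInvProd_semiconj_p (j - 1))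
      (implAInvProd_semiconj_p (j - 1 - 1))
    have h5 : (q (j - 1) - p (j - 1) + (q (j - 1 - 1) - p (j - 1 - 1)) :
        Module.End ℂ (Core N)) = q (j - 1) + q (j - 1 - 1) - p (j - 1 - 1) - p (j - 1) := by
      abel
    rw [h5] at h4
    have h6 := Implementer.semiconjBy_mul (Implementer.semiconjBy_mul h2 h4) h3
    exact Implementer.semiconjBy_mul (hz' _) h6
  · have h2 : SemiconjBy (implEProd N).core (-p (j - 1) + -p (j - 1 - 1))
        (-(p (j - 1) + p (j - 1 - 1))) := by
      rw [neg_add]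
      exact SemiconjBy.add_right (SemiconjBy.neg_right (implEProd_commute_p _))
        (SemiconjBy.neg_right (implEProd_commute_p _))
    have h3 := SemiconjBy.add_right (permImp_semiconj_q (Equiv.subRight 1) j)
      (permImp_semiconj_q (Equiv.subRight 1) (j - 1))
    have h4 := SemiconjBy.add_right (implAInvProd_semiconj_q (j - 1))
      (implAInvProd_semiconj_q (j - 1 - 1))
    have h6 := Implementer.semiconjBy_mul (Implementer.semiconjBy_mul h2 h4) h3
    exact Implementer.semiconjBy_mul (hz' _) h6

/-! ## The evolution operator -/

theorem fc_phi_mul_fc_phi_inv {b : ℂ} (hb : b.im = 0 ∨ ‖b‖ = 1) (k l : ZMod (2 * N)) :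
    fc (phi b) (q k + q l) * fc (fun x => (phi b x)⁻¹) (q k + q l) = 1 :=
  (diagonalized_q_add_q k l).fc_mul_fc_eq_one (measurable_phi b) (measurable_phi_inv b)
    (exists_bound_of_norm_eq_one (norm_phi hb)) (exists_bound_of_norm_eq_one (norm_phi_inv hb))
    fun _ => mul_inv_cancel₀ (Complex.exp_ne_zero _)

/-- Each exponential cancels the one inside the flip operator of the same pair and commutes with the
flip operators of the other pairs. -/
theorem op_implEProd_mul_prod_Tcheck {b : ℂ} (hb : b.im = 0 ∨ ‖b‖ = 1) :
    Implementer.op (implEProd N) *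
      prodUpTo N (fun l => Tcheck b (2 * (l : ZMod (2 * N)) + 1) (2 * (l : ZMod (2 * N)))) =
    prodUpTo N (fun l => fc (fun x => (phi b x)⁻¹)
      (q (N := N) (2 * (l : ZMod (2 * N)) + 1) + q (2 * (l : ZMod (2 * N))))) := by
  rw [implEProd, map_prodUpTo, ← prodUpTo_mul]
  · refine prodUpTo_congr fun i _ _ => ?_
    have : implE (2 * (i : ZMod (2 * N)) + 1) (2 * (i : ZMod (2 * N))) =
        implE (2 * (i : ZMod (2 * N))) (2 * (i : ZMod (2 * N)) + 1) := by
      rw [implE, implE, gaussMul_comm]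
    rw [Tcheck_eq, ← mul_assoc, this, Implementer.op_mul_inv, one_mul]
  · intro i j hi hi' hj hj' hij
    rw [Tcheck_eq]
    refine Commute.mul_right ?_ ?_
    · have h : Commute (implE (2 * (i : ZMod (2 * N))) (2 * (i : ZMod (2 * N)) + 1))
          (implE (2 * (j : ZMod (2 * N)) + 1) (2 * (j : ZMod (2 * N)))) := by
        unfold implE
        have h0 : Commute
            (gaussMul 1 (2 * (i : ZMod (2 * N))) (2 * (i : ZMod (2 * N)) + 1))
            (gaussMul 1 (2 * (j : ZMod (2 * N)) + 1) (2 * (j : ZMod (2 * N)))) :=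
          commute_gauss _ _
        simpa [MulAut.conj_apply] using h0.map (MulAut.conj (fourierImp N)⁻¹)
      exact (h.inv_right).map Implementer.op
    · have h7 : (2 * (j : ZMod (2 * N)) : ZMod (2 * N)) ≠ 2 * (i : ZMod (2 * N)) := fun h =>
        hij (two_mul_cast_inj hj hj' hi hi' h).symm
      exact (diagonalized_q_add_q _ _).semiconjBy_fc (measurable_phi_inv b)
        (exists_bound_of_norm_eq_one (norm_phi_inv hb))
        (SemiconjBy.add_right
          (implE_commute_q (two_mul_add_one_ne _ _) fun h => h7 (add_right_cancel h))
          (implE_commute_q h7 (two_mul_add_one_ne _ _).symm))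

theorem prod_fc_phi_mul_kappaG_mul_fracDehnOp {b : ℂ} (hb : b.im = 0 ∨ ‖b‖ = 1) :
    prodUpTo N (fun j => fc (phi b)
      (q (N := N) (2 * (j : ZMod (2 * N)) - 1) + q (2 * (j : ZMod (2 * N)) - 1 - 1))) *
      kappaG N b * fracDehnOp N b = 1 := by
  set F : ℕ → L2 N →L[ℂ] L2 N := fun j => fc (phi b)
      (q (N := N) (2 * (j : ZMod (2 * N)) - 1) + q (2 * (j : ZMod (2 * N)) - 1 - 1)) with hF
  set K : ℕ → L2 N →L[ℂ] L2 N := fun l => fc (fun x => (phi b x)⁻¹)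
      (q (N := N) (2 * (l : ZMod (2 * N)) + 1) + q (2 * (l : ZMod (2 * N)))) with hK
  -- The dilogarithms of the evolution operator are numbered one step ahead of those in the flips;
  -- this is repaired by a cyclic shift of commuting factors, with `K 0` as the left inverse of `F
  -- 1`.
  have hFs : ∀ l, F (l + 1) = fc (phi b)
      (q (N := N) (2 * (l : ZMod (2 * N)) + 1) + q (2 * (l : ZMod (2 * N)))) := fun l => by
    simp only [hF]
    push_cast
    rw [show (2 * ((l : ZMod (2 * N)) + 1) - 1 : ZMod (2 * N)) = 2 * l + 1 by ring,
      add_sub_cancel_right]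
  have hshift : prodUpTo N (fun l => F (l + 1)) = prodUpTo N F := by
    refine prodUpTo_shift (fun i j => ?_) ?_ (x := K 0) ?_
    · exact (diagonalized_q_add_q _ _).fc_commute (diagonalized_q_add_q _ _) (measurable_phi b)
        (measurable_phi b) (exists_bound_of_norm_eq_one (norm_phi hb))
        (exists_bound_of_norm_eq_one (norm_phi hb))
    · have h1 : ((2 * N : ℕ) : ZMod (2 * N)) = 0 := ZMod.natCast_self _
      push_cast at h1
      rw [hFs, show F 1 = F (0 + 1) from rfl, hFs, h1]
      simp
    · rw [show F 1 = F (0 + 1) from rfl, hFs]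
      exact (diagonalized_q_add_q _ _).fc_mul_fc_eq_one (measurable_phi_inv b) (measurable_phi b)
        (exists_bound_of_norm_eq_one (norm_phi_inv hb)) (exists_bound_of_norm_eq_one (norm_phi hb))
        fun _ => inv_mul_cancel₀ (Complex.exp_ne_zero _)
  have hFK : prodUpTo N F * prodUpTo N K = 1 := by
    rw [← hshift]
    refine prodUpTo_mul_eq_one (fun i j _ _ _ _ _ => ?_) fun i _ _ => ?_
    · rw [hFs]
      exact (diagonalized_q_add_q _ _).fc_commute (diagonalized_q_add_q _ _) (measurable_phi b)
        (measurable_phi_inv b) (exists_bound_of_norm_eq_one (norm_phi hb))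
        (exists_bound_of_norm_eq_one (norm_phi_inv hb))
    · rw [hFs]
      exact fc_phi_mul_fc_phi_inv hb _ _
  have hP : (P (Equiv.subRight (1 : ZMod (2 * N))) * P (Equiv.addRight (1 : ZMod (2 * N))) :
      L2 N →L[ℂ] L2 N) = 1 := by
    rw [P_mul, ← P_one]
    congr 1
    ext i
    simp
  have hA : prodUpTo (2 * N) (fun k => Ring.inverse (A (N := N) (k : ZMod (2 * N)))) *
      prodUpTo (2 * N) (fun k => A (N := N) (k : ZMod (2 * N))) = 1 :=
    prodUpTo_mul_eq_one (fun i j _ _ _ _ _ => inverse_A_commute_A _ _)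
      fun i _ _ => inverse_A_mul _
  have hz : zetaPow b ((N : ℝ) + 6 / (N : ℝ)) * zetaPow b (-(N : ℝ) - 6 / (N : ℝ)) = 1 := by
    rw [show -(N : ℝ) - 6 / (N : ℝ) = -((N : ℝ) + 6 / (N : ℝ)) by ring, zetaPow_mul_neg]
  have hE := op_implEProd_mul_prod_Tcheck (N := N) hb
  rw [kappaG, fracDehnOp, fc_exp_sum_p_mul_p, mul_assoc, smul_mul_smul_comm, hz, one_smul]
  set E := Implementer.op (implEProd N)
  set IA := prodUpTo (2 * N) (fun k => Ring.inverse (A (N := N) (k : ZMod (2 * N))))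
  set AA := prodUpTo (2 * N) (fun k => A (N := N) (k : ZMod (2 * N)))
  set TT := prodUpTo N
    (fun l => Tcheck b (2 * (l : ZMod (2 * N)) + 1) (2 * (l : ZMod (2 * N))))
  calc _ = prodUpTo N F * (E * (IA * (P (Equiv.subRight (1 : ZMod (2 * N))) *
        P (Equiv.addRight (1 : ZMod (2 * N)))) * AA) * TT) := by simp only [mul_assoc]
    _ = 1 := by rw [hP, mul_one, hA, mul_one, hE, hFK]

/-- Conjugation by `κ(G)` takes each even generator to the preceding odd one with sign `+`, and
functions of them accordingly. -/
theorem kappaG_mul_prod_fc_phi {b : ℂ} (hb : b.im = 0 ∨ ‖b‖ = 1) :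
    kappaG N b * prodUpTo N (fun j => fc (phi b)
      (p (N := N) (2 * (j : ZMod (2 * N))) + p (2 * (j : ZMod (2 * N)) - 1))) =
    prodUpTo N (fun j => fc (phi b)
      (q (N := N) (2 * (j : ZMod (2 * N)) - 1) + q (2 * (j : ZMod (2 * N)) - 1 - 1))) *
      kappaG N b := by
  obtain ⟨g, hg, hp, -⟩ := exists_implementer_kappaG (N := N) hb
  rw [← hg]
  have key : ∀ n, SemiconjBy (Implementer.op g) (prodUpTo n (fun j => fc (phi b)
      (p (N := N) (2 * (j : ZMod (2 * N))) + p (2 * (j : ZMod (2 * N)) - 1))))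
      (prodUpTo n (fun j => fc (phi b)
      (q (N := N) (2 * (j : ZMod (2 * N)) - 1) + q (2 * (j : ZMod (2 * N)) - 1 - 1)))) := by
    intro n
    induction n with
    | zero => exact SemiconjBy.one_right _
    | succ n ih =>
      rw [prodUpTo_succ, prodUpTo_succ]
      exact ih.mul_right ((diagonalized_q_add_q _ _).semiconjBy_fc (measurable_phi b)
        (exists_bound_of_norm_eq_one (norm_phi hb)) (hp _ (even_val_two_mul _)))
  exact key N

end

section

open MarkedPoint

/-! ## Moving distinguished corners -/

/-- The decorated triangle with the distinguished corner moved one step counterclockwise. -/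
def rotTriple (s : Triple) : Triple := ![s 1, s 2, s 0]

theorem rotTriple_apply (s : Triple) (i : Fin 3) : rotTriple s i = s (i + 1) := by
  fin_cases i <;> rfl

theorem rotTriple_rotTriple_rotTriple (s : Triple) : rotTriple (rotTriple (rotTriple s)) = s := by
  funext i
  fin_cases i <;> rfl

theorem ccw_rotTriple {s : Triple} (h : CCW (s 0) (s 1) (s 2)) :
    CCW (rotTriple s 0) (rotTriple s 1) (rotTriple s 2) := by
  change CCW (s 1) (s 2) (s 0)
  unfold CCW at *
  tauto

theorem interiorsDisjoint_rotTriple_left (s t : Triple) :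
    InteriorsDisjoint (rotTriple s) t ↔ InteriorsDisjoint s t := by
  unfold InteriorsDisjoint
  simp only [rotTriple_apply]
  exact ⟨fun ⟨i, h⟩ => ⟨i + 1, h⟩, fun ⟨i, h⟩ => ⟨i - 1, by simpa only [sub_add_cancel] using h⟩⟩

theorem interiorsDisjoint_rotTriple_right (s t : Triple) :
    InteriorsDisjoint s (rotTriple t) ↔ InteriorsDisjoint s t := by
  unfold InteriorsDisjoint
  simp only [rotTriple_apply]
  refine exists_congr fun i => ⟨fun h j => ?_, fun h j => h _⟩
  simpa only [sub_add_cancel] using h (j - 1)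

variable {N : ℕ}

/-- Moving the distinguished corner of a triangle of the annulus. -/
def AnnTriangle.rot : AnnTriangle N → AnnTriangle N :=
  Quotient.map (sa := deckSetoid N) (sb := deckSetoid N) rotTriple (by
    rintro s t ⟨k, h⟩
    refine ⟨k, fun i => ?_⟩
    rw [rotTriple_apply, rotTriple_apply, h])

theorem rot_toAnn (s : Triple) : (toAnn N s).rot = toAnn N (rotTriple s) := rfl

theorem AnnTriangle.rot_rot_rot (c : AnnTriangle N) : c.rot.rot.rot = c := by
  induction c using Quotient.inductionOn with
  | h s => exact congrArg (toAnn N) (rotTriple_rotTriple_rotTriple s)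

theorem exists_toAnn_eq (c : AnnTriangle N) : ∃ s, c = toAnn N s :=
  (Quotient.exists_rep c).imp fun _ h => h.symm

theorem exists_rotTriple_eq (s : Triple) : ∃ s', rotTriple s' = s :=
  ⟨_, rotTriple_rotTriple_rotTriple s⟩

theorem toAnn_rotTriple_eq_rot {s : Triple} {c : AnnTriangle N}
    (h : toAnn N (rotTriple s) = c.rot) : toAnn N s = c := by
  rw [← c.rot_rot_rot, ← h]
  exact (congrArg (toAnn N) (rotTriple_rotTriple_rotTriple s)).symm

/-- Moving the distinguished corner of the triangle number `i` of a triangulation. -/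
def DecTriangulation.rotAt (τ : DecTriangulation N) (i : ZMod (2 * N)) : DecTriangulation N where
  tri := Function.update τ.tri i (τ.tri i).rot
  ccw k s h := by
    by_cases hk : k = i
    · subst hk
      obtain ⟨s, rfl⟩ := exists_rotTriple_eq s
      rw [Function.update_self] at h
      exact ccw_rotTriple (τ.ccw _ _ (toAnn_rotTriple_eq_rot h))
    · rw [Function.update_of_ne hk] at h
      exact τ.ccw _ _ h
  disjoint k l s t hs ht hne := by
    by_cases hk : k = i <;> by_cases hl : l = i
    · subst hk; subst hl
      obtain ⟨s, rfl⟩ := exists_rotTriple_eq s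
      obtain ⟨t, rfl⟩ := exists_rotTriple_eq t
      rw [Function.update_self] at hs ht
      rw [interiorsDisjoint_rotTriple_left, interiorsDisjoint_rotTriple_right]
      exact τ.disjoint _ _ _ _ (toAnn_rotTriple_eq_rot hs) (toAnn_rotTriple_eq_rot ht)
        (hne.imp id fun h h' => h (congrArg _ h'))
    · subst hk
      obtain ⟨s, rfl⟩ := exists_rotTriple_eq s
      rw [Function.update_self] at hs
      rw [Function.update_of_ne hl] at ht
      rw [interiorsDisjoint_rotTriple_left]
      exact τ.disjoint _ _ _ _ (toAnn_rotTriple_eq_rot hs) ht (Or.inl (Ne.symm hl))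
    · subst hl
      obtain ⟨t, rfl⟩ := exists_rotTriple_eq t
      rw [Function.update_self] at ht
      rw [Function.update_of_ne hk] at hs
      rw [interiorsDisjoint_rotTriple_right]
      exact τ.disjoint _ _ _ _ hs (toAnn_rotTriple_eq_rot ht) (Or.inl hk)
    · rw [Function.update_of_ne hk] at hs
      rw [Function.update_of_ne hl] at ht
      exact τ.disjoint _ _ _ _ hs ht hne

theorem DecTriangulation.rotAt_rotAt_rotAt (τ : DecTriangulation N) (i : ZMod (2 * N)) :
    ((τ.rotAt i).rotAt i).rotAt i = τ := by
  ext1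
  simp [rotAt, AnnTriangle.rot_rot_rot]

theorem DecTriangulation.rotAt_rotAt_tri (τ : DecTriangulation N) (i : ZMod (2 * N)) :
    ((τ.rotAt i).rotAt i).tri = Function.update τ.tri i (τ.tri i).rot.rot := by
  simp [rotAt]

/-- Relabelling the triangles. -/
def DecTriangulation.relabel (τ : DecTriangulation N) (σ : Equiv.Perm (ZMod (2 * N))) :
    DecTriangulation N where
  tri k := τ.tri (σ k)
  ccw k := τ.ccw (σ k)
  disjoint k l s t hs ht hne :=
    τ.disjoint (σ k) (σ l) s t hs ht (hne.imp (fun h h' => h (σ.injective h')) id)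

/-! ## Triangulations with some diagonals flipped -/

open Classical in
/-- The triangles with numbers `2m` and `2m+1` fill the square with lower left corner `m`, cut by
the diagonal from the lower left to the upper right corner if `m` satisfies `χ` and by the other
diagonal otherwise. -/
def flipLift (χ : ℤ → Prop) (n : ℤ) : Triple :=
  -- With every square flipped this is literally the rotated standard triangulation; with none
  -- flipped it is the standard one with labels shifted and corners moved.
  if χ (n / 2) then fun i => MarkedPoint.rotateTop 1 (stdLift n i) else rotTriple (stdLift (n + 1))

section FlipLift

variable {χ : ℤ → Prop} {m : ℤ}

theorem flipLift_even_pos (h : χ m) : flipLift χ (2 * m) = ![.bot m, .top (m + 1), .top m] := by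
  have h1 : 2 * m / 2 = m := by omega
  rw [flipLift, h1, if_pos h, stdLift_even]
  funext i
  fin_cases i <;> simp [MarkedPoint.rotateTop]

theorem flipLift_odd_pos (h : χ m) :
    flipLift χ (2 * m + 1) = ![.top (m + 1), .bot m, .bot (m + 1)] := by
  have h1 : (2 * m + 1) / 2 = m := by omega
  rw [flipLift, h1, if_pos h, stdLift_odd]
  funext i
  fin_cases i <;> simp [MarkedPoint.rotateTop]

theorem flipLift_even_neg (h : ¬χ m) : flipLift χ (2 * m) = ![.bot m, .bot (m + 1), .top m] := by
  have h1 : 2 * m / 2 = m := by omega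
  rw [flipLift, h1, if_neg h, stdLift_odd]
  rfl

theorem flipLift_odd_neg (h : ¬χ m) :
    flipLift χ (2 * m + 1) = ![.top (m + 1), .top m, .bot (m + 1)] := by
  have h1 : (2 * m + 1) / 2 = m := by omega
  rw [flipLift, h1, if_neg h, show 2 * m + 1 + 1 = 2 * (m + 1) by ring, stdLift_even]
  funext i
  fin_cases i <;> simp [rotTriple]

theorem flipLift_cases (χ : ℤ → Prop) (n : ℤ) : ∃ m,
    (n = 2 * m ∧ (flipLift χ n = ![.bot m, .top (m + 1), .top m] ∧ χ m ∨
      flipLift χ n = ![.bot m, .bot (m + 1), .top m] ∧ ¬χ m)) ∨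
    (n = 2 * m + 1 ∧ (flipLift χ n = ![.top (m + 1), .bot m, .bot (m + 1)] ∧ χ m ∨
      flipLift χ n = ![.top (m + 1), .top m, .bot (m + 1)] ∧ ¬χ m)) := by
  refine ⟨n / 2, ?_⟩
  obtain ⟨m, rfl | rfl⟩ : ∃ m, n = 2 * m ∨ n = 2 * m + 1 := ⟨n / 2, by omega⟩
  · have h1 : 2 * m / 2 = m := by omega
    rw [h1]
    by_cases h : χ m
    · exact Or.inl ⟨rfl, Or.inl ⟨flipLift_even_pos h, h⟩⟩
    · exact Or.inl ⟨rfl, Or.inr ⟨flipLift_even_neg h, h⟩⟩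
  · have h1 : (2 * m + 1) / 2 = m := by omega
    rw [h1]
    by_cases h : χ m
    · exact Or.inr ⟨rfl, Or.inl ⟨flipLift_odd_pos h, h⟩⟩
    · exact Or.inr ⟨rfl, Or.inr ⟨flipLift_odd_neg h, h⟩⟩

theorem flipLift_ccw (χ : ℤ → Prop) (n : ℤ) :
    CCW (flipLift χ n 0) (flipLift χ n 1) (flipLift χ n 2) := by
  obtain ⟨m, ⟨-, ⟨h, -⟩ | ⟨h, -⟩⟩ | ⟨-, ⟨h, -⟩ | ⟨h, -⟩⟩⟩ := flipLift_cases χ n <;>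
  · rw [h]
    simp [CCW, Before]

/-- The triangle number `n` is contained in the square with lower left corner `n / 2`. -/
theorem vertices_flipLift (χ : ℤ → Prop) (n : ℤ) (j : Fin 3) :
    flipLift χ n j = .bot (n / 2) ∨ flipLift χ n j = .bot (n / 2 + 1) ∨
      flipLift χ n j = .top (n / 2) ∨ flipLift χ n j = .top (n / 2 + 1) := by
  obtain ⟨m, ⟨hn, ⟨h, -⟩ | ⟨h, -⟩⟩ | ⟨hn, ⟨h, -⟩ | ⟨h, -⟩⟩⟩ := flipLift_cases χ n <;>
  · have h1 : n / 2 = m := by omega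
    rw [h, h1]
    fin_cases j <;> simp

/-- Every triangle has an edge with the squares to the right on its outer side. -/
theorem exists_edge_right (χ : ℤ → Prop) (n : ℤ) : ∃ i : Fin 3, ∀ x : MarkedPoint,
    (∃ m', n / 2 < m' ∧ (x = .bot m' ∨ x = .bot (m' + 1) ∨ x = .top m' ∨ x = .top (m' + 1))) →
      x = flipLift χ n i ∨ x = flipLift χ n (i + 1) ∨
        CCW (flipLift χ n i) x (flipLift χ n (i + 1)) := by
  obtain ⟨m, ⟨hn, ⟨h, -⟩ | ⟨h, -⟩⟩ | ⟨hn, ⟨h, -⟩ | ⟨h, -⟩⟩⟩ := flipLift_cases χ n <;>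
    have h1 : n / 2 = m := by omega
  · refine ⟨0, ?_⟩
    rintro x ⟨m', h2, rfl | rfl | rfl | rfl⟩ <;> rw [h] <;> simp [CCW, Before] <;> omega
  · refine ⟨1, ?_⟩
    rintro x ⟨m', h2, rfl | rfl | rfl | rfl⟩ <;> rw [h] <;> simp [CCW, Before] <;> omega
  · refine ⟨2, ?_⟩
    rintro x ⟨m', h2, rfl | rfl | rfl | rfl⟩ <;> rw [h] <;> simp [CCW, Before] <;> omega
  · refine ⟨2, ?_⟩
    rintro x ⟨m', h2, rfl | rfl | rfl | rfl⟩ <;> rw [h] <;> simp [CCW, Before] <;> omega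

/-- Every triangle has an edge with the squares to the left on its outer side. -/
theorem exists_edge_left (χ : ℤ → Prop) (n : ℤ) : ∃ i : Fin 3, ∀ x : MarkedPoint,
    (∃ m', m' < n / 2 ∧ (x = .bot m' ∨ x = .bot (m' + 1) ∨ x = .top m' ∨ x = .top (m' + 1))) →
      x = flipLift χ n i ∨ x = flipLift χ n (i + 1) ∨
        CCW (flipLift χ n i) x (flipLift χ n (i + 1)) := by
  obtain ⟨m, ⟨hn, ⟨h, -⟩ | ⟨h, -⟩⟩ | ⟨hn, ⟨h, -⟩ | ⟨h, -⟩⟩⟩ := flipLift_cases χ n <;>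
    have h1 : n / 2 = m := by omega
  · refine ⟨2, ?_⟩
    rintro x ⟨m', h2, rfl | rfl | rfl | rfl⟩ <;> rw [h] <;> simp [CCW, Before] <;> omega
  · refine ⟨2, ?_⟩
    rintro x ⟨m', h2, rfl | rfl | rfl | rfl⟩ <;> rw [h] <;> simp [CCW, Before] <;> omega
  · refine ⟨0, ?_⟩
    rintro x ⟨m', h2, rfl | rfl | rfl | rfl⟩ <;> rw [h] <;> simp [CCW, Before] <;> omega
  · refine ⟨1, ?_⟩
    rintro x ⟨m', h2, rfl | rfl | rfl | rfl⟩ <;> rw [h] <;> simp [CCW, Before] <;> omega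

/-- Different squares are separated by an edge of the first triangle facing the second square. Two
triangles of one square are separated by its diagonal, which is edge `0` of both when flipped and
edge `1` of both otherwise. -/
theorem flipLift_disjoint (χ : ℤ → Prop) (n n' : ℤ) (h : n ≠ n') :
    InteriorsDisjoint (flipLift χ n) (flipLift χ n') := by
  rcases lt_trichotomy (n / 2) (n' / 2) with h1 | h1 | h1
  · obtain ⟨i, hi⟩ := exists_edge_right χ n
    exact ⟨i, fun j => hi _ ⟨n' / 2, h1, vertices_flipLift χ n' j⟩⟩
  · obtain ⟨m, ⟨hn, ⟨h2, hc⟩ | ⟨h2, hc⟩⟩ | ⟨hn, ⟨h2, hc⟩ | ⟨h2, hc⟩⟩⟩ := flipLift_cases χ n <;>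
    obtain ⟨m', ⟨hn', ⟨h3, hc'⟩ | ⟨h3, hc'⟩⟩ | ⟨hn', ⟨h3, hc'⟩ | ⟨h3, hc'⟩⟩⟩ :=
      flipLift_cases χ n' <;>
    obtain rfl : m = m' := by omega
    all_goals first
      | exact absurd hc hc'
      | exact absurd hc' hc
      | exact absurd (hn.trans hn'.symm) h
      | rw [h2, h3]
        first
          | (refine ⟨0, fun j => ?_⟩; fin_cases j <;> simp [CCW, Before]; done)
          | (refine ⟨1, fun j => ?_⟩; fin_cases j <;> simp [CCW, Before]; done)
  · obtain ⟨i, hi⟩ := exists_edge_left χ n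
    exact ⟨i, fun j => hi _ ⟨n' / 2, h1, vertices_flipLift χ n' j⟩⟩

theorem shift_rotTriple (k : ℤ) (s : Triple) (i : Fin 3) :
    shift k (rotTriple s i) = rotTriple (fun i => shift k (s i)) i := by
  fin_cases i <;> rfl

theorem flipLift_shift (hχ : ∀ m k, χ (m + N * k) ↔ χ m) (n k : ℤ) (i : Fin 3) :
    shift (N * k) (flipLift χ n i) = flipLift χ (n + 2 * N * k) i := by
  have h1 : (n + 2 * N * k) / 2 = n / 2 + N * k := by
    rw [mul_assoc, Int.add_mul_ediv_left _ _ (by norm_num)]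
  unfold flipLift
  rw [h1]
  by_cases h : χ (n / 2)
  · rw [if_pos h, if_pos ((hχ _ _).2 h), ← rotateTop_shift, stdLift_shift]
  · rw [if_neg h, if_neg (fun h' => h ((hχ _ _).1 h')), shift_rotTriple]
    simp_rw [stdLift_shift]
    rw [show n + 1 + 2 * N * k = n + 2 * N * k + 1 by ring]

theorem toAnn_flipLift_eq (hχ : ∀ m k, χ (m + N * k) ↔ χ m) {n n' : ℤ}
    (h : (n : ZMod (2 * N)) = n') : toAnn N (flipLift χ n) = toAnn N (flipLift χ n') := by
  rw [ZMod.intCast_eq_intCast_iff_dvd_sub] at h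
  obtain ⟨k, hk⟩ := h
  refine Quotient.sound (s := deckSetoid N) ⟨k, fun i => ?_⟩
  rw [flipLift_shift hχ]
  congr 1
  push_cast at hk
  linarith

theorem lift_of_toAnn_flipLift (hχ : ∀ m k, χ (m + N * k) ↔ χ m) (s : Triple) (n : ℤ)
    (h : toAnn N s = toAnn N (flipLift χ n)) : ∃ k : ℤ, s = flipLift χ (n + 2 * N * k) := by
  obtain ⟨k, hk⟩ := Quotient.exact (s := deckSetoid N) h.symm
  exact ⟨k, funext fun i => by rw [hk i, flipLift_shift hχ]⟩

end FlipLift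

theorem toAnn_stdLift_eq {n n' : ℤ} (h : (n : ZMod (2 * N)) = n') :
    toAnn N (stdLift n) = toAnn N (stdLift n') := by
  rw [ZMod.intCast_eq_intCast_iff_dvd_sub] at h
  obtain ⟨k, hk⟩ := h
  refine Quotient.sound (s := deckSetoid N) ⟨k, fun i => ?_⟩
  rw [stdLift_shift]
  congr 1
  push_cast at hk
  linarith

/-- The squares number `1, …, n` modulo `N`. -/
def upTo (N n : ℕ) (m : ℤ) : Prop := ∃ l : ℕ, 1 ≤ l ∧ l ≤ n ∧ (N : ℤ) ∣ m - l

/-- The difference `n + 1 - l` lies strictly between `0` and `N`, so no earlier flip has reached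
this square by wrapping around the annulus. -/
theorem not_upTo_succ {n : ℕ} (hn : n + 1 ≤ N) : ¬upTo N n ((n + 1 : ℕ) : ℤ) := by
  rintro ⟨l, h1, h2, h3⟩
  have := Int.le_of_dvd (by omega) h3
  omega

theorem rotateTop_toAnn (m : ℤ) (s : Triple) :
    (toAnn N s).rotateTop m = toAnn N fun i => MarkedPoint.rotateTop m (s i) := rfl

theorem rotateTop_vec (m : ℤ) (x y z : MarkedPoint) :
    (toAnn N ![x, y, z]).rotateTop m = toAnn N ![MarkedPoint.rotateTop m x,
      MarkedPoint.rotateTop m y, MarkedPoint.rotateTop m z] := by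
  rw [rotateTop_toAnn]
  congr 1
  funext i
  fin_cases i <;> rfl

theorem DecTriangulation.rotateTop_zero (τ : DecTriangulation N) : τ.rotateTop 0 = τ := by
  ext1
  funext k
  change (τ.tri k).rotateTop 0 = _
  obtain ⟨s, hs⟩ := exists_toAnn_eq (τ.tri k)
  rw [hs, rotateTop_toAnn]
  congr 1
  funext i
  cases s i <;> simp [MarkedPoint.rotateTop]

theorem DecTriangulation.rotateTop_rotateTop (τ : DecTriangulation N) (m n : ℤ) :
    (τ.rotateTop m).rotateTop n = τ.rotateTop (m + n) := by
  ext1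
  funext k
  change ((τ.tri k).rotateTop m).rotateTop n = (τ.tri k).rotateTop (m + n)
  obtain ⟨s, hs⟩ := exists_toAnn_eq (τ.tri k)
  rw [hs, rotateTop_toAnn, rotateTop_toAnn, rotateTop_toAnn]
  congr 1
  funext i
  cases s i <;> simp [MarkedPoint.rotateTop, add_assoc]

theorem rotateTop_update (m : ℤ) (F : ZMod (2 * N) → AnnTriangle N) (i : ZMod (2 * N))
    (c : AnnTriangle N) : (fun k => (Function.update F i c k).rotateTop m) =
      Function.update (fun k => (F k).rotateTop m) i (c.rotateTop m) := by
  funext k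
  by_cases h : k = i
  · subst h; simp
  · simp [h]

variable [NeZero N]

/-- The triangulation of the annulus with the diagonals of the squares in `χ` flipped. -/
def flipTriangulation (χ : ℤ → Prop) (hχ : ∀ m k, χ (m + N * k) ↔ χ m) : DecTriangulation N where
  tri k := toAnn N (flipLift χ k.val)
  ccw k s h := by
    obtain ⟨l, rfl⟩ := lift_of_toAnn_flipLift hχ s _ h
    exact flipLift_ccw _ _
  disjoint k l s t hs ht hne := by
    obtain ⟨a, rfl⟩ := lift_of_toAnn_flipLift hχ s _ hs
    obtain ⟨c, rfl⟩ := lift_of_toAnn_flipLift hχ t _ ht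
    refine flipLift_disjoint _ _ _ fun h => ?_
    rcases hne with hne | hne
    · apply hne
      have h2 := congrArg (fun n : ℤ => (n : ZMod (2 * N))) h
      have h0 : (2 * (N : ZMod (2 * N))) = 0 := by exact_mod_cast ZMod.natCast_self (2 * N)
      simpa [h0] using h2
    · exact hne (by rw [h])

theorem flipTriangulation_tri {χ : ℤ → Prop} (hχ : ∀ m k, χ (m + N * k) ↔ χ m)
    {k : ZMod (2 * N)} {n : ℤ} (h : (n : ZMod (2 * N)) = k) :
    (flipTriangulation χ hχ).tri k = toAnn N (flipLift χ n) :=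
  toAnn_flipLift_eq hχ (by rw [h]; simp)

theorem upTo_add (N n : ℕ) (m k : ℤ) : upTo N n (m + N * k) ↔ upTo N n m := by
  unfold upTo
  refine exists_congr fun l => and_congr_right fun _ => and_congr_right fun _ => ?_
  rw [show m + N * k - l = m - l + N * k by ring]
  exact (Int.dvd_add_left (Dvd.intro k rfl))

theorem upTo_zero (N : ℕ) (m : ℤ) : ¬upTo N 0 m := by
  rintro ⟨l, h1, h2, -⟩
  omega

theorem upTo_self (m : ℤ) : upTo N N m := by
  have hN : (0 : ℤ) < N := by exact_mod_cast Nat.pos_of_ne_zero (NeZero.ne N)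
  have h1 := Int.emod_nonneg (m - 1) hN.ne'
  have h2 := Int.emod_lt_of_pos (m - 1) hN
  -- Shifting by one selects the representative modulo `N` in `1, …, N` rather than in `0, …, N -
  -- 1`.
  refine ⟨((m - 1) % N).toNat + 1, by omega, by omega, ?_⟩
  rw [Nat.cast_add, Int.toNat_of_nonneg h1]
  have := Int.emod_add_mul_ediv (m - 1) N
  exact ⟨(m - 1) / N, by push_cast; linarith⟩

theorem upTo_succ (N n : ℕ) (m : ℤ) :
    upTo N (n + 1) m ↔ upTo N n m ∨ (N : ℤ) ∣ m - (n + 1 : ℕ) := by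
  constructor
  · rintro ⟨l, h1, h2, h3⟩
    rcases Nat.lt_or_ge l (n + 1) with h | h
    · exact Or.inl ⟨l, h1, by omega, h3⟩
    · obtain rfl : l = n + 1 := by omega
      exact Or.inr h3
  · rintro (⟨l, h1, h2, h3⟩ | h)
    · exact ⟨l, h1, by omega, h3⟩
    · exact ⟨n + 1, by omega, le_rfl, h⟩

variable (N) in
/-- The triangulation with the diagonals of the squares `1, …, n` flipped. -/
def flipUpTo (n : ℕ) : DecTriangulation N := flipTriangulation (upTo N n) (upTo_add N n)

/-! ## Quantization of the elementary moves -/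

variable {b : ℂ}

theorem Quantizes.rotAt (τ : DecTriangulation N) (i : ZMod (2 * N)) :
    Quantizes b τ (τ.rotAt i) (A i) := by
  obtain ⟨s, hs⟩ := exists_toAnn_eq (τ.tri i)
  refine Quantizes.rho τ (τ.rotAt i) i s hs ?_
  change Function.update τ.tri i (τ.tri i).rot = _
  rw [hs]
  rfl

/-- A third corner move returns to `τ`. Read backwards, this says that two moves are represented by
the inverse of `A i`. -/
theorem Quantizes.rotAt_rotAt (τ : DecTriangulation N) (i : ZMod (2 * N)) :
    Quantizes b ((τ.rotAt i).rotAt i) τ (A i) := by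
  have := Quantizes.rotAt (b := b) ((τ.rotAt i).rotAt i) i
  rwa [DecTriangulation.rotAt_rotAt_rotAt] at this

theorem Quantizes.prod_A (τ : DecTriangulation N) (n : ℕ) (hn : n ≤ 2 * N) :
    ∃ τ' : DecTriangulation N,
      (∀ k : ZMod (2 * N), (∃ i : ℕ, 1 ≤ i ∧ i ≤ n ∧ k = (i : ZMod (2 * N))) →
        τ'.tri k = (τ.tri k).rot) ∧
      (∀ k : ZMod (2 * N), (¬∃ i : ℕ, 1 ≤ i ∧ i ≤ n ∧ k = (i : ZMod (2 * N))) →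
        τ'.tri k = τ.tri k) ∧
      Quantizes b τ τ' (prodUpTo n fun k => A (N := N) (k : ZMod (2 * N))) := by
  induction n with
  | zero =>
    refine ⟨τ, ?_, fun _ _ => rfl, Quantizes.refl τ⟩
    rintro k ⟨i, h1, h2, -⟩
    omega
  | succ n ih =>
    obtain ⟨τ', h1, h2, h3⟩ := ih (by omega)
    refine ⟨τ'.rotAt ((n + 1 : ℕ) : ZMod (2 * N)), ?_, ?_, ?_⟩
    · rintro k ⟨i, hi, hi', rfl⟩
      rcases Nat.lt_or_ge i (n + 1) with h | h
      · obtain ⟨m, -, -, hm, hm'⟩ := exists_cast_eq (N := N) (i : ZMod (2 * N))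
        have hne : (i : ZMod (2 * N)) ≠ ((n + 1 : ℕ) : ZMod (2 * N)) := by
          have him : i = m := by
            by_contra hne
            exact hm' i hi (by omega) hne rfl
          exact hm' (n + 1) (by omega) hn (by omega)
        change Function.update _ _ _ _ = _
        rw [Function.update_of_ne hne, h1 _ ⟨i, hi, by omega, rfl⟩]
      · obtain rfl : i = n + 1 := by omega
        change Function.update _ _ _ _ = _
        rw [Function.update_self, h2]
        -- The triangle `n + 1` has not been touched before, as its label has only one
        -- representative in `1, …, 2N`.
        rintro ⟨j, hj, hj', hjn⟩
        obtain ⟨m, -, -, hm, hm'⟩ := exists_cast_eq (N := N) ((n + 1 : ℕ) : ZMod (2 * N))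
        by_cases him : j = m
        · exact hm' (n + 1) (by omega) hn (by omega) rfl
        · exact hm' j hj (by omega) him hjn
    · intro k hk
      change Function.update _ _ _ _ = _
      rw [Function.update_of_ne fun h => hk ⟨n + 1, by omega, le_rfl, h⟩, h2]
      exact fun ⟨i, hi, hi', h⟩ => hk ⟨i, hi, by omega, h⟩
    · rw [prodUpTo_succ]
      exact h3.trans _ _ _ _ _ (Quantizes.rotAt _ _)

/-- All distinguished corners may be moved at once. -/
theorem Quantizes.prod_A_all {τ τ' : DecTriangulation N} (h : ∀ k, τ'.tri k = (τ.tri k).rot) :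
    Quantizes b τ τ' (prodUpTo (2 * N) fun k => A (N := N) (k : ZMod (2 * N))) := by
  obtain ⟨τ'', h1, -, h3⟩ := Quantizes.prod_A (b := b) τ (2 * N) le_rfl
  have : τ'' = τ' := by
    ext1
    funext k
    obtain ⟨m, hm, hm', hk, -⟩ := exists_cast_eq k
    rw [h1 k ⟨m, hm, hm', hk.symm⟩, h k]
  rwa [this] at h3

theorem Quantizes.flipUpTo_zero :
    Quantizes b ((stdTriangulation N).relabel (Equiv.addRight 1)) (flipUpTo N 0)
      (prodUpTo (2 * N) fun k => A (N := N) (k : ZMod (2 * N))) := by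
  refine Quantizes.prod_A_all fun k => ?_
  change toAnn N (flipLift (upTo N 0) k.val) = toAnn N (rotTriple (stdLift (k + 1).val))
  rw [flipLift, if_neg (upTo_zero _ _), ← rot_toAnn, ← rot_toAnn]
  congr 1
  exact toAnn_stdLift_eq (by simp)

/-- The square number `n` modulo `N` contains exactly the triangles `2n` and `2n + 1`, so a flip
there changes no other label. -/
theorem eq_or_eq_add_one_of_dvd {k : ZMod (2 * N)} {n : ℕ}
    (h : (N : ℤ) ∣ (k.val : ℤ) / 2 - n) :
    k = 2 * (n : ZMod (2 * N)) ∨ k = 2 * (n : ZMod (2 * N)) + 1 := by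
  obtain ⟨c, hc⟩ := h
  have h0 : (2 * (N : ZMod (2 * N))) = 0 := by exact_mod_cast ZMod.natCast_self (2 * N)
  have hk : ((k.val : ℤ) : ZMod (2 * N)) = k := by simp
  rcases Int.emod_two_eq_zero_or_one (k.val : ℤ) with h1 | h1
  · left
    have h2 : (k.val : ℤ) = 2 * n + 2 * N * c := by
      have : (k.val : ℤ) = 2 * ((k.val : ℤ) / 2) := by omega
      rw [this]
      linarith
    rw [← hk, h2]
    push_cast
    rw [h0, zero_mul, add_zero]
  · right
    have h2 : (k.val : ℤ) = 2 * n + 1 + 2 * N * c := by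
      have : (k.val : ℤ) = 2 * ((k.val : ℤ) / 2) + 1 := by omega
      rw [this]
      linarith
    rw [← hk, h2]
    push_cast
    rw [h0, zero_mul, add_zero]

theorem flipUpTo_succ_tri {n : ℕ} {k : ZMod (2 * N)}
    (h0 : k ≠ 2 * ((n + 1 : ℕ) : ZMod (2 * N))) (h1 : k ≠ 2 * ((n + 1 : ℕ) : ZMod (2 * N)) + 1) :
    (flipUpTo N (n + 1)).tri k = (flipUpTo N n).tri k := by
  have h : ¬(N : ℤ) ∣ (k.val : ℤ) / 2 - (n + 1 : ℕ) := fun h =>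
    (eq_or_eq_add_one_of_dvd h).elim h0 h1
  change toAnn N (flipLift (upTo N (n + 1)) k.val) = toAnn N (flipLift (upTo N n) k.val)
  have hχ : upTo N (n + 1) ((k.val : ℤ) / 2) ↔ upTo N n ((k.val : ℤ) / 2) := by
    rw [upTo_succ]
    exact or_iff_left h
  by_cases hn : upTo N n ((k.val : ℤ) / 2)
  · rw [flipLift, flipLift, if_pos hn, if_pos (hχ.2 hn)]
  · rw [flipLift, flipLift, if_neg hn, if_neg (mt hχ.1 hn)]

/-- Moving the corner of the triangle `2l` two steps brings the square into the position required by
`omega`; the flip is made there, and a third move restores the corner. The operators along this path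
multiply to `A⁻¹ T A`, which is `Tcheck`. -/
theorem Quantizes.flipUpTo_succ (hb : b.im = 0 ∨ ‖b‖ = 1) {n : ℕ} (hn : n + 1 ≤ N) :
    Quantizes b (flipUpTo N n) (flipUpTo N (n + 1))
      (Tcheck b (2 * ((n + 1 : ℕ) : ZMod (2 * N)) + 1) (2 * ((n + 1 : ℕ) : ZMod (2 * N)))) := by
  set l : ℤ := ((n + 1 : ℕ) : ℤ) with hl
  set j : ZMod (2 * N) := 2 * ((n + 1 : ℕ) : ZMod (2 * N)) with hj
  have hij : j + 1 ≠ j := two_mul_add_one_ne _ _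
  have hcj : ((2 * l : ℤ) : ZMod (2 * N)) = j := by rw [hj, hl]; push_cast; rfl
  have hci : ((2 * l + 1 : ℤ) : ZMod (2 * N)) = j + 1 := by rw [← hcj]; push_cast; rfl
  have hneg : ¬upTo N n l := not_upTo_succ hn
  have hpos : upTo N (n + 1) l := ⟨n + 1, by omega, le_rfl, by simp [hl]⟩
  have e1 : (flipUpTo N n).tri j = toAnn N ![.bot l, .bot (l + 1), .top l] := by
    rw [← flipLift_even_neg hneg]; exact flipTriangulation_tri _ hcj
  have e2 : (flipUpTo N n).tri (j + 1) = toAnn N ![.top (l + 1), .top l, .bot (l + 1)] := by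
    rw [← flipLift_odd_neg hneg]; exact flipTriangulation_tri _ hci
  have e3 : (flipUpTo N (n + 1)).tri j = toAnn N ![.bot l, .top (l + 1), .top l] := by
    rw [← flipLift_even_pos hpos]; exact flipTriangulation_tri _ hcj
  have e4 : (flipUpTo N (n + 1)).tri (j + 1) =
      toAnn N ![.top (l + 1), .bot l, .bot (l + 1)] := by
    rw [← flipLift_odd_pos hpos]; exact flipTriangulation_tri _ hci
  rw [← inverse_A_mul_T_mul_A hb hij]
  refine Quantizes.trans _ (((flipUpTo N (n + 1)).rotAt j).rotAt j) _ _ _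
    (Quantizes.trans _ (((flipUpTo N n).rotAt j).rotAt j) _ _ _
      (Quantizes.symm _ _ _ (Quantizes.rotAt_rotAt _ j))
      (Quantizes.omega _ _ (j + 1) j hij (.top (l + 1)) (.top l) (.bot l) (.bot (l + 1))
        ?_ ?_ ?_)) (Quantizes.rotAt_rotAt _ j)
  · rw [DecTriangulation.rotAt_rotAt_tri, Function.update_of_ne hij, e2]
  · rw [DecTriangulation.rotAt_rotAt_tri, Function.update_self, e1]
    rfl
  · rw [DecTriangulation.rotAt_rotAt_tri, DecTriangulation.rotAt_rotAt_tri]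
    funext k
    by_cases hk : k = j
    · rw [hk, Function.update_self, Function.update_self, e3]
      rfl
    · rw [Function.update_of_ne hk, Function.update_of_ne hk]
      by_cases hk' : k = j + 1
      · rw [hk', Function.update_self, e4]
      · rw [Function.update_of_ne hk', Function.update_of_ne hk]
        exact flipUpTo_succ_tri hk hk'

theorem Quantizes.prod_Tcheck (hb : b.im = 0 ∨ ‖b‖ = 1) (n : ℕ) (hn : n ≤ N) :
    Quantizes b (flipUpTo N 0) (flipUpTo N n)
      (prodUpTo n fun l => Tcheck b (2 * (l : ZMod (2 * N)) + 1) (2 * (l : ZMod (2 * N)))) := by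
  induction n with
  | zero => exact Quantizes.refl _
  | succ n ih =>
    rw [prodUpTo_succ]
    exact (ih (by omega)).trans _ _ _ _ _ (Quantizes.flipUpTo_succ hb hn)

theorem flipUpTo_self : flipUpTo N N = (stdTriangulation N).rotateTop 1 := by
  ext1
  funext k
  change toAnn N (flipLift (upTo N N) k.val) = _
  rw [flipLift, if_pos (upTo_self _)]
  rfl

theorem Quantizes.fracDehnOp (hb : b.im = 0 ∨ ‖b‖ = 1) :
    Quantizes b (stdTriangulation N) ((stdTriangulation N).rotateTop 1) (fracDehnOp N b) := by
  refine Quantizes.phase _ _ _ _ (norm_zetaPow hb _) ?_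
  rw [← flipUpTo_self]
  exact Quantizes.trans _ (flipUpTo N 0) _ _ _
    (Quantizes.trans _ ((stdTriangulation N).relabel (Equiv.addRight 1)) _ _ _
      (Quantizes.relabel _ _ _ fun _ => rfl) Quantizes.flipUpTo_zero)
    (Quantizes.prod_Tcheck hb N le_rfl)

/-! ## Naturality under the mapping class group -/

/-- Elementary moves refer only to labels and to the cyclic sequence of vertices; a mapping class
moves the vertices and keeps the labels, hence the same operators. -/
theorem Quantizes.rotateTop {τ τ' : DecTriangulation N} {X : L2 N →L[ℂ] L2 N}
    (h : Quantizes b τ τ' X) (m : ℤ) : Quantizes b (τ.rotateTop m) (τ'.rotateTop m) X := by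
  induction h with
  | relabel τ τ' σ h =>
    exact Quantizes.relabel _ _ σ fun k => congrArg (AnnTriangle.rotateTop m) (h k)
  | rho τ τ' i s h h' =>
    refine Quantizes.rho _ _ i (fun i => MarkedPoint.rotateTop m (s i)) ?_ ?_
    · exact congrArg (AnnTriangle.rotateTop m) h
    · change (fun k => (τ'.tri k).rotateTop m) = _
      rw [h', rotateTop_update, rotateTop_vec]
      rfl
  | omega τ τ' i j hij L B R U hi hj h' =>
    refine Quantizes.omega _ _ i j hij (MarkedPoint.rotateTop m L) (MarkedPoint.rotateTop m B)
      (MarkedPoint.rotateTop m R) (MarkedPoint.rotateTop m U) ?_ ?_ ?_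
    · rw [← rotateTop_vec]
      exact congrArg (AnnTriangle.rotateTop m) hi
    · rw [← rotateTop_vec]
      exact congrArg (AnnTriangle.rotateTop m) hj
    · change (fun k => (τ'.tri k).rotateTop m) = _
      rw [h', rotateTop_update, rotateTop_update, rotateTop_vec, rotateTop_vec]
      rfl
  | refl τ => exact Quantizes.refl _
  | trans τ τ' τ'' X Y _ _ ihX ihY => exact Quantizes.trans _ _ _ _ _ ihX ihY
  | symm τ τ' X _ ih => exact Quantizes.symm _ _ _ ih
  | phase τ τ' X c hc _ ih => exact Quantizes.phase _ _ _ _ hc ih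

theorem Quantizes.pow {τ : DecTriangulation N} {X : L2 N →L[ℂ] L2 N}
    (h : Quantizes b τ (τ.rotateTop 1) X) (n : ℕ) : Quantizes b τ (τ.rotateTop n) (X ^ n) := by
  induction n with
  | zero =>
    rw [Nat.cast_zero, DecTriangulation.rotateTop_zero, pow_zero]
    exact Quantizes.refl τ
  | succ n ih =>
    rw [pow_succ]
    refine ih.trans _ _ _ _ _ ?_
    -- The next factor starts at the triangulation rotated by `n`, where naturality provides the
    -- same operator `X`.
    have := h.rotateTop n
    rwa [DecTriangulation.rotateTop_rotateTop, add_comm (1 : ℤ), ← Nat.cast_succ] at this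

end

section

/-! ## The realization of the observable algebra -/

/-- For `N = 1` the two neighbours of a label coincide, and the commutator of neighbouring
generators would be counted twice; this is where `N > 1` enters. -/
theorem sub_one_ne_add_one {N : ℕ} (hN : 1 < N) (m : ZMod (2 * N)) : m - 1 ≠ m + 1 := fun h => by
  have h2 : ((2 : ℕ) : ZMod (2 * N)) = 0 := by
    push_cast
    linear_combination -h
  rw [ZMod.natCast_eq_zero_iff] at h2
  have := Nat.le_of_dvd (by norm_num) h2
  omega

variable {N : ℕ} [NeZero N]

/-- The operator realizing the generator `f_j` of the observable algebra. -/
def obsOp (j : ZMod (2 * N)) : Module.End ℂ (Core N) :=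
  if Even j.val then p j + p (j - 1) else q j + q (j - 1)

theorem obsOp_of_even {j : ZMod (2 * N)} (h : Even j.val) : obsOp j = p j + p (j - 1) := if_pos h

theorem obsOp_of_not_even {j : ZMod (2 * N)} (h : ¬Even j.val) : obsOp j = q j + q (j - 1) :=
  if_neg h

theorem commConst_eq_zero {m n : ZMod (2 * N)} (h : Even m.val ↔ Even n.val) :
    commConst N m n = 0 := by
  refine if_neg ?_
  rintro (rfl | rfl)
  · have := not_even_val_add_one m
    tauto
  · have := even_val_sub_one m
    tauto

/-- Of the four elementary commutators two vanish because `m` and `n` differ in parity; the other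
two detect `n = m + 1` and `n = m - 1`, which exclude each other. -/
theorem commutator_p_add_q_add (hN : 1 < N) {m n : ZMod (2 * N)} (hm : Even m.val)
    (hn : ¬Even n.val) :
    ((p m + p (m - 1)) * (q n + q (n - 1)) - (q n + q (n - 1)) * (p m + p (m - 1)) :
      Module.End ℂ (Core N)) =
    (if n = m + 1 ∨ n = m - 1 then (2 * (Real.pi : ℂ) * Complex.I)⁻¹ else 0) • 1 := by
  have h1 : m ≠ n := fun h => hn (h ▸ hm)
  have h2 : m - 1 ≠ n - 1 := fun h => h1 (sub_left_injective h)
  have e : ((p m + p (m - 1)) * (q n + q (n - 1)) - (q n + q (n - 1)) * (p m + p (m - 1)) :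
      Module.End ℂ (Core N)) = (p m * q n - q n * p m) + (p m * q (n - 1) - q (n - 1) * p m) +
      (p (m - 1) * q n - q n * p (m - 1)) +
      (p (m - 1) * q (n - 1) - q (n - 1) * p (m - 1)) := by noncomm_ring
  rw [e, commutator_p_q, commutator_p_q, commutator_p_q, commutator_p_q, if_neg h1, if_neg h2]
  by_cases h3 : n = m + 1
  · have h4 : m - 1 ≠ n := fun h => sub_one_ne_add_one hN m (h.trans h3)
    rw [if_pos (by rw [h3, add_sub_cancel_right]), if_neg h4, if_pos (Or.inl h3)]
    simp
  · have h5 : m ≠ n - 1 := fun h => h3 (by rw [h, sub_add_cancel])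
    by_cases h4 : n = m - 1
    · rw [if_neg h5, if_pos h4.symm, if_pos (Or.inr h4)]
      simp
    · rw [if_neg h5, if_neg (Ne.symm h4), if_neg (not_or.2 ⟨h3, h4⟩)]
      simp

theorem commutator_obsOp (hN : 1 < N) (m n : ZMod (2 * N)) :
    obsOp m * obsOp n - obsOp n * obsOp m =
      algebraMap ℂ (Module.End ℂ (Core N)) (commConst N m n) := by
  rw [Algebra.algebraMap_eq_smul_one]
  by_cases hm : Even m.val <;> by_cases hn : Even n.val
  · rw [obsOp_of_even hm, obsOp_of_even hn, commConst_eq_zero (iff_of_true hm hn), zero_smul,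
      sub_eq_zero]
    exact ((commute_p _ _).add_right (commute_p _ _)).add_left
      ((commute_p _ _).add_right (commute_p _ _))
  · rw [obsOp_of_even hm, obsOp_of_not_even hn, commutator_p_add_q_add hN hm hn, commConst,
      hm.neg_one_pow, one_mul]
  · rw [obsOp_of_not_even hm, obsOp_of_even hn, ← neg_sub, commutator_p_add_q_add hN hn hm,
      commConst, (Nat.not_even_iff_odd.1 hm).neg_one_pow]
    -- Being neighbours is symmetric; the sign `(-1)^m` for odd `m` comes from exchanging the
    -- factors of the commutator.
    have h : (m = n + 1 ∨ m = n - 1) ↔ (n = m + 1 ∨ n = m - 1) := by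
      rw [← sub_eq_iff_eq_add, eq_sub_iff_add_eq, or_comm, eq_comm, eq_comm (a := m - 1)]
    simp only [h]
    split_ifs <;> simp
  · rw [obsOp_of_not_even hm, obsOp_of_not_even hn, commConst_eq_zero (iff_of_false hm hn),
      zero_smul, sub_eq_zero]
    exact ((commute_q _ _).add_right (commute_q _ _)).add_left
      ((commute_q _ _).add_right (commute_q _ _))

/-- The realization of the observable algebra on the Schwartz space. -/
def realization (hN : 1 < N) : ObsAlgebra N →ₐ[ℂ] Module.End ℂ (Core N) :=
  RingQuot.liftAlgHom ℂ ⟨FreeAlgebra.lift ℂ obsOp, by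
    rintro _ _ ⟨m, n⟩
    rw [map_sub, map_mul, map_mul, FreeAlgebra.lift_ι_apply, FreeAlgebra.lift_ι_apply,
      AlgHom.commutes, commutator_obsOp hN]⟩

theorem realization_f (hN : 1 < N) (j : ZMod (2 * N)) : realization hN (f j) = obsOp j := by
  rw [realization, f, RingQuot.liftAlgHom_mkAlgHom_apply, FreeAlgebra.lift_ι_apply]

theorem isSelfAdjoint_closedOp_obsOp (j : ZMod (2 * N)) : IsSelfAdjoint (closedOp (obsOp j)) := by
  by_cases h : Even j.val
  · rw [obsOp_of_even h]
    exact (diagonalized_p_add_p _ _).isSelfAdjoint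
  · rw [obsOp_of_not_even h]
    exact (diagonalized_q_add_q _ _).isSelfAdjoint

theorem kappaG_mem_unitary {b : ℂ} (hb : b.im = 0 ∨ ‖b‖ = 1) :
    kappaG N b ∈ unitary (L2 N →L[ℂ] L2 N) := by
  obtain ⟨g, hg, -⟩ := exists_implementer_kappaG (N := N) hb
  exact hg ▸ g.op_mem_unitary

theorem mem_graph_closedOp_obsOp_iff {b : ℂ} (hb : b.im = 0 ∨ ‖b‖ = 1) (j : ZMod (2 * N))
    (ψ χ : L2 N) : (ψ, χ) ∈ (closedOp (obsOp j)).graph ↔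
      (kappaG N b ψ, (-1 : ℂ) ^ j.val • kappaG N b χ) ∈ (closedOp (obsOp (j - 1))).graph := by
  obtain ⟨g, hg, hp, hq⟩ := exists_implementer_kappaG (N := N) hb
  rw [← hg, Implementer.op_apply, Implementer.op_apply]
  by_cases h : Even j.val
  · rw [obsOp_of_even h, obsOp_of_not_even fun h' => (even_val_sub_one j).1 h' h, h.neg_one_pow]
    have := (diagonalized_q_add_q (j - 1) (j - 1 - 1)).mem_graph_closedOp_iff 1 (one_mul 1)
      (by simpa using hp j h) ψ χ
    simpa using this
  · rw [obsOp_of_not_even h, obsOp_of_even ((even_val_sub_one j).2 h),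
      (Nat.not_even_iff_odd.1 h).neg_one_pow]
    -- For odd labels the image carries the sign `-1`, which appears as the scalar in front of the
    -- second component of the graph.
    have := (diagonalized_p_add_p (j - 1) (j - 1 - 1)).mem_graph_closedOp_iff (-1) (by norm_num)
      (by rw [Complex.ofReal_neg, Complex.ofReal_one, neg_one_smul]; exact hq j h) ψ χ
    simpa using this



theorem evolOdd_eq_inverse {b : ℂ} (hb : b.im = 0 ∨ ‖b‖ = 1)
    {κ : ObsAlgebra N →ₐ[ℂ] Module.End ℂ (Core N)} (hκ : ∀ j, κ (f j) = obsOp j) :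
    evolOdd b κ (kappaG N b) = Ring.inverse (fracDehnOp N b) := by
  refine (inverse_eq_of_mul_eq_one (fracDehnOp_mem_unitary hb) ?_).symm
  rw [← prod_fc_phi_mul_kappaG_mul_fracDehnOp hb, evolOdd]
  congr 3
  funext j
  rw [hκ, obsOp_of_not_even fun h => (even_val_sub_one _).1 h (even_val_two_mul _)]

theorem evolEven_eq_evolOdd {b : ℂ} (hb : b.im = 0 ∨ ‖b‖ = 1)
    {κ : ObsAlgebra N →ₐ[ℂ] Module.End ℂ (Core N)} (hκ : ∀ j, κ (f j) = obsOp j) :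
    evolEven b κ (kappaG N b) = evolOdd b κ (kappaG N b) := by
  have h1 : ∀ j : ℕ, κ (f (2 * (j : ZMod (2 * N)))) =
      p (2 * (j : ZMod (2 * N))) + p (2 * (j : ZMod (2 * N)) - 1) := fun j => by
    rw [hκ, obsOp_of_even (even_val_two_mul _)]
  have h2 : ∀ j : ℕ, κ (f (2 * (j : ZMod (2 * N)) - 1)) =
      q (2 * (j : ZMod (2 * N)) - 1) + q (2 * (j : ZMod (2 * N)) - 1 - 1) := fun j => by
    rw [hκ, obsOp_of_not_even fun h => (even_val_sub_one _).1 h (even_val_two_mul _)]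
  simp only [evolEven, evolOdd, h1, h2]
  exact kappaG_mul_prod_fc_phi hb

end

end QuantumLiouville

end

open QuantumLiouville in
theorem mainTheorem1 (N : ℕ) [NeZero N] (hN : 1 < N) (b : ℂ) (hb : b.re ≠ 0)
    (hb' : b.im = 0 ∨ ‖b‖ = 1) :
    -- the fractional Dehn twist operator and the Dehn twist operator
    (fracDehnOp N b ∈ unitary (L2 N →L[ℂ] L2 N) ∧
      Quantizes b (stdTriangulation N) ((stdTriangulation N).rotateTop 1) (fracDehnOp N b) ∧
      Quantizes b (stdTriangulation N) ((stdTriangulation N).rotateTop N) (dehnOp N b)) ∧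
    ∃ κ : ObsAlgebra N →ₐ[ℂ] Module.End ℂ (Core N),
      -- the realization of the observable algebra
      (∀ j : ZMod (2 * N),
        κ (f j) = if Even j.val then p j + p (j - 1) else q j + q (j - 1)) ∧
      (∀ j : ZMod (2 * N), IsSelfAdjoint (closedOp (κ (f j)))) ∧
      kappaG N b ∈ unitary (L2 N →L[ℂ] L2 N) ∧
      (∀ (j : ZMod (2 * N)) (ψ χ : L2 N),
        (ψ, χ) ∈ (closedOp (κ (f j))).graph ↔
          (kappaG N b ψ, (-1 : ℂ) ^ j.val • kappaG N b χ) ∈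
            (closedOp (κ (f (j - 1)))).graph) ∧
      -- the light-cone evolution operator
      evolEven b κ (kappaG N b) = Ring.inverse (fracDehnOp N b) ∧
      evolOdd b κ (kappaG N b) = Ring.inverse (fracDehnOp N b) ∧
      evolEven b κ (kappaG N b) ^ N = Ring.inverse (dehnOp N b) := by
  have hκ := realization_f hN
  have hodd := evolOdd_eq_inverse hb' hκ
  have heven := (evolEven_eq_evolOdd hb' hκ).trans hodd
  refine ⟨⟨fracDehnOp_mem_unitary hb', Quantizes.fracDehnOp hb',
    (Quantizes.fracDehnOp hb').pow N⟩, realization hN, hκ, fun j => ?_, kappaG_mem_unitary hb',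
    fun j ψ χ => ?_, heven, hodd, ?_⟩
  · rw [hκ]
    exact isSelfAdjoint_closedOp_obsOp j
  · rw [hκ, hκ]
    exact mem_graph_closedOp_obsOp_iff hb' j ψ χ
  · rw [heven, dehnOp, Ring.inverse_pow]
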